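/- Let $(M^{2n},g,J)$ be a connected Kähler manifold of real dimension $2n\ge 4$, where the metric $g$ may have arbitrary signature: $g$ is a smooth pseudo-Riemannian metric and $J$ is a complex structure with $g(J\cdot,J\cdot)=g$ and $\nabla J=0$, $\nabla$ being the Levi-Civita connection of $g$. A comma denotes covariant differentiation with respect to $\nabla$. Put $J_{jk}=g_{j\alpha}J^\alpha{}_k$ and $\bar\omega_i=J^\alpha{}_i\,\omega_\alpha$ for a $1$-form $\omega_i$. A *solution* of the h-projective equation is a pair $(a_{ij},\lambda_i)$ of a smooth symmetric hermitian ($a(J\cdot,J\cdot)=a$) $(0,2)$-tensor and a smooth $1$-form such that $$a_{ij,k}=\lambda_i g_{jk}+\lambda_j g_{ik}-\bar\lambda_i J_{jk}-\bar\lambda_j J_{ik}.\qquad(1)$$ The solutions form a real vector space, whose dimension is called the *degree of mobility* of $g$. Suppose that the degree of mobility of $g$ is at least $3$. Then for every solution $(a_{ij},\lambda_i)$ of (1) such that $a_{ij}$ is not a constant multiple of $g_{ij}$, there are a unique constant $B\in\mathbb R$ and a smooth function $\mu$ on $M$ such that, together with (1), $$\lambda_{i,j}=\mu\, g_{ij}+B\,a_{ij},\qquad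 \mu_{,i}=2B\lambda_i$$ hold on all of $M$. The constant $B$ is the same for all such solutions. -/

import Mathlib

open scoped Manifold ContDiff Bundle

noncomputable section

namespace Kahler

/-! ### Tensor fields on a manifold `M` modelled on `E` -/

/-- `(0,1)`-tensors on `M` (no regularity imposed). -/
abbrev CovectorField (E : Type*) [NormedAddCommGroup E] [NormedSpace ℝ E]
    (M : Type*) [TopologicalSpace M] [ChartedSpace E M] : Type _ :=
  Π p : M, TangentSpace 𝓘(ℝ, E) p →L[ℝ] ℝ

/-- `(0,2)`-tensors on `M` (no regularity imposed). -/
abbrev BilinField (E : Type*) [NormedAddCommGroup E] [NormedSpace ℝ E]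
    (M : Type*) [TopologicalSpace M] [ChartedSpace E M] : Type _ :=
  Π p : M, TangentSpace 𝓘(ℝ, E) p →L[ℝ] TangentSpace 𝓘(ℝ, E) p →L[ℝ] ℝ

/-- `(1,1)`-tensors on `M`, i.e. fields of endomorphisms (no regularity imposed). -/
abbrev EndField (E : Type*) [NormedAddCommGroup E] [NormedSpace ℝ E]
    (M : Type*) [TopologicalSpace M] [ChartedSpace E M] : Type _ :=
  Π p : M, TangentSpace 𝓘(ℝ, E) p →L[ℝ] TangentSpace 𝓘(ℝ, E) p

section Smoothness

variable {E : Type*} [NormedAddCommGroup E] [NormedSpace ℝ E]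
  {M : Type*} [TopologicalSpace M] [ChartedSpace E M] [IsManifold 𝓘(ℝ, E) ∞ M]

/-- The `1`-form `l` is a smooth section of the cotangent bundle. -/
def SmoothCovector (l : CovectorField E M) : Prop :=
  ContMDiff 𝓘(ℝ, E) (𝓘(ℝ, E).prod 𝓘(ℝ, E →L[ℝ] ℝ)) ∞
    (fun p ↦ Bundle.TotalSpace.mk' (E →L[ℝ] ℝ)
      (E := fun p : M ↦ (TangentSpace 𝓘(ℝ, E) p →L[ℝ] ℝ)) p (l p))

/-- The `(0,2)`-tensor `T` is a smooth section. -/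
def SmoothBilin (T : BilinField E M) : Prop :=
  ContMDiff 𝓘(ℝ, E) (𝓘(ℝ, E).prod 𝓘(ℝ, E →L[ℝ] E →L[ℝ] ℝ)) ∞
    (fun p ↦ Bundle.TotalSpace.mk' (E →L[ℝ] E →L[ℝ] ℝ)
      (E := fun p : M ↦
        (TangentSpace 𝓘(ℝ, E) p →L[ℝ] TangentSpace 𝓘(ℝ, E) p →L[ℝ] ℝ)) p (T p))

/-- The `(1,1)`-tensor `J` is a smooth section of the endomorphism bundle. -/
def SmoothEnd (J : EndField E M) : Prop :=
  ContMDiff 𝓘(ℝ, E) (𝓘(ℝ, E).prod 𝓘(ℝ, E →L[ℝ] E)) ∞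
    (fun p ↦ Bundle.TotalSpace.mk' (E →L[ℝ] E)
      (E := fun p : M ↦ (TangentSpace 𝓘(ℝ, E) p →L[ℝ] TangentSpace 𝓘(ℝ, E) p)) p (J p))

end Smoothness

/-! ### Components in a chart -/

section Components

variable {E : Type*} [NormedAddCommGroup E] [NormedSpace ℝ E]
  {M : Type*} [TopologicalSpace M] [ChartedSpace E M]

/-- The coordinate frame of the chart `c` at the point with coordinates `y`:
the derivative of the inverse chart. -/
def frame (c : OpenPartialHomeomorph M E) (y : E) :
    E →L[ℝ] TangentSpace 𝓘(ℝ, E) (c.symm y) :=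
  mfderiv 𝓘(ℝ, E) 𝓘(ℝ, E) c.symm y

/-- The dual coordinate coframe: the derivative of the chart. -/
def coframe (c : OpenPartialHomeomorph M E) (y : E) :
    TangentSpace 𝓘(ℝ, E) (c.symm y) →L[ℝ] E :=
  mfderiv 𝓘(ℝ, E) 𝓘(ℝ, E) c (c.symm y)

/-- Components of a `1`-form in the chart `c`, as a function of the coordinates. -/
def covectorInChart (c : OpenPartialHomeomorph M E) (l : CovectorField E M) (y : E) :
    E →L[ℝ] ℝ :=
  l (c.symm y) ∘L frame c y

/-- Components of a `(0,2)`-tensor in the chart `c`, as a function of the coordinates. -/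
def bilinInChart (c : OpenPartialHomeomorph M E) (T : BilinField E M) (y : E) :
    E →L[ℝ] E →L[ℝ] ℝ :=
  ContinuousLinearMap.precomp ℝ (frame c y) ∘L T (c.symm y) ∘L frame c y

theorem bilinInChart_apply (c : OpenPartialHomeomorph M E) (T : BilinField E M) (y u v : E) :
    bilinInChart c T y u v = T (c.symm y) (frame c y u) (frame c y v) := rfl

theorem bilinInChart_add (c : OpenPartialHomeomorph M E) (T S : BilinField E M) :
    bilinInChart c (T + S) = fun y ↦ bilinInChart c T y + bilinInChart c S y := by
  ext y u v
  rfl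

theorem bilinInChart_smul (c : OpenPartialHomeomorph M E) (r : ℝ) (T : BilinField E M) :
    bilinInChart c (r • T) = fun y ↦ r • bilinInChart c T y := by
  ext y u v
  rfl

/-- Components of a `(1,1)`-tensor in the chart `c`, as a function of the coordinates. -/
def endInChart (c : OpenPartialHomeomorph M E) (J : EndField E M) (y : E) : E →L[ℝ] E :=
  coframe c y ∘L J (c.symm y) ∘L frame c y

end Components

/-! ### The Levi-Civita connection in coordinates -/

section Coordinates

variable {E : Type*} [NormedAddCommGroup E] [NormedSpace ℝ E]

/-- Christoffel symbols `Γ(u, v)` of the metric with components `G`: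
`G(Γ(u, v), w) = ½ (∂_u G(v, w) + ∂_v G(u, w) - ∂_w G(u, v))` for all `w`. -/
def christoffel (G : E → E →L[ℝ] E →L[ℝ] ℝ) (y u v : E) : E :=
  (G y).inverse ((1 / 2 : ℝ) •
    (fderiv ℝ (fun z ↦ G z v) y u + fderiv ℝ (fun z ↦ G z u) y v
      - fderiv ℝ (fun z ↦ G z u v) y))

/-- `(∇_w L)(u)` for a `1`-form with components `L`. -/
def covDerivCovector (G : E → E →L[ℝ] E →L[ℝ] ℝ) (L : E → E →L[ℝ] ℝ) (y w u : E) : ℝ :=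
  fderiv ℝ (fun z ↦ L z u) y w - L y (christoffel G y w u)

/-- `(∇_w T)(u, v)` for a `(0,2)`-tensor with components `T`. -/
def covDerivBilin (G : E → E →L[ℝ] E →L[ℝ] ℝ) (T : E → E →L[ℝ] E →L[ℝ] ℝ)
    (y w u v : E) : ℝ :=
  fderiv ℝ (fun z ↦ T z u v) y w - T y (christoffel G y w u) v - T y u (christoffel G y w v)

theorem covDerivBilin_add (G : E → E →L[ℝ] E →L[ℝ] ℝ) {T S : E → E →L[ℝ] E →L[ℝ] ℝ}
    {y u v : E} (hT : DifferentiableAt ℝ (fun z ↦ T z u v) y)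
    (hS : DifferentiableAt ℝ (fun z ↦ S z u v) y) (w : E) :
    covDerivBilin G (fun z ↦ T z + S z) y w u v =
      covDerivBilin G T y w u v + covDerivBilin G S y w u v := by
  simp only [covDerivBilin, add_apply, fderiv_fun_add hT hS]
  ring

theorem covDerivBilin_smul (G : E → E →L[ℝ] E →L[ℝ] ℝ) {T : E → E →L[ℝ] E →L[ℝ] ℝ}
    {y u v : E} (hT : DifferentiableAt ℝ (fun z ↦ T z u v) y) (r : ℝ) (w : E) :
    covDerivBilin G (fun z ↦ r • T z) y w u v = r * covDerivBilin G T y w u v := by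
  simp only [covDerivBilin, smul_apply, smul_eq_mul, fderiv_const_mul hT]
  ring

/-- `(∇_w A)(u)` for a `(1,1)`-tensor with components `A`. -/
def covDerivEnd (G : E → E →L[ℝ] E →L[ℝ] ℝ) (A : E → E →L[ℝ] E) (y w u : E) : E :=
  fderiv ℝ (fun z ↦ A z u) y w + christoffel G y w (A y u) - A y (christoffel G y w u)

end Coordinates

/-! ### Kähler structures of arbitrary signature -/

/-- A (pseudo-)Kähler structure on `M`: a smooth pseudo-Riemannian metric `g` of arbitrary
signature and a smooth almost complex structure `J` which is `g`-orthogonal and parallel with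
respect to the Levi-Civita connection of `g` (so that `J` is integrable). -/
structure KahlerStructure (E : Type*) [NormedAddCommGroup E] [NormedSpace ℝ E]
    (M : Type*) [TopologicalSpace M] [ChartedSpace E M] [IsManifold 𝓘(ℝ, E) ∞ M] where
  /-- the metric -/
  g : BilinField E M
  /-- the complex structure -/
  J : EndField E M
  g_smooth : SmoothBilin g
  g_symm : ∀ p u v, g p u v = g p v u
  g_nondegenerate : ∀ p u, (∀ v, g p u v = 0) → u = 0
  J_smooth : SmoothEnd J
  J_sq : ∀ p u, J p (J p u) = -u
  g_hermitian : ∀ p u v, g p (J p u) (J p v) = g p u v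
  J_parallel : ∀ c ∈ atlas E M, ∀ y ∈ c.target, ∀ w u,
    covDerivEnd (bilinInChart c g) (endInChart c J) y w u = 0

section MainEquation

variable {E : Type*} [NormedAddCommGroup E] [NormedSpace ℝ E]
  {M : Type*} [TopologicalSpace M] [ChartedSpace E M] [IsManifold 𝓘(ℝ, E) ∞ M]

/-- The tensor equation
`a_{ij,k} = λ_i g_{jk} + λ_j g_{ik} - λ̄_i J_{jk} - λ̄_j J_{ik}`, where `λ̄_i = J^α_i λ_α`
and `J_{jk} = g_{jα} J^α_k`, contracted with `u^i v^j w^k` in every chart of the atlas. -/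
def KahlerStructure.HProjectiveEquation (K : KahlerStructure E M)
    (a : BilinField E M) (l : CovectorField E M) : Prop :=
  ∀ c ∈ atlas E M, ∀ y ∈ c.target, ∀ u v w : E,
    covDerivBilin (bilinInChart c K.g) (bilinInChart c a) y w u v =
      covectorInChart c l y u * bilinInChart c K.g y v w
      + covectorInChart c l y v * bilinInChart c K.g y u w
      - covectorInChart c l y (endInChart c K.J y u)
          * bilinInChart c K.g y v (endInChart c K.J y w)
      - covectorInChart c l y (endInChart c K.J y v)
          * bilinInChart c K.g y u (endInChart c K.J y w)

/-- `(a, l)` is a solution of the h-projective equation: `a` is a smooth symmetric hermitian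
`(0,2)`-tensor and `l` a smooth `1`-form. -/
structure KahlerStructure.IsSolution (K : KahlerStructure E M)
    (a : BilinField E M) (l : CovectorField E M) : Prop where
  smooth_left : SmoothBilin a
  smooth_right : SmoothCovector l
  symm : ∀ p u v, a p u v = a p v u
  hermitian : ∀ p u v, a p (K.J p u) (K.J p v) = a p u v
  equation : K.HProjectiveEquation a l

/-- The extended system for `(a, l, μ)` with the constant `B`: the h-projective equation
together with `λ_{i,j} = μ g_{ij} + B a_{ij}` and `μ_{,i} = 2 B λ_i`, where `μ` is a smooth
function. -/
structure KahlerStructure.IsExtendedSolution (K : KahlerStructure E M)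
    (a : BilinField E M) (l : CovectorField E M) (μ : M → ℝ) (B : ℝ) : Prop where
  isSolution : K.IsSolution a l
  smooth_function : ContMDiff 𝓘(ℝ, E) 𝓘(ℝ, ℝ) ∞ μ
  hessian : ∀ c ∈ atlas E M, ∀ y ∈ c.target, ∀ u v : E,
    covDerivCovector (bilinInChart c K.g) (covectorInChart c l) y v u =
      μ (c.symm y) * bilinInChart c K.g y u v + B * bilinInChart c a y u v
  gradient : ∀ p v, mvfderiv 𝓘(ℝ, E) μ p v = 2 * B * l p v

/-! ### The space of solutions -/

theorem contMDiffAt_frame {c : OpenPartialHomeomorph M E} (hc : c ∈ atlas E M) {y : E}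
    (hy : y ∈ c.target) (u : E) :
    ContMDiffAt 𝓘(ℝ, E) (𝓘(ℝ, E).prod 𝓘(ℝ, E)) ∞
      (fun z ↦ (Bundle.TotalSpace.mk' E (c.symm z) (frame c z u) :
        TangentBundle 𝓘(ℝ, E) M)) y := by
  have h1 : ContMDiffOn 𝓘(ℝ, E) 𝓘(ℝ, E) ∞ c.symm c.target :=
    contMDiffOn_symm_of_mem_maximalAtlas (IsManifold.subset_maximalAtlas hc)
  have h2 := h1.contMDiffOn_tangentMapWithin (m := ∞) (by simp) c.open_target.uniqueMDiffOn
  have h3 : ContMDiff 𝓘(ℝ, E) (𝓘(ℝ, E).prod 𝓘(ℝ, E)) ∞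
      (fun z ↦ (Bundle.TotalSpace.mk' E z u : TangentBundle 𝓘(ℝ, E) E)) := by
    intro z
    exact Bundle.contMDiffAt_totalSpace.mpr
      ⟨contMDiffAt_id, by simpa using (contMDiffAt_const :
        ContMDiffAt 𝓘(ℝ, E) 𝓘(ℝ, E) ∞ (fun _ : E ↦ u) z)⟩
  have h4 := h2.comp (h3.contMDiffOn (s := c.target)) (fun z hz ↦ hz)
  have h5 := h4.contMDiffAt (c.open_target.mem_nhds hy)
  refine h5.congr_of_eventuallyEq ?_
  filter_upwards [c.open_target.mem_nhds hy] with z hz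
  simp only [Function.comp_apply, tangentMapWithin, frame,
    mfderivWithin_of_mem_nhds (c.open_target.mem_nhds hz)]
  rfl

theorem contDiffAt_bilinInChart {T : BilinField E M} (hT : SmoothBilin T)
    {c : OpenPartialHomeomorph M E} (hc : c ∈ atlas E M) {y : E} (hy : y ∈ c.target) (u v : E) :
    ContDiffAt ℝ ∞ (fun z ↦ bilinInChart c T z u v) y := by
  have h1 : ContMDiffAt 𝓘(ℝ, E) 𝓘(ℝ, E) ∞ c.symm y :=
    contMDiffAt_symm_of_mem_maximalAtlas (IsManifold.subset_maximalAtlas hc) hy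
  have h := ContMDiffAt.clm_bundle_apply₂ (F₁ := E) (F₂ := E) (F₃ := ℝ)
    (E₁ := fun p : M ↦ TangentSpace 𝓘(ℝ, E) p) (E₂ := fun p : M ↦ TangentSpace 𝓘(ℝ, E) p)
    (E₃ := fun _ : M ↦ ℝ)
    ((hT (c.symm y)).comp y h1) (contMDiffAt_frame hc hy u) (contMDiffAt_frame hc hy v)
  rw [Bundle.contMDiffAt_totalSpace] at h
  exact h.2.contDiffAt

theorem differentiableAt_bilinInChart {T : BilinField E M} (hT : SmoothBilin T)
    {c : OpenPartialHomeomorph M E} (hc : c ∈ atlas E M) {y : E} (hy : y ∈ c.target) (u v : E) :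
    DifferentiableAt ℝ (fun z ↦ bilinInChart c T z u v) y :=
  (contDiffAt_bilinInChart hT hc hy u v).differentiableAt (by simp)

set_option synthInstance.maxHeartbeats 400000 in
theorem KahlerStructure.isSolution_zero (K : KahlerStructure E M) :
    K.IsSolution (fun _ ↦ 0) (fun _ ↦ 0) where
  smooth_left := Bundle.contMDiff_zeroSection ℝ (fun p : M ↦
    (TangentSpace 𝓘(ℝ, E) p →L[ℝ] TangentSpace 𝓘(ℝ, E) p →L[ℝ] ℝ))
  smooth_right := Bundle.contMDiff_zeroSection ℝ (fun p : M ↦ (TangentSpace 𝓘(ℝ, E) p →L[ℝ] ℝ))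
  symm _ _ _ := rfl
  hermitian _ _ _ := rfl
  equation := by
    intro c hc y hy u v w
    have h : bilinInChart c (fun _ ↦ 0 : BilinField E M) = fun _ ↦ 0 := by
      ext y u v
      rfl
    simp [covDerivBilin, covectorInChart, h]

set_option synthInstance.maxHeartbeats 400000 in
theorem KahlerStructure.IsSolution.add {K : KahlerStructure E M}
    {a b : BilinField E M} {l m : CovectorField E M}
    (ha : K.IsSolution a l) (hb : K.IsSolution b m) : K.IsSolution (a + b) (l + m) where
  smooth_left := ContMDiff.add_section (F := E →L[ℝ] E →L[ℝ] ℝ) (V := fun p : M ↦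
    (TangentSpace 𝓘(ℝ, E) p →L[ℝ] TangentSpace 𝓘(ℝ, E) p →L[ℝ] ℝ))
    ha.smooth_left hb.smooth_left
  smooth_right := ContMDiff.add_section (F := E →L[ℝ] ℝ) (V := fun p : M ↦
    (TangentSpace 𝓘(ℝ, E) p →L[ℝ] ℝ)) ha.smooth_right hb.smooth_right
  symm p u v := congrArg₂ (· + ·) (ha.symm p u v) (hb.symm p u v)
  hermitian p u v := congrArg₂ (· + ·) (ha.hermitian p u v) (hb.hermitian p u v)
  equation := by
    intro c hc y hy u v w
    have hl (z : E) : covectorInChart c (l + m) y z =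
        covectorInChart c l y z + covectorInChart c m y z := rfl
    rw [bilinInChart_add, covDerivBilin_add _ (differentiableAt_bilinInChart ha.smooth_left hc hy u v)
      (differentiableAt_bilinInChart hb.smooth_left hc hy u v), ha.equation c hc y hy u v w,
      hb.equation c hc y hy u v w]
    simp only [hl]
    ring

set_option synthInstance.maxHeartbeats 400000 in
theorem KahlerStructure.IsSolution.smul {K : KahlerStructure E M}
    {a : BilinField E M} {l : CovectorField E M} (r : ℝ)
    (ha : K.IsSolution a l) : K.IsSolution (r • a) (r • l) where
  smooth_left := ContMDiff.const_smul_section (F := E →L[ℝ] E →L[ℝ] ℝ) (V := fun p : M ↦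
    (TangentSpace 𝓘(ℝ, E) p →L[ℝ] TangentSpace 𝓘(ℝ, E) p →L[ℝ] ℝ)) ha.smooth_left
  smooth_right := ContMDiff.const_smul_section (F := E →L[ℝ] ℝ) (V := fun p : M ↦
    (TangentSpace 𝓘(ℝ, E) p →L[ℝ] ℝ)) ha.smooth_right
  symm p u v := congrArg (r * ·) (ha.symm p u v)
  hermitian p u v := congrArg (r * ·) (ha.hermitian p u v)
  equation := by
    intro c hc y hy u v w
    have hl (z : E) : covectorInChart c (r • l) y z = r * covectorInChart c l y z := rfl
    rw [bilinInChart_smul, covDerivBilin_smul _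
      (differentiableAt_bilinInChart ha.smooth_left hc hy u v), ha.equation c hc y hy u v w]
    simp only [hl]
    ring

set_option synthInstance.maxHeartbeats 400000 in
/-- The real vector space of all solutions `(a, l)` of the h-projective equation. -/
def KahlerStructure.solutionSpace (K : KahlerStructure E M) :
    Submodule ℝ (BilinField E M × CovectorField E M) where
  carrier := {s | K.IsSolution s.1 s.2}
  zero_mem' := K.isSolution_zero
  add_mem' ha hb := KahlerStructure.IsSolution.add ha hb
  smul_mem' r _ ha := KahlerStructure.IsSolution.smul r ha

/-- The degree of mobility: the dimension of the space of solutions. -/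
def KahlerStructure.degreeOfMobility (K : KahlerStructure E M) :
    Cardinal :=
  Module.rank ℝ K.solutionSpace

end MainEquation

end Kahler

end

/-! After raising indices with `g`, a solution is a field of hermitian operators `a` together with a
vector field `lam` such that `∇_X a = hsym X lam`. Put `L = ∇ lam`. Cross-differentiation gives the
integrability condition `[R(X, Y), a] = hsym Y (L X) - hsym X (L Y)`, and its traces force `L` to be
hermitian in real dimension above two.

Take two solutions with `1, a, A` independent at a point. In `g(R(X, Y) Z, W)` let `a` act on the
first pair of arguments and `A` on the second. The pair symmetry of the curvature lets each
integrability condition be applied in turn, and `R` disappears. What remains is a bilinear identity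
between quadratic forms, which forces `L = B a + m` and `L' = B A + m'` with the same `B`
(`Integrability.exists_common_factor`).

To see that `B` is constant, subtract from `R` the curvature of constant holomorphic sectional
curvature determined by `B`. The difference commutes with `a` and `A`, and the Ricci identity
expresses its value on `lam` as `η ∧ 1 + dB ∧ a`, where `η = dm - 2 B g(lam, ·)`. In real dimension
four the commutant of `a` and `A` is so small that the difference vanishes. In higher dimension its
`J`-invariance would, for `dB ≠ 0`, put the quadratic forms of `a` and `A` in the plane spanned by
`g` and `dB² + (dB ∘ J)²`. Either way `dB = 0` (`RicciIdentity.factor_eq_zero`), and then `η = 0`,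
which is the gradient equation.

For the global statement, `(a, lam, tr ∇ lam)` satisfies a closed linear first-order system, so a
solution vanishing on an open set vanishes everywhere (`IsSolution.eq_zero_of_eventually`). Hence
two solutions independent of the metric as global tensors are pointwise independent on a dense set.
Across the remaining points `B` extends as a quotient of smooth functions, and connectedness makes
it one number. Degree of mobility at least three supplies such a pair. Every further solution not
proportional to `g` is independent of `g` and one member of the pair, and uniqueness of the constant
for that member transfers `B` to it. -/

noncomputable section

namespace Kahler

/-! ### Hermitian linear algebra over the reals -/

section Algebra

variable {E : Type*} [NormedAddCommGroup E] [NormedSpace ℝ E]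

/-- A nondegenerate symmetric form `g` with an orthogonal complex structure `J`. -/
structure IsHermitianPair (g : E →L[ℝ] E →L[ℝ] ℝ) (J : E →L[ℝ] E) : Prop where
  symm : ∀ u v, g u v = g v u
  nondeg : ∀ u, (∀ v, g u v = 0) → u = 0
  sq : ∀ u, J (J u) = -u
  herm : ∀ u v, g (J u) (J v) = g u v

/-- Self-adjoint endomorphisms commuting with `J`. -/
structure IsHermitianOp (g : E →L[ℝ] E →L[ℝ] ℝ) (J a : E →L[ℝ] E) : Prop where
  self_adj : ∀ u v, g (a u) v = g u (a v)
  comm : ∀ u, a (J u) = J (a u)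

/-- The hermitian operator `P Q* + Q P*`, where `*` is taken with respect to the
hermitian form with real part `g`. -/
def hsym (g : E →L[ℝ] E →L[ℝ] ℝ) (J : E →L[ℝ] E) (P Q : E) : E →L[ℝ] E :=
  (g P).smulRight Q + (g Q).smulRight P + (g (J P)).smulRight (J Q) + (g (J Q)).smulRight (J P)

theorem hsym_apply (g : E →L[ℝ] E →L[ℝ] ℝ) (J : E →L[ℝ] E) (P Q Z : E) :
    hsym g J P Q Z = g P Z • Q + g Q Z • P + g (J P) Z • J Q + g (J Q) Z • J P := by
  simp [hsym]

theorem hsym_comm (g : E →L[ℝ] E →L[ℝ] ℝ) (J : E →L[ℝ] E) (P Q : E) :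
    hsym g J P Q = hsym g J Q P := by
  ext Z
  simp only [hsym_apply]
  abel

theorem hsym_add_right (g : E →L[ℝ] E →L[ℝ] ℝ) (J : E →L[ℝ] E) (P Q Q' : E) :
    hsym g J P (Q + Q') = hsym g J P Q + hsym g J P Q' := by
  ext Z
  simp only [hsym_apply, map_add, add_apply]
  module

theorem hsym_smul_right (g : E →L[ℝ] E →L[ℝ] ℝ) (J : E →L[ℝ] E) (P Q : E) (r : ℝ) :
    hsym g J P (r • Q) = r • hsym g J P Q := by
  ext Z
  simp only [hsym_apply, map_smul, smul_apply, smul_eq_mul]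
  module

theorem hsym_add_left (g : E →L[ℝ] E →L[ℝ] ℝ) (J : E →L[ℝ] E) (P P' Q : E) :
    hsym g J (P + P') Q = hsym g J P Q + hsym g J P' Q := by
  rw [hsym_comm, hsym_add_right, hsym_comm g J Q, hsym_comm g J Q]

theorem hsym_smul_left (g : E →L[ℝ] E →L[ℝ] ℝ) (J : E →L[ℝ] E) (P Q : E) (r : ℝ) :
    hsym g J (r • P) Q = r • hsym g J P Q := by
  rw [hsym_comm, hsym_smul_right, hsym_comm g J Q]

/-- The algebraic identities of the curvature operator of a Kähler metric. -/
structure IsKahlerCurvature (g : E →L[ℝ] E →L[ℝ] ℝ) (J : E →L[ℝ] E)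
    (R : E →L[ℝ] E →L[ℝ] E →L[ℝ] E) : Prop where
  alt : ∀ X Y Z, R X Y Z = -R Y X Z
  skew : ∀ X Y Z W, g (R X Y Z) W = -g Z (R X Y W)
  comm : ∀ X Y Z, R X Y (J Z) = J (R X Y Z)
  bianchi : ∀ X Y Z, R X Y Z + R Y Z X + R Z X Y = 0

/-- The integrability condition of the h-projective equation `∇_X a = hsym X lam`
with `L = ∇ lam`. -/
def Integrability (g : E →L[ℝ] E →L[ℝ] ℝ) (J : E →L[ℝ] E)
    (R : E →L[ℝ] E →L[ℝ] E →L[ℝ] E) (a L : E →L[ℝ] E) : Prop :=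
  ∀ X Y Z, R X Y (a Z) - a (R X Y Z) = hsym g J Y (L X) Z - hsym g J X (L Y) Z

variable {g : E →L[ℝ] E →L[ℝ] ℝ} {J : E →L[ℝ] E}

namespace IsHermitianPair

theorem skew (h : IsHermitianPair g J) (u v : E) : g (J u) v = -g u (J v) := by
  have := h.herm u (J v)
  rw [h.sq] at this
  simp only [map_neg] at this
  linarith

theorem apply_J_self (h : IsHermitianPair g J) (u : E) : g u (J u) = 0 := by
  have h1 := h.skew u u
  have h2 := h.symm u (J u)
  linarith

theorem ext_left (h : IsHermitianPair g J) {u v : E} (huv : ∀ w, g u w = g v w) : u = v := by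
  rw [← sub_eq_zero]
  refine h.nondeg _ fun w ↦ ?_
  simp [huv w]

theorem J_injective (h : IsHermitianPair g J) {u v : E} (huv : J u = J v) : u = v := by
  have := congrArg J huv
  rw [h.sq, h.sq] at this
  exact neg_injective this

end IsHermitianPair

theorem isHermitianOp_one : IsHermitianOp g J (1 : E →L[ℝ] E) :=
  ⟨fun _ _ ↦ rfl, fun _ ↦ rfl⟩

namespace IsHermitianOp

theorem add {a b : E →L[ℝ] E} (ha : IsHermitianOp g J a) (hb : IsHermitianOp g J b) :
    IsHermitianOp g J (a + b) :=
  ⟨fun u v ↦ by simp [ha.self_adj, hb.self_adj], fun u ↦ by simp [ha.comm, hb.comm]⟩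

theorem smul {a : E →L[ℝ] E} (ha : IsHermitianOp g J a) (r : ℝ) : IsHermitianOp g J (r • a) :=
  ⟨fun u v ↦ by simp [ha.self_adj], fun u ↦ by simp [ha.comm]⟩

theorem sub {a b : E →L[ℝ] E} (ha : IsHermitianOp g J a) (hb : IsHermitianOp g J b) :
    IsHermitianOp g J (a - b) :=
  ⟨fun u v ↦ by simp [ha.self_adj, hb.self_adj], fun u ↦ by simp [ha.comm, hb.comm]⟩

theorem apply_J_self (h : IsHermitianPair g J) {a : E →L[ℝ] E} (ha : IsHermitianOp g J a)
    (u : E) : g (a u) (J u) = 0 := by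
  have h1 := ha.self_adj u (J u)
  have h2 := h.skew u (a u)
  have h3 := h.symm (a u) (J u)
  rw [ha.comm] at h1
  linarith

/-- A hermitian operator is determined by its quadratic form. -/
theorem eq_of_quadratic (h : IsHermitianPair g J) {a b : E →L[ℝ] E} (ha : IsHermitianOp g J a)
    (hb : IsHermitianOp g J b) (hab : ∀ u, g (a u) u = g (b u) u) : a = b := by
  ext u
  refine h.ext_left fun v ↦ ?_
  have h1 := hab (u + v)
  have h2 := hab u
  have h3 := hab v
  have h4 := ha.self_adj v u
  have h5 := hb.self_adj v u
  have h6 := h.symm v (a u)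
  have h7 := h.symm v (b u)
  simp only [map_add, add_apply] at h1
  linarith

end IsHermitianOp

namespace IsKahlerCurvature

variable {R : E →L[ℝ] E →L[ℝ] E →L[ℝ] E}

/-- The usual octahedron argument: four instances of the Bianchi identity combined with the two skew
symmetries. -/
theorem pair (hR : IsKahlerCurvature g J R) (h : IsHermitianPair g J) (X Y Z W : E) :
    g (R X Y Z) W = g (R Z W X) Y := by
  have b (X Y Z W : E) : g (R X Y Z) W + g (R Y Z X) W + g (R Z X Y) W = 0 := by
    have := congrArg (fun v ↦ g v W) (hR.bianchi X Y Z)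
    simpa using this
  have s (X Y Z W : E) : g (R X Y Z) W = -g (R X Y W) Z := by
    rw [hR.skew, h.symm]
  have t (X Y Z W : E) : g (R X Y Z) W = -g (R Y X Z) W := by
    rw [hR.alt]; simp
  linarith [b X Y Z W, b Y Z W X, b Z W X Y, b W X Y Z, s X Y Z W, s Y Z X W, s Z X Y W,
    s Y Z W X, s Z W Y X, s W Y Z X, s Z W X Y, s W X Z Y, s X Z W Y, s W X Y Z, s X Y W Z,
    s Y W X Z, t X Z W Y, t Y W X Z, t X Y Z W, t Z W X Y, t W Y Z X]

/-- Pair symmetry moves `J` from the first two arguments to the last two, where it commutes with the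
curvature and is orthogonal. -/
theorem J_invariant (hR : IsKahlerCurvature g J R) (h : IsHermitianPair g J) (X Y Z : E) :
    R (J X) (J Y) Z = R X Y Z := by
  refine h.ext_left fun W ↦ ?_
  rw [hR.pair h, hR.comm, h.herm, ← hR.pair h]

end IsKahlerCurvature

/-! ### Pointwise algebra of two solutions: elimination of the curvature. -/

section TwoSolutions

variable {R : E →L[ℝ] E →L[ℝ] E →L[ℝ] E} {a A L L' : E →L[ℝ] E}

/-- The left side contracts `[R(a X, Y), A] - [R(X, a Y), A]`, the right side `[R(A Z, W), a] -
[R(Z, A W), a]`. By self-adjointness and pair symmetry both are the curvature form with `a` acting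
on one pair and `A` on the other, so the curvature drops out. -/
theorem Integrability.exchange (h : IsHermitianPair g J) (hR : IsKahlerCurvature g J R)
    (ha : IsHermitianOp g J a) (hA : IsHermitianOp g J A)
    (hI : Integrability g J R a L) (hI' : Integrability g J R A L') (X Y Z W : E) :
    g (hsym g J Y (L' (a X)) Z - hsym g J (a X) (L' Y) Z) W
      - g (hsym g J (a Y) (L' X) Z - hsym g J X (L' (a Y)) Z) W =
    g (hsym g J W (L (A Z)) X - hsym g J (A Z) (L W) X) Y
      - g (hsym g J (A W) (L Z) X - hsym g J Z (L (A W)) X) Y := by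
  rw [← hI', ← hI', ← hI, ← hI]
  simp only [map_sub, sub_apply]
  rw [hA.self_adj, hA.self_adj, ha.self_adj, ha.self_adj, hR.pair h (a X) Y (A Z),
    hR.pair h (a X) Y Z, hR.pair h X (a Y) (A Z), hR.pair h X (a Y) Z]
  ring

/-- Evaluate the exchange identity at `(X, Y, X, Y)` and at `(X, JY, JX, Y)`. In the difference only
terms that split as a function of `X` times a function of `Y` survive, since `g(u, J P u) = 0` for
hermitian `P`. -/
theorem Integrability.quadratic (h : IsHermitianPair g J) (hR : IsKahlerCurvature g J R)
    (ha : IsHermitianOp g J a) (hA : IsHermitianOp g J A)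
    (hL : IsHermitianOp g J L) (hL' : IsHermitianOp g J L')
    (hI : Integrability g J R a L) (hI' : Integrability g J R A L') (X Y : E) :
    g (L' Y) Y * g (a X) X + g (a Y) Y * g (L' X) X
      - g (L Y) Y * g (A X) X - g (A Y) Y * g (L X) X =
    g Y Y * (g X (L' (a X)) - g X (L (A X))) + (g Y (L' (a Y)) - g Y (L (A Y))) * g X X := by
  have e1 := Integrability.exchange h hR ha hA hI hI' X Y X Y
  have e2 := Integrability.exchange h hR ha hA hI hI' X (J Y) (J X) Y
  simp only [hsym_apply, map_add, map_sub, add_apply, sub_apply, map_smul, smul_apply,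
    smul_eq_mul, ha.comm, hA.comm, hL.comm, hL'.comm, h.sq, map_neg, h.skew, ha.self_adj,
    hA.self_adj, hL.self_adj, hL'.self_adj, neg_apply] at e1 e2 ⊢
  have z {P : E →L[ℝ] E} (hP : IsHermitianOp g J P) (u : E) : g u (J (P u)) = 0 := by
    rw [← hP.comm, ← hP.self_adj, hP.apply_J_self h]
  have w {P Q : E →L[ℝ] E} (hP : IsHermitianOp g J P) (hQ : IsHermitianOp g J Q) (u : E) :
      g u (P (Q u)) = g u (Q (P u)) := by
    rw [← hP.self_adj, ← hQ.self_adj, h.symm]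
  simp only [z ha, z hA, z hL, z hL', h.apply_J_self] at e1 e2
  rw [w hL' ha X, w hL' ha Y, w hL hA X, w hL hA Y]
  linear_combination (-1 / 2 : ℝ) * (e1 - e2)

/-- The functional argument behind the proportionality of two pairs of quadratic forms:
if `p · q' + q · p' = r · s' + s · r'` modulo a third function `e` independent of `q` and `s`,
then `p` and `r` are the same multiples of `s` and `q` modulo `e`. -/
theorem exists_common_factor {V : Type*} {e q s p r t : V → ℝ}
    (hi : LinearIndependent ℝ ![e, q, s])
    (H : ∀ X Y, p Y * q X + q Y * p X - r Y * s X - s Y * r X = e Y * t X + t Y * e X) :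
    ∃ B m m' : ℝ, r = B • q + m • e ∧ p = B • s + m' • e := by
  have key (W : Submodule ℝ (V → ℝ)) (v : V → ℝ) (hv : v ∉ W) :
      ∃ f : Module.Dual ℝ (V → ℝ), f v = 1 ∧ ∀ w ∈ W, f w = 0 := by
    obtain ⟨f, hf, hW⟩ := Submodule.exists_le_ker_of_notMem hv
    refine ⟨(f v)⁻¹ • f, by simp [hf], fun w hw ↦ ?_⟩
    have : f w = 0 := hW hw
    simp [this]
  -- `φ` reads off the coefficient of `q` and kills `e` and `s`; `ψ` reads off the coefficient of
  -- `s` and kills only `e`. The factor `B` will be `φ r`.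
  obtain ⟨φ, hφq, hφ⟩ := key (Submodule.span ℝ {e, s}) q (by
    have := hi.notMem_span_image (s := {0, 2}) (x := 1) (by simp)
    simpa [Set.image_pair] using this)
  obtain ⟨ψ, hψs, hψ⟩ := key (Submodule.span ℝ {e}) s (by
    have := hi.notMem_span_image (s := {0}) (x := 2) (by simp)
    simpa using this)
  have hφe : φ e = 0 := hφ _ (Submodule.subset_span (by simp))
  have hφs : φ s = 0 := hφ _ (Submodule.subset_span (by simp))
  have hψe : ψ e = 0 := hψ _ (Submodule.subset_span (by simp))
  have H' (Y : V) : p Y • q + q Y • p - r Y • s - s Y • r = e Y • t + t Y • e := by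
    ext X
    simpa using H X Y
  have h1 : p = φ r • s + (-φ p) • q + φ t • e := by
    ext Y
    have := congrArg φ (H' Y)
    simp only [map_add, map_sub, map_smul, hφe, hφs, hφq, smul_eq_mul] at this
    simp only [Pi.add_apply, Pi.smul_apply, smul_eq_mul]
    linarith
  -- Applying `φ` to the formula for `p` gives `φ p = -φ p`.
  have h2 : φ p = 0 := by
    have := congrArg φ h1
    simp only [map_add, map_smul, hφe, hφs, hφq, smul_eq_mul] at this
    linarith
  have h3 : p = φ r • s + φ t • e := by
    rw [h2] at h1
    simpa using h1
  have h4 : ∀ Y, r Y = φ r * q Y + (φ r * ψ q - ψ r) * s Y + (φ t * ψ q - ψ t) * e Y := by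
    intro Y
    have := congrArg ψ (H' Y)
    have h5 : ψ p = φ r := by
      rw [h3]
      simp [hψe, hψs]
    have h6 := congrFun h3 Y
    simp only [map_add, map_sub, map_smul, hψe, hψs, h5, smul_eq_mul] at this
    simp only [Pi.add_apply, Pi.smul_apply, smul_eq_mul] at h6
    rw [h6] at this
    linarith
  have h7 : r = φ r • q + (φ r * ψ q - ψ r) • s + (φ t * ψ q - ψ t) • e := by
    ext Y
    simpa using h4 Y
  -- The same device: applying `ψ` to the formula for `r` shows that this coefficient equals its own
  -- negative.
  have h8 : φ r * ψ q - ψ r = 0 := by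
    have := congrArg ψ h7
    simp only [map_add, map_smul, hψe, hψs, smul_eq_mul] at this
    linarith
  rw [h8] at h7
  exact ⟨φ r, φ t * ψ q - ψ t, φ t, by simpa using h7, h3⟩

/-- Quadratic forms of linearly independent hermitian operators are linearly independent. -/
theorem linearIndependent_quadratic (h : IsHermitianPair g J) (ha : IsHermitianOp g J a)
    (hA : IsHermitianOp g J A) (hi : LinearIndependent ℝ ![1, a, A]) :
    LinearIndependent ℝ ![fun u ↦ g u u, fun u ↦ g (a u) u, fun u ↦ g (A u) u] := by
  rw [Fintype.linearIndependent_iff] at hi ⊢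
  intro c hc
  apply hi c
  simp only [Fin.sum_univ_three, Matrix.cons_val] at hc ⊢
  refine IsHermitianOp.eq_of_quadratic h ((((isHermitianOp_one).smul _).add (ha.smul _)).add
    (hA.smul _)) (b := 0) ⟨by simp, by simp⟩ fun u ↦ ?_
  have := congrFun hc u
  simpa using this

/-- Two solutions of the integrability condition which are independent together with the
identity have derivatives determined by the same factor. -/
theorem Integrability.exists_common_factor (h : IsHermitianPair g J)
    (hR : IsKahlerCurvature g J R) (ha : IsHermitianOp g J a) (hA : IsHermitianOp g J A)
    (hL : IsHermitianOp g J L) (hL' : IsHermitianOp g J L')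
    (hI : Integrability g J R a L) (hI' : Integrability g J R A L')
    (hi : LinearIndependent ℝ ![1, a, A]) :
    ∃ B m m' : ℝ, L = B • a + m • 1 ∧ L' = B • A + m' • 1 := by
  obtain ⟨B, m, m', h1, h2⟩ := Kahler.exists_common_factor
    (linearIndependent_quadratic h ha hA hi)
    (fun X Y ↦ Integrability.quadratic h hR ha hA hL hL' hI hI' X Y)
  refine ⟨B, m, m', hL.eq_of_quadratic h ((ha.smul B).add (isHermitianOp_one.smul m)) fun u ↦ ?_,
    hL'.eq_of_quadratic h ((hA.smul B).add (isHermitianOp_one.smul m')) fun u ↦ ?_⟩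
  · simpa using congrFun h1 u
  · simpa using congrFun h2 u

end TwoSolutions
end Algebra
end Kahler
end

/-! ### Traces of the integrability condition. -/

noncomputable section

namespace Kahler

section Trace

variable {E : Type*} [NormedAddCommGroup E] [NormedSpace ℝ E]

/-- The trace as a continuous linear functional on the endomorphisms of a finite-dimensional
space. -/
def tr (E : Type*) [NormedAddCommGroup E] [NormedSpace ℝ E] [FiniteDimensional ℝ E] :
    (E →L[ℝ] E) →L[ℝ] ℝ :=
  LinearMap.toContinuousLinearMap (LinearMap.trace ℝ E ∘ₗ ContinuousLinearMap.coeLM ℝ)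

variable [FiniteDimensional ℝ E]

theorem tr_apply (T : E →L[ℝ] E) : tr E T = LinearMap.trace ℝ E T := rfl

theorem tr_smulRight (f : E →L[ℝ] ℝ) (v : E) : tr E (f.smulRight v) = f v :=
  LinearMap.trace_smulRight f.toLinearMap v

theorem tr_one : tr E 1 = Module.finrank ℝ E := LinearMap.trace_one ℝ E

theorem tr_mul_comm (S T : E →L[ℝ] E) : tr E (S * T) = tr E (T * S) :=
  LinearMap.trace_mul_comm ℝ (S : E →ₗ[ℝ] E) T

variable {g : E →L[ℝ] E →L[ℝ] ℝ} {J : E →L[ℝ] E}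

/-- The musical isomorphism of a nondegenerate form. -/
def IsHermitianPair.toDual (h : IsHermitianPair g J) : E ≃ₗ[ℝ] Module.Dual ℝ E :=
  LinearEquiv.ofInjectiveOfFinrankEq
    { toFun := fun u ↦ (g u).toLinearMap
      map_add' := fun u v ↦ by ext; simp
      map_smul' := fun r v ↦ by ext; simp }
    (fun u v huv ↦ h.ext_left fun w ↦ LinearMap.congr_fun huv w)
    (Subspace.dual_finrank_eq).symm

/-- Through the musical isomorphism `S` is conjugate to minus its transpose, so its trace equals its
own negative. -/
theorem tr_eq_zero_of_skew (h : IsHermitianPair g J) {S : E →L[ℝ] E}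
    (hS : ∀ u v, g (S u) v = -g u (S v)) : tr E S = 0 := by
  have h1 : h.toDual.conj S.toLinearMap + Module.Dual.transpose (R := ℝ) S.toLinearMap = 0 := by
    ext f v
    obtain ⟨u, rfl⟩ := h.toDual.surjective f
    simp only [LinearEquiv.conj_apply, LinearMap.coe_comp, LinearEquiv.coe_coe,
      Function.comp_apply, LinearEquiv.symm_apply_apply, LinearMap.add_apply]
    have : g (S u) v + g u (S v) = 0 := by rw [hS]; ring
    exact this
  have h2 := congrArg (LinearMap.trace ℝ (Module.Dual ℝ E)) h1
  rw [map_add, LinearMap.trace_conj', LinearMap.trace_transpose', map_zero] at h2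
  rw [tr_apply]
  linarith

theorem IsHermitianPair.tr_J (h : IsHermitianPair g J) : tr E J = 0 :=
  tr_eq_zero_of_skew h h.skew

theorem tr_hsym (h : IsHermitianPair g J) (P Q : E) : tr E (hsym g J P Q) = 4 * g P Q := by
  rw [hsym]
  simp only [map_add, tr_smulRight, h.herm]
  rw [h.symm Q P]
  ring

variable {R : E →L[ℝ] E →L[ℝ] E →L[ℝ] E} {a L : E →L[ℝ] E}

/-- The commutator `[R(X, Y), a]` has trace zero, while `hsym P Q` has trace `4 g(P, Q)`. -/
theorem Integrability.self_adj (h : IsHermitianPair g J) (hI : Integrability g J R a L)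
    (X Y : E) : g (L X) Y = g X (L Y) := by
  have h1 : R X Y * a - a * R X Y = hsym g J Y (L X) - hsym g J X (L Y) := by
    ext Z
    exact hI X Y Z
  have h2 := congrArg (tr E) h1
  rw [map_sub, tr_mul_comm, sub_self, map_sub, tr_hsym h, tr_hsym h, h.symm Y] at h2
  linarith

/-- The endomorphism `Y ↦ [R(X, Y), a] W`. -/
def commutatorMap (R : E →L[ℝ] E →L[ℝ] E →L[ℝ] E) (a : E →L[ℝ] E) (X W : E) : E →L[ℝ] E :=
  (R X).flip (a W) - a * (R X).flip W

omit [FiniteDimensional ℝ E] in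
theorem commutatorMap_apply (X W Y : E) :
    commutatorMap R a X W Y = R X Y (a W) - a (R X Y W) := rfl

omit [FiniteDimensional ℝ E] in
theorem Integrability.commutatorMap_eq (hI : Integrability g J R a L) (X W : E) :
    commutatorMap R a X W =
      ((g.flip W).smulRight (L X) + g (L X) W • 1 + (g.flip W ∘L J).smulRight (J (L X))
        + g (J (L X)) W • J)
      - (g X W • L + (g.flip W ∘L L).smulRight X + g (J X) W • (J * L)
        + (g.flip W ∘L (J * L)).smulRight (J X)) := by
  ext Y
  rw [commutatorMap_apply, hI X Y W]
  simp [hsym_apply]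

theorem Integrability.tr_commutatorMap (h : IsHermitianPair g J) (hI : Integrability g J R a L)
    (X W : E) : tr E (commutatorMap R a X W) =
      (Module.finrank ℝ E - 1) * g (L X) W - tr E L * g X W - tr E (J * L) * g (J X) W
        - g (J (L (J X))) W := by
  rw [hI.commutatorMap_eq]
  simp only [map_add, map_sub, map_smul, smul_eq_mul, tr_smulRight, tr_one, h.tr_J]
  simp [h.sq, hI.self_adj h]
  ring

/-- Since `R(J X, Y) = -R(X, J Y)` and both `R` and `a` commute with `J`, the map for `(J X, J W)`
is `-J C J`, where `C` is the map for `(X, W)`. As `J² = -1`, it has the trace of `C`. -/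
theorem tr_commutatorMap_J (h : IsHermitianPair g J) (hR : IsKahlerCurvature g J R)
    (ha : IsHermitianOp g J a) (X W : E) :
    tr E (commutatorMap R a (J X) (J W)) = tr E (commutatorMap R a X W) := by
  have h1 : commutatorMap R a (J X) (J W) = -(J * (commutatorMap R a X W * J)) := by
    ext Y
    have h2 (V : E) : R (J X) Y V = -R X (J Y) V := by
      have := hR.J_invariant h X (J Y) V
      rw [h.sq] at this
      rw [← this]; simp
    change _ = -J (commutatorMap R a X W (J Y))
    simp only [commutatorMap_apply, ha.comm, h2, hR.comm, map_neg, map_sub]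
    abel
  have h3 : commutatorMap R a X W * J * J = -commutatorMap R a X W := by
    ext Y
    simp [h.sq]
  rw [h1, map_neg, tr_mul_comm, h3, map_neg, neg_neg]

/-- Comparing the trace formula at `(X, W)` and at `(J X, J W)` gives `(d - 2) (J L J + L) = 0` with
`d` the real dimension, so `L` commutes with `J` once `d > 2`. -/
theorem Integrability.isHermitianOp (h : IsHermitianPair g J) (hR : IsKahlerCurvature g J R)
    (ha : IsHermitianOp g J a) (hI : Integrability g J R a L) (hE : 2 < Module.finrank ℝ E) :
    IsHermitianOp g J L := by
  refine ⟨hI.self_adj h, fun X ↦ ?_⟩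
  have h1 : J (L (J X)) = -L X := by
    refine h.ext_left fun W ↦ ?_
    have h2 := tr_commutatorMap_J h hR ha X W
    rw [hI.tr_commutatorMap h, hI.tr_commutatorMap h] at h2
    have h3 : g (L (J X)) (J W) = -g (J (L (J X))) W := by rw [h.skew]; simp
    simp only [h.sq, h.herm, map_neg, neg_apply, h3, h.skew X W] at h2
    have h4 : (2 : ℝ) < Module.finrank ℝ E := by exact_mod_cast hE
    have h5 : ((Module.finrank ℝ E : ℝ) - 2) * (g (J (L (J X))) W + g (L X) W) = 0 := by
      linarith
    rcases mul_eq_zero.mp h5 with h6 | h6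
    · linarith
    · simp only [map_neg, neg_apply]
      linarith
  apply h.J_injective
  rw [h1, h.sq]

/-- The tracefree part of `L` is determined by `a`. -/
theorem Integrability.trace_formula (h : IsHermitianPair g J) (hR : IsKahlerCurvature g J R)
    (ha : IsHermitianOp g J a) (hI : Integrability g J R a L) (hE : 2 < Module.finrank ℝ E)
    (X W : E) : (Module.finrank ℝ E : ℝ) * g (L X) W =
      tr E L * g X W + tr E (commutatorMap R a X W) := by
  have hL := hI.isHermitianOp h hR ha hE
  have h1 : tr E (J * L) = 0 := tr_eq_zero_of_skew h fun u v ↦ by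
    simp [h.skew, hL.self_adj, hL.comm]
  rw [hI.tr_commutatorMap h, h1, hL.comm, h.sq]
  simp
  ring

/-- If all `hsym X v` lie in a plane then `v` vanishes. -/
theorem eq_zero_of_hsym_mem_span (h : IsHermitianPair g J) (hE : 3 < Module.finrank ℝ E)
    {S T : E →L[ℝ] E} {v : E} (H : ∀ X, ∃ r s : ℝ, hsym g J X v = r • S + s • T) : v = 0 := by
  by_contra hv
  let f : E →ₗ[ℝ] (E →L[ℝ] E) :=
    { toFun := fun X ↦ hsym g J X v
      map_add' := fun X Y ↦ hsym_add_left g J X Y v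
      map_smul' := fun r X ↦ hsym_smul_left g J X v r }
  have h1 : Module.finrank ℝ f.range ≤ 2 := by
    have : f.range ≤ Submodule.span ℝ {S, T} := by
      rintro _ ⟨X, rfl⟩
      obtain ⟨r, s, hrs⟩ := H X
      exact Submodule.mem_span_pair.mpr ⟨r, s, hrs.symm⟩
    refine (Submodule.finrank_mono this).trans ?_
    classical
    have := finrank_span_finset_le_card (R := ℝ) ({S, T} : Finset (E →L[ℝ] E))
    simp only [Finset.coe_insert, Finset.coe_singleton] at this
    exact this.trans Finset.card_le_two
  -- `v` and `J v` are independent because `J v` has no real multiple equal to `v`: that would give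
  -- `(r² + 1) v = 0`. Nondegeneracy then provides `Z`.
  have hind : ∃ Z, g v Z = 1 ∧ g (J v) Z = 0 := by
    have : (h.toDual v) ∉ Submodule.span ℝ {h.toDual (J v)} := by
      intro hm
      obtain ⟨r, hr⟩ := Submodule.mem_span_singleton.mp hm
      rw [← map_smul] at hr
      have h3 := h.toDual.injective hr
      have h4 := congrArg J h3
      rw [map_smul, h.sq] at h4
      have h5 : (r * r + 1) • v = 0 := by
        have h6 : r • r • -v = v := by rw [h4, h3]
        rw [add_smul, one_smul, mul_smul]
        nth_rewrite 2 [← h6]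
        simp
      rcases smul_eq_zero.mp h5 with h6 | h6
      · nlinarith
      · exact hv h6
    obtain ⟨F, hF, hF'⟩ := Submodule.exists_le_ker_of_notMem this
    obtain ⟨Z, hZ⟩ := (Module.evalEquiv ℝ E).surjective F
    have h3 : F (h.toDual (J v)) = 0 := hF' (Submodule.mem_span_singleton_self _)
    rw [← hZ] at hF h3
    refine ⟨(g v Z)⁻¹ • Z, ?_, ?_⟩
    · have : g v Z ≠ 0 := hF
      simp [this]
    · have : g (J v) Z = 0 := h3
      simp [this]
  obtain ⟨Z, hZ, hZ'⟩ := hind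
  -- Evaluating `hsym X v = 0` at `Z` writes `X` as `p v + q J v`; substituting back leaves `2 p v =
  -- 0`. With a range of dimension at most two, rank-nullity contradicts dimension above three.
  have h2 : Module.finrank ℝ f.ker ≤ 1 := by
    have : f.ker ≤ Submodule.span ℝ {J v} := by
      intro X hX
      have h3 : ∀ W, hsym g J X v W = 0 := fun W ↦ by
        have : hsym g J X v = 0 := hX
        simp [this]
      have h4 := h3 Z
      rw [hsym_apply, hZ, hZ'] at h4
      have h5 : X = (-g X Z) • v + (-g (J X) Z) • J v := by
        rw [← sub_eq_zero, ← h4]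
        module
      generalize -g X Z = p at h5
      generalize -g (J X) Z = q at h5
      have h6 := h4
      rw [h5] at h6
      simp only [map_add, map_smul, add_apply, smul_apply, h.sq, hZ, hZ', map_neg, neg_apply,
        smul_eq_mul] at h6
      have h7 : (2 * p) • v = 0 := by
        rw [← h6]
        module
      rcases smul_eq_zero.mp h7 with h8 | h8
      · have : p = 0 := by linarith
        rw [h5, this]
        exact Submodule.mem_span_singleton.mpr ⟨q, by simp⟩
      · exact absurd h8 hv
    refine (Submodule.finrank_mono this).trans ?_
    exact (finrank_span_le_card _).trans (by simp)
  have := f.finrank_range_add_finrank_ker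
  omega

end Trace
end Kahler
end

/-! ### Commutants of hermitian operators. -/

noncomputable section

namespace Kahler

section Commutant

variable {E : Type*} [NormedAddCommGroup E] [NormedSpace ℝ E]
  {g : E →L[ℝ] E →L[ℝ] ℝ} {J : E →L[ℝ] E} {a A : E →L[ℝ] E}

/-- With `J` as multiplication by `i`, the operator `a` is complex linear and every vector is an
eigenvector, so `a` is a complex scalar. -/
theorem exists_eq_complex_smul (hJ : ∀ u, J (J u) = -u) (ha : ∀ u, a (J u) = J (a u))
    (H : ∀ v, ∃ p q : ℝ, a v = p • v + q • J v) : ∃ p q : ℝ, ∀ v, a v = p • v + q • J v := by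
  let Jc : Module.End ℝ E := J.toLinearMap
  have hJc : Jc * Jc = -1 := by
    ext u
    exact hJ u
  let _ : Module ℂ E := Module.compHom E (Complex.lift ⟨Jc, hJc⟩).toRingHom
  have hsmul (z : ℂ) (v : E) : z • v = z.re • v + z.im • J v := by
    change (Complex.lift ⟨Jc, hJc⟩ z) v = _
    rw [Complex.lift_apply]
    simp [Complex.liftAux_apply, Jc]
  let f : E →ₗ[ℂ] E :=
    { toFun := a
      map_add' := map_add a
      map_smul' := fun z v ↦ by simp [hsmul, ha] }
  obtain ⟨z, hz⟩ := LinearMap.exists_eq_smul_id_of_forall_notLinearIndependent (f := f) (by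
    intro v hv
    obtain ⟨p, q, hpq⟩ := H v
    rw [LinearIndependent.pair_iff] at hv
    have := hv ⟨p, q⟩ (-1) (by
      have : f v = p • v + q • J v := hpq
      rw [this, hsmul]
      simp only [neg_smul, one_smul]
      abel)
    simpa using this.2)
  exact ⟨z.re, z.im, fun v ↦ by
    rw [← hsmul]
    exact LinearMap.congr_fun hz v⟩

theorem IsHermitianPair.exists_apply_self_ne_zero (h : IsHermitianPair g J) [Nontrivial E] :
    ∃ u, g u u ≠ 0 := by
  by_contra! H
  obtain ⟨u, hu⟩ := exists_ne (0 : E)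
  refine hu (h.nondeg u fun v ↦ ?_)
  have h1 := H (u + v)
  simp only [map_add, add_apply, H, h.symm v u] at h1
  linarith

/-- Otherwise `a = p + q J`. Evaluating `g(a u, J u) = 0` at a non-null vector gives `q = 0`, and
`a` would be a real multiple of the identity. -/
theorem IsHermitianOp.exists_notMem_span (h : IsHermitianPair g J) (ha : IsHermitianOp g J a)
    [Nontrivial E] (hi : LinearIndependent ℝ ![1, a]) :
    ∃ v, a v ∉ Submodule.span ℝ {v, J v} := by
  by_contra! H
  obtain ⟨p, q, hpq⟩ := exists_eq_complex_smul h.sq ha.comm (fun v ↦ by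
    obtain ⟨p, q, hpq⟩ := Submodule.mem_span_pair.mp (H v)
    exact ⟨p, q, hpq.symm⟩)
  obtain ⟨u, hu⟩ := h.exists_apply_self_ne_zero
  have h1 := ha.apply_J_self h u
  rw [hpq] at h1
  simp only [map_add, map_smul, add_apply, smul_apply, h.apply_J_self, h.herm, smul_eq_mul] at h1
  have hq : q = 0 := by
    rcases mul_eq_zero.mp (by linarith : q * g u u = 0) with h2 | h2
    · exact h2
    · exact absurd h2 hu
  rw [LinearIndependent.pair_iff] at hi
  have := hi p (-1) (by
    ext v
    simp [hpq, hq])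
  simp at this

/-- This is complex independence of `v` and `w` in real terms: multiplying a relation by the
conjugate coefficient isolates `w`. -/
theorem linearIndependent_four (hJ : ∀ u, J (J u) = -u) {v w : E}
    (hw : w ∉ Submodule.span ℝ {v, J v}) : v = 0 ∨ LinearIndependent ℝ ![v, J v, w, J w] := by
  by_cases hv : v = 0
  · exact Or.inl hv
  right
  rw [Fintype.linearIndependent_iff]
  intro c hc
  simp only [Fin.sum_univ_four, Matrix.cons_val] at hc
  have key (p q : ℝ) (u : E) : p • (p • u + q • J u) - q • J (p • u + q • J u)
      = (p ^ 2 + q ^ 2) • u := by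
    simp only [map_add, map_smul, hJ]
    module
  have h1 : c 2 ^ 2 + c 3 ^ 2 = 0 := by
    by_contra hne
    apply hw
    have h2 : c 2 • w + c 3 • J w = -(c 0 • v + c 1 • J v) := by
      rw [← sub_eq_zero, ← hc]
      module
    have h3 := key (c 2) (c 3) w
    rw [h2] at h3
    have h4 : w = (c 2 ^ 2 + c 3 ^ 2)⁻¹ • ((c 2 ^ 2 + c 3 ^ 2) • w) := by
      rw [smul_smul, inv_mul_cancel₀ hne, one_smul]
    rw [h4, ← h3]
    refine Submodule.smul_mem _ _ (Submodule.mem_span_pair.mpr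
      ⟨-(c 2 * c 0) - c 3 * c 1, -(c 2 * c 1) + c 3 * c 0, ?_⟩)
    simp only [map_add, map_smul, hJ, map_neg]
    module
  have h2 : c 2 = 0 := by nlinarith [sq_nonneg (c 2), sq_nonneg (c 3)]
  have h3 : c 3 = 0 := by nlinarith [sq_nonneg (c 2), sq_nonneg (c 3)]
  have h4 := key (c 0) (c 1) v
  have h5 : c 0 • v + c 1 • J v = 0 := by
    rw [← hc, h2, h3]
    simp
  rw [h5] at h4
  have h6 : c 0 ^ 2 + c 1 ^ 2 = 0 := by
    rcases smul_eq_zero.mp (h4.symm.trans (by simp)) with h7 | h7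
    · exact h7
    · exact absurd h7 hv
  have h7 : c 0 = 0 := by nlinarith [sq_nonneg (c 0), sq_nonneg (c 1)]
  have h8 : c 1 = 0 := by nlinarith [sq_nonneg (c 0), sq_nonneg (c 1)]
  intro i
  fin_cases i
  · exact h7
  · exact h8
  · exact h2
  · exact h3

/-- In real dimension four, skew operators commuting with two hermitian operators which are
independent together with the identity are multiples of `J`. -/
theorem eq_smul_J_of_commute (h : IsHermitianPair g J) (hE : Module.finrank ℝ E = 4)
    (ha : IsHermitianOp g J a) (hA : IsHermitianOp g J A)
    (hi : LinearIndependent ℝ ![1, a, A]) {T : E →L[ℝ] E}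
    (hT : ∀ u v, g (T u) v = -g u (T v)) (hTJ : ∀ u, T (J u) = J (T u))
    (hTa : ∀ u, T (a u) = a (T u)) (hTA : ∀ u, T (A u) = A (T u)) :
    ∃ r : ℝ, ∀ u, T u = r • J u := by
  have : Nontrivial E := Module.nontrivial_of_finrank_pos (R := ℝ) (by omega)
  have hi' : LinearIndependent ℝ ![1, a] := by
    rw [LinearIndependent.pair_iff]
    intro s t hst
    rw [Fintype.linearIndependent_iff] at hi
    have := hi ![s, t, 0] (by simpa [Fin.sum_univ_three] using hst)
    exact ⟨this 0, this 1⟩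
  obtain ⟨v, hv⟩ := ha.exists_notMem_span h hi'
  have hb := (linearIndependent_four h.sq hv).resolve_left (by
    rintro rfl
    simp at hv)
  let b := basisOfLinearIndependentOfCardEqFinrank hb (by simp [hE])
  have hbv : ⇑b = ![v, J v, a v, J (a v)] := coe_basisOfLinearIndependentOfCardEqFinrank _ _
  -- `v` and `a v` form a complex basis, so `v` is a cyclic vector of `a`. A complex linear `P`
  -- commuting with `a` is determined by `P v`, hence is a complex polynomial in `a` of degree at
  -- most one.
  have key {P : E →L[ℝ] E} (hPJ : ∀ u, P (J u) = J (P u)) (hPa : ∀ u, P (a u) = a (P u)) :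
      ∃ p q r s : ℝ, ∀ u, P u = p • u + q • J u + r • a u + s • J (a u) := by
    refine ⟨b.repr (P v) 0, b.repr (P v) 1, b.repr (P v) 2, b.repr (P v) 3, fun u ↦ ?_⟩
    have h1 := b.sum_repr (P v)
    simp only [Fin.sum_univ_four, hbv, Matrix.cons_val] at h1
    generalize b.repr (P v) 0 = p at *
    generalize b.repr (P v) 1 = q at *
    generalize b.repr (P v) 2 = r at *
    generalize b.repr (P v) 3 = s at *
    have h2 : P.toLinearMap = (p • 1 + q • J + r • a + s • (J * a) : E →L[ℝ] E).toLinearMap := by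
      refine b.ext fun i ↦ ?_
      rw [hbv]
      fin_cases i
      · simp [← h1]
      · simp [hPJ, ← h1, ha.comm]
      · simp [hPa, ← h1, ha.comm]
      · simp [hPa, hPJ, ← h1, ha.comm]
    simpa using LinearMap.congr_fun h2 u
  have quad {p r : ℝ} (H : ∀ u, p * g u u + r * g (a u) u = 0) : p = 0 ∧ r = 0 := by
    have h1 : p • (1 : E →L[ℝ] E) + r • a = 0 := by
      refine ((isHermitianOp_one.smul p).add (ha.smul r)).eq_of_quadratic h (b := 0)
        ⟨by simp, by simp⟩ fun u ↦ ?_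
      simpa using H u
    rw [LinearIndependent.pair_iff] at hi'
    exact hi' p r h1
  -- If `A` commuted with `a`, it would be such a polynomial, with real coefficients because it is
  -- hermitian; this contradicts independence of `1, a, A`.
  have hna : ∃ u, A (a u) ≠ a (A u) := by
    by_contra! hc
    obtain ⟨p, q, r, s, hA'⟩ := key hA.comm hc
    obtain ⟨hq, hs⟩ := quad (p := q) (r := s) fun u ↦ by
      have := hA.apply_J_self h u
      rw [hA'] at this
      simpa [h.apply_J_self, h.herm, ha.apply_J_self h] using this
    rw [Fintype.linearIndependent_iff] at hi
    have := hi ![p, r, -1] (by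
      ext u
      simp [Fin.sum_univ_three, hA', hq, hs]) 2
    simp at this
  obtain ⟨u, hu⟩ := hna
  obtain ⟨p, q, r, s, hT'⟩ := key hTJ hTa
  -- Skewness removes the hermitian part `p + r a` of `T`, leaving `q J + s J a`. Commuting with `A`
  -- then gives `s J [A, a] = 0`, and so `s = 0`.
  obtain ⟨hp, hr⟩ := quad (p := p) (r := r) fun u ↦ by
    have h1 := hT u u
    rw [h.symm u] at h1
    have h2 : g (T u) u = 0 := by linarith
    rw [hT'] at h2
    simpa [h.skew, h.apply_J_self, ha.apply_J_self h] using h2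
  refine ⟨q, fun w ↦ ?_⟩
  have h1 := hTA u
  rw [hT', hT', hp, hr] at h1
  simp only [map_add, map_smul, zero_smul, zero_add, add_zero, hA.comm] at h1
  have h2 : s • J (a (A u) - A (a u)) = 0 := by
    rw [map_sub, smul_sub, sub_eq_zero]
    exact add_left_cancel h1
  rcases smul_eq_zero.mp h2 with h3 | h3
  · rw [hT', hp, hr, h3]
    simp
  · exact absurd (sub_eq_zero.mp (h.J_injective (by rw [h3, map_zero]))).symm hu

end Commutant
end Kahler
end

/-! ### Constancy of the common factor. -/

noncomputable section

namespace Kahler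

section Constancy

variable {E : Type*} [NormedAddCommGroup E] [NormedSpace ℝ E] [FiniteDimensional ℝ E]
  {g : E →L[ℝ] E →L[ℝ] ℝ} {J : E →L[ℝ] E} {R : E →L[ℝ] E →L[ℝ] E →L[ℝ] E} {a A : E →L[ℝ] E}

omit [FiniteDimensional ℝ E] in
theorem finrank_span_pair_le (X Y : E) : Module.finrank ℝ (Submodule.span ℝ {X, Y}) ≤ 2 := by
  classical
  have h1 := finrank_span_finset_le_card (R := ℝ) ({X, Y} : Finset E)
  rw [Finset.coe_pair] at h1
  exact h1.trans Finset.card_le_two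

/-- A form `θ` with `J`-invariant `θ ∧ 1` on a subspace of real dimension more
than two vanishes there. -/
theorem eq_zero_of_wedge_J_invariant (hJ : ∀ u, J (J u) = -u) {N : Submodule ℝ E}
    (hd : 2 < Module.finrank ℝ N) {θ : E →L[ℝ] ℝ}
    (H : ∀ X ∈ N, ∀ Y ∈ N, θ (J X) • J Y - θ (J Y) • J X = θ X • Y - θ Y • X) {X : E}
    (hX : X ∈ N) : θ X = 0 := by
  by_contra hθ
  set S := Submodule.span ℝ {X, J X} with hS
  have hSX : X ∈ S := Submodule.subset_span (by simp)
  have hSJ : J X ∈ S := Submodule.subset_span (by simp)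
  obtain ⟨Y, hYN, hY⟩ : ∃ Y ∈ N, Y ∉ S := by
    by_contra! hNS
    have h1 := Submodule.finrank_mono (R := ℝ) (s := N) (t := S) hNS
    have h2 := finrank_span_pair_le X (J X)
    rw [← hS] at h2
    omega
  apply hY
  -- The hypothesis and its image under `J` are two linear equations for `Y` and `J Y` modulo the
  -- span of `X` and `J X`; their determinant is `θ(X)² + θ(J X)²`.
  have h1 : (θ X ^ 2 + θ (J X) ^ 2) • Y =
      θ X • (θ Y • X - θ (J Y) • J X) + θ (J X) • (θ Y • J X + θ (J Y) • X) := by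
    have h2 := H X hX Y hYN
    have h3 := congrArg J h2
    simp only [map_sub, map_smul, hJ] at h3
    have h4 : (θ X ^ 2 + θ (J X) ^ 2) • Y = θ X • (θ X • Y - θ Y • X - (θ (J X) • J Y - θ
        (J Y) • J X))
      + θ X • (θ Y • X - θ (J Y) • J X)
      + θ (J X) • (θ X • J Y - θ Y • J X - (θ (J X) • -Y - θ (J Y) • -X))
      + θ (J X) • (θ Y • J X + θ (J Y) • X) := by module
    rw [h4, h2, h3]
    simp
  have h2 : θ X ^ 2 + θ (J X) ^ 2 ≠ 0 := by positivity
  have h3 : Y = (θ X ^ 2 + θ (J X) ^ 2)⁻¹ • ((θ X ^ 2 + θ (J X) ^ 2) • Y) := by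
    rw [smul_smul, inv_mul_cancel₀ h2, one_smul]
  rw [h3, h1]
  have h5 (p q : ℝ) (u v : E) (hu : u ∈ S) (hv : v ∈ S) : p • u + q • v ∈ S :=
    S.add_mem (S.smul_mem _ hu) (S.smul_mem _ hv)
  refine S.smul_mem _ (h5 _ _ _ _ ?_ (h5 _ _ _ _ hSJ hSX))
  rw [sub_eq_add_neg, ← neg_smul]
  exact h5 _ _ _ _ hSX hSJ

/-- The curvature minus the curvature of constant holomorphic sectional curvature. -/
def reducedCurvature (g : E →L[ℝ] E →L[ℝ] ℝ) (J : E →L[ℝ] E) (R : E →L[ℝ] E →L[ℝ] E →L[ℝ] E)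
    (B : ℝ) (X Y : E) : E →L[ℝ] E :=
  R X Y + B • ((g Y).smulRight X - (g X).smulRight Y + (g (J Y)).smulRight (J X)
    - (g (J X)).smulRight (J Y) + (2 * g X (J Y)) • J)

omit [FiniteDimensional ℝ E] in
theorem reducedCurvature_apply (B : ℝ) (X Y Z : E) :
    reducedCurvature g J R B X Y Z = R X Y Z + B • (g Y Z • X - g X Z • Y + g (J Y) Z • J X
      - g (J X) Z • J Y + (2 * g X (J Y)) • J Z) := by
  simp [reducedCurvature]

omit [FiniteDimensional ℝ E] in
theorem reducedCurvature_J (h : IsHermitianPair g J) (hR : IsKahlerCurvature g J R)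
    (B : ℝ) (X Y Z : E) :
    reducedCurvature g J R B X Y (J Z) = J (reducedCurvature g J R B X Y Z) := by
  simp only [reducedCurvature_apply, map_add, map_sub, map_smul, h.sq, h.herm, hR.comm,
    map_neg, h.skew, neg_smul]
  module

omit [FiniteDimensional ℝ E] in
theorem reducedCurvature_skew (h : IsHermitianPair g J) (hR : IsKahlerCurvature g J R)
    (B : ℝ) (X Y Z W : E) :
    g (reducedCurvature g J R B X Y Z) W = -g Z (reducedCurvature g J R B X Y W) := by
  simp only [reducedCurvature_apply, map_add, map_sub, map_smul, add_apply, sub_apply, smul_apply,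
    smul_eq_mul]
  rw [h.symm Z X, h.symm Z Y, h.symm Z (J X), h.symm Z (J Y), hR.skew, h.skew Z W]
  ring

omit [FiniteDimensional ℝ E] in
theorem reducedCurvature_bianchi (h : IsHermitianPair g J) (hR : IsKahlerCurvature g J R)
    (B : ℝ) (X Y Z : E) :
    reducedCurvature g J R B X Y Z + reducedCurvature g J R B Y Z X
      + reducedCurvature g J R B Z X Y = 0 := by
  have h1 := hR.bianchi X Y Z
  have e1 := h.symm Z (J X)
  have e2 := h.symm Z (J Y)
  have e3 := h.symm Y (J X)
  have e4 := h.skew X Z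
  have e5 := h.skew Y Z
  have e6 := h.skew X Y
  simp only [reducedCurvature_apply, h.symm Z X, h.symm Z Y, h.symm Y X, h.skew, e1, e2, e3]
  rw [← sub_eq_zero, sub_zero, ← h1]
  module

omit [FiniteDimensional ℝ E] in
-- The integrability condition with `L = B a + m` says that `[R(X, Y), a]` is what the
-- constant-curvature model gives; the `m` terms cancel by symmetry of `hsym`.
theorem reducedCurvature_comm (ha : IsHermitianOp g J a) {B m : ℝ}
    (hI : Integrability g J R a (B • a + m • 1)) (X Y Z : E) :
    reducedCurvature g J R B X Y (a Z) = a (reducedCurvature g J R B X Y Z) := by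
  have h1 := hI X Y Z
  have h2 : R X Y (a Z) = a (R X Y Z) + (hsym g J Y (B • a X + m • X) Z
      - hsym g J X (B • a Y + m • Y) Z) := by
    rw [← sub_eq_iff_eq_add', h1]; rfl
  simp only [reducedCurvature_apply, h2, hsym_apply, map_add, map_sub, map_smul, add_apply,
    smul_apply, ha.comm, ← ha.self_adj, smul_eq_mul]
  module

omit [FiniteDimensional ℝ E] in
/-- In real dimension four the curvature is determined by two independent solutions. -/
theorem reducedCurvature_eq_zero (h : IsHermitianPair g J) (hE : Module.finrank ℝ E = 4)
    (hR : IsKahlerCurvature g J R)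
    (ha : IsHermitianOp g J a) (hA : IsHermitianOp g J A)
    (hi : LinearIndependent ℝ ![1, a, A]) {B m m' : ℝ}
    (hI : Integrability g J R a (B • a + m • 1))
    (hI' : Integrability g J R A (B • A + m' • 1)) (X Y : E) :
    reducedCurvature g J R B X Y = 0 := by
  have key (X Y : E) : ∃ r : ℝ, ∀ u, reducedCurvature g J R B X Y u = r • J u :=
    eq_smul_J_of_commute h hE ha hA hi (reducedCurvature_skew h hR B X Y)
      (reducedCurvature_J h hR B X Y) (reducedCurvature_comm ha hI X Y)
      (reducedCurvature_comm hA hI' X Y)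
  -- The reduced curvature is a scalar 2-form times `J`. For `Z` outside the span of `X` and `Y`,
  -- the Bianchi identity forces the coefficient at `(X, Y)` to vanish.
  obtain ⟨Z, hZ⟩ : ∃ Z, Z ∉ Submodule.span ℝ {X, Y} := by
    by_contra! H
    have h1 : Submodule.span ℝ {X, Y} = ⊤ := Submodule.eq_top_iff'.mpr H
    have h2 := finrank_span_pair_le X Y
    rw [h1, finrank_top] at h2
    omega
  obtain ⟨r, hr⟩ := key X Y
  obtain ⟨s, hs⟩ := key Y Z
  obtain ⟨t, ht⟩ := key Z X
  have h1 := reducedCurvature_bianchi h hR B X Y Z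
  rw [hr, hs, ht] at h1
  have h2 : r • Z + s • X + t • Y = 0 := by
    apply h.J_injective
    simpa using h1
  have hr0 : r = 0 := by
    by_contra hne
    apply hZ
    refine Submodule.mem_span_pair.mpr ⟨-(r⁻¹ * s), -(r⁻¹ * t), ?_⟩
    have h3 : r⁻¹ • (r • Z + s • X + t • Y) = 0 := by rw [h2, smul_zero]
    have h4 : Z = (r⁻¹ * r) • Z := by rw [inv_mul_cancel₀ hne, one_smul]
    rw [h4, ← sub_eq_zero, ← neg_eq_zero, ← h3]
    module
  ext u
  rw [hr, hr0]
  simp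

/-- The derivative of the curvature identity for `lam` when `∇ lam = B a + m` with non-constant
factors. -/
def RicciIdentity (g : E →L[ℝ] E →L[ℝ] ℝ) (J : E →L[ℝ] E) (R : E →L[ℝ] E →L[ℝ] E →L[ℝ] E)
    (a : E →L[ℝ] E) (lam : E) (B : ℝ) (b θ : E →L[ℝ] ℝ) : Prop :=
  ∀ X Y, R X Y lam = θ X • Y - θ Y • X + b X • a Y - b Y • a X
    + B • (hsym g J X lam Y - hsym g J Y lam X)

omit [FiniteDimensional ℝ E] in
-- On `lam` the model curvature absorbs the `hsym` terms up to `2 B g(lam, ·) ∧ 1`, which shifts `θ`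
-- to `θ - 2 B g(lam, ·)`.
theorem RicciIdentity.reducedCurvature_eq (h : IsHermitianPair g J) {lam : E} {B : ℝ}
    {b θ : E →L[ℝ] ℝ} (H : RicciIdentity g J R a lam B b θ) (X Y : E) :
    reducedCurvature g J R B X Y lam =
      (θ - (2 * B) • g lam) X • Y - (θ - (2 * B) • g lam) Y • X + b X • a Y - b Y • a X := by
  rw [reducedCurvature_apply, H X Y]
  simp only [hsym_apply, sub_apply, smul_apply, smul_eq_mul]
  rw [h.symm Y X, h.symm lam Y, h.symm lam X, h.skew lam Y, h.symm lam (J Y), h.skew lam X,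
    h.symm lam (J X), h.skew X Y, h.symm (J Y) X]
  module

omit [FiniteDimensional ℝ E] in
-- The reduced curvature is unchanged when `J` is applied to both of its first two arguments, so its
-- value on `lam` is too. This replaces its vanishing when the dimension exceeds four.
theorem RicciIdentity.J_invariant (h : IsHermitianPair g J) (hR : IsKahlerCurvature g J R)
    {lam : E} {B : ℝ} {b θ : E →L[ℝ] ℝ} (H : RicciIdentity g J R a lam B b θ)
    (ha : IsHermitianOp g J a) (X Y : E) :
    (θ - (2 * B) • g lam) (J X) • J Y - (θ - (2 * B) • g lam) (J Y) • J X + b (J X) • J (a Y)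
      - b (J Y) • J (a X) =
    (θ - (2 * B) • g lam) X • Y - (θ - (2 * B) • g lam) Y • X + b X • a Y - b Y • a X := by
  rw [← H.reducedCurvature_eq h, ← ha.comm, ← ha.comm, ← H.reducedCurvature_eq h,
    reducedCurvature_apply, reducedCurvature_apply, hR.J_invariant h]
  simp only [h.sq, map_neg, neg_apply]
  rw [h.symm (J X) Y, h.symm X (J Y), h.skew Y X, h.symm Y (J X)]
  module

/-- With a constant factor, the scalar part of `∇ lam` has gradient `2 B lam`. -/
theorem RicciIdentity.eq_of_eq_zero (h : IsHermitianPair g J) (hR : IsKahlerCurvature g J R)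
    (hE : 2 < Module.finrank ℝ E)
    {lam : E} {B : ℝ} {b θ : E →L[ℝ] ℝ} (H : RicciIdentity g J R a lam B b θ)
    (ha : IsHermitianOp g J a) (hb : b = 0) (X : E) : θ X = 2 * B * g lam X := by
  have h1 := eq_zero_of_wedge_J_invariant h.sq (N := ⊤) (by simpa using hE)
    (θ := θ - (2 * B) • g lam) (fun X _ Y _ ↦ by
      have := H.J_invariant h hR ha X Y
      simpa only [hb, zero_apply, zero_smul, add_zero, sub_zero] using this) (X := X) (by simp)
  simp only [sub_apply, smul_apply, smul_eq_mul] at h1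
  linarith

/-- Vanishing of the reduced curvature leaves `η ∧ 1 + b ∧ a = 0`. If `b ≠ 0`, then `η` vanishes on
`ker b` and `a` is a scalar there; since `a` commutes with `J` and `ker b` is not `J`-invariant, `a`
is a scalar everywhere. -/
theorem RicciIdentity.factor_eq_zero_of_finrank_eq_four (h : IsHermitianPair g J)
    (hE : Module.finrank ℝ E = 4) (hR : IsKahlerCurvature g J R)
    (ha : IsHermitianOp g J a) (hA : IsHermitianOp g J A)
    (hi : LinearIndependent ℝ ![1, a, A]) {B m m' : ℝ}
    (hI : Integrability g J R a (B • a + m • 1))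
    (hI' : Integrability g J R A (B • A + m' • 1))
    {lam : E} {b θ : E →L[ℝ] ℝ} (H : RicciIdentity g J R a lam B b θ) : b = 0 := by
  have h0 (X Y : E) : (θ - (2 * B) • g lam) X • Y - (θ - (2 * B) • g lam) Y • X + b X • a Y
      - b Y • a X = 0 := by
    rw [← H.reducedCurvature_eq h, reducedCurvature_eq_zero h hE hR ha hA hi hI hI']
    rfl
  generalize θ - (2 * B) • g lam = η at h0
  by_contra hb
  obtain ⟨Y, hY⟩ : ∃ Y, b Y = 1 := by
    obtain ⟨Z, hZ⟩ := DFunLike.ne_iff.mp hb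
    have : b Z ≠ 0 := hZ
    exact ⟨(b Z)⁻¹ • Z, by simp [this]⟩
  have hη (X : E) (hX : b X = 0) : η X = 0 := by
    by_contra hne
    have h1 : LinearMap.ker b.toLinearMap ≤ Submodule.span ℝ {X} := by
      intro Z hZ
      have hZ' : b Z = 0 := hZ
      have h2 := h0 X Z
      rw [hX, hZ'] at h2
      have h3 : η X • Z = η Z • X := by
        rw [← sub_eq_zero, ← h2]
        module
      refine Submodule.mem_span_singleton.mpr ⟨(η X)⁻¹ * η Z, ?_⟩
      rw [mul_smul, ← h3, smul_smul, inv_mul_cancel₀ hne, one_smul]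
    have h2 := Submodule.finrank_mono h1
    have h3 : Module.finrank ℝ (Submodule.span ℝ {X}) ≤ 1 :=
      (finrank_span_le_card _).trans (by simp)
    have h4 := b.toLinearMap.finrank_range_add_finrank_ker
    have h5 := Submodule.finrank_le (LinearMap.range b.toLinearMap)
    rw [Module.finrank_self] at h5
    omega
  have h1 (X : E) (hX : b X = 0) : a X = (-η Y) • X := by
    have h2 := h0 X Y
    rw [hX, hη X hX, hY] at h2
    rw [← sub_eq_zero, ← neg_eq_zero, ← h2]
    module
  obtain ⟨X, hX, hJX⟩ : ∃ X, b X = 0 ∧ b (J X) ≠ 0 := by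
    refine ⟨J Y - b (J Y) • Y, by simp [hY], ?_⟩
    simp only [map_sub, map_smul, h.sq, map_neg, hY, smul_eq_mul]
    nlinarith [sq_nonneg (b (J Y))]
  have h2 : a = (-η Y) • 1 := by
    ext Z
    have h3 : b (Z - (b Z / b (J X)) • J X) = 0 := by
      simp [hJX]
    have h4 := h1 _ h3
    simp only [map_sub, map_smul, ha.comm, h1 X hX] at h4
    change a Z = (-η Y) • Z
    rw [sub_eq_iff_eq_add] at h4
    rw [h4]
    module
  rw [Fintype.linearIndependent_iff] at hi
  have := hi ![-η Y, -1, 0] (by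
    rw [h2]
    simp [Fin.sum_univ_three]) 1
  simp at this

/-- In real dimension greater than four, a hermitian operator with a factor of non-constant
trace type is a rank one perturbation of a multiple of the identity. -/
theorem RicciIdentity.quadratic_of_finrank_gt_four (h : IsHermitianPair g J)
    (hE : 4 < Module.finrank ℝ E) (hR : IsKahlerCurvature g J R)
    (ha : IsHermitianOp g J a) {B : ℝ}
    {lam : E} {b θ : E →L[ℝ] ℝ} (H : RicciIdentity g J R a lam B b θ) (hb : b ≠ 0) :
    ∃ p k : ℝ, ∀ Z, g (a Z) Z = p * g Z Z + k * (b Z ^ 2 + b (J Z) ^ 2) := by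
  have h0 := H.J_invariant h hR ha
  generalize θ - (2 * B) • g lam = η at h0
  -- Apart from sign conventions, `Y` is `Z` divided by the complex value formed from `b(Z)` and
  -- `b(J Z)`.
  obtain ⟨Y, hY, hJY⟩ : ∃ Y, b Y = 1 ∧ b (J Y) = 0 := by
    obtain ⟨Z, hZ⟩ := DFunLike.ne_iff.mp hb
    have hZ' : b Z ≠ 0 := hZ
    have h1 : b Z ^ 2 + b (J Z) ^ 2 ≠ 0 := by positivity
    refine ⟨(b Z ^ 2 + b (J Z) ^ 2)⁻¹ • (b Z • Z + b (J Z) • J Z), ?_, ?_⟩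
    · simp only [map_smul, map_add, smul_eq_mul]
      field_simp
    · simp only [map_smul, map_add, smul_eq_mul, h.sq, map_neg]
      ring
  let N : Submodule ℝ E := LinearMap.ker b.toLinearMap ⊓ LinearMap.ker (b ∘L J).toLinearMap
  have hN {X : E} : X ∈ N ↔ b X = 0 ∧ b (J X) = 0 := Iff.rfl
  have hNJ (X : E) (hX : X ∈ N) : J X ∈ N := by
    rw [hN] at hX ⊢
    exact ⟨hX.2, by rw [h.sq, map_neg, hX.1, neg_zero]⟩
  have hd : Module.finrank ℝ E ≤ Module.finrank ℝ N + 2 := by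
    have h1 := Submodule.finrank_sup_add_finrank_inf_eq (LinearMap.ker b.toLinearMap)
      (LinearMap.ker (b ∘L J).toLinearMap)
    have h2 := b.toLinearMap.finrank_range_add_finrank_ker
    have h3 := (b ∘L J).toLinearMap.finrank_range_add_finrank_ker
    have h4 := Submodule.finrank_le (LinearMap.range b.toLinearMap)
    have h5 := Submodule.finrank_le (LinearMap.range (b ∘L J).toLinearMap)
    have h6 := Submodule.finrank_le
      (LinearMap.ker b.toLinearMap ⊔ LinearMap.ker (b ∘L J).toLinearMap)
    rw [Module.finrank_self] at h4 h5
    change _ = _ at h1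
    change _ ≤ Module.finrank ℝ (LinearMap.ker b.toLinearMap ⊓ LinearMap.ker (b ∘L J).toLinearMap :
      Submodule ℝ E) + 2
    omega
  have hη (X : E) (hX : X ∈ N) : η X = 0 := by
    refine eq_zero_of_wedge_J_invariant h.sq (by omega) (fun X hX Y hY ↦ ?_) hX
    have h1 := h0 X Y
    rw [(hN.mp hX).1, (hN.mp hX).2, (hN.mp hY).1, (hN.mp hY).2] at h1
    simpa using h1
  -- Pairing `X` in the complex hyperplane `N` with `Y` leaves a single term containing `a X`.
  have h1 (X : E) (hX : X ∈ N) : a X = (-η Y) • X + η (J Y) • J X := by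
    have h2 := h0 X Y
    rw [(hN.mp hX).1, (hN.mp hX).2, hη X hX, hη _ (hNJ X hX), hY, hJY] at h2
    have h3 : a X = (-η Y) • X + η (J Y) • J X + ((0 : ℝ) • J Y - η (J Y) • J X
      + (0 : ℝ) • J (a Y) - (0 : ℝ) • J (a X)
      - ((0 : ℝ) • Y - η Y • X + (0 : ℝ) • a Y - (1 : ℝ) • a X)) := by module
    rw [h2, sub_self, add_zero] at h3
    exact h3
  -- Otherwise `g(a X, J X) = 0` makes `N` totally isotropic. Then `2 dim N ≤ dim E`, whereas `dim N
  -- ≥ dim E - 2`, which is impossible above dimension four.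
  have hq : η (J Y) = 0 := by
    by_contra hne
    have h2 (X : E) (hX : X ∈ N) : g X X = 0 := by
      have h3 := ha.apply_J_self h X
      rw [h1 X hX] at h3
      simp only [map_add, map_smul, add_apply, smul_apply, smul_eq_mul, h.herm,
        h.apply_J_self] at h3
      rcases mul_eq_zero.mp (by linarith : η (J Y) * g X X = 0) with h4 | h4
      · exact absurd h4 hne
      · exact h4
    have h3 : N.map h.toDual.toLinearMap ≤ N.dualAnnihilator := by
      rintro _ ⟨X, hX, rfl⟩
      rw [Submodule.mem_dualAnnihilator]
      intro Z hZ
      change g X Z = 0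
      have h4 := h2 _ (N.add_mem hX hZ)
      simp only [map_add, add_apply, h2 X hX, h2 Z hZ, h.symm Z X] at h4
      linarith
    have h4 := Submodule.finrank_mono h3
    rw [LinearEquiv.finrank_map_eq] at h4
    have h5 := Subspace.finrank_add_finrank_dualAnnihilator_eq N
    omega
  refine ⟨-η Y, g (a Y) Y - (-η Y) * g Y Y, fun Z ↦ ?_⟩
  -- `D` is hermitian and vanishes on `N`, so its quadratic form depends only on the component of
  -- `Z` along `Y` and `J Y`; the coefficient is `k = g(D Y, Y)`.
  have hD : IsHermitianOp g J (a - (-η Y) • (1 : E →L[ℝ] E)) := ha.sub (isHermitianOp_one.smul _)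
  set D := a - (-η Y) • (1 : E →L[ℝ] E) with hDdef
  have hDapp (X : E) : D X = a X - (-η Y) • X := rfl
  have hDN (X : E) (hX : X ∈ N) : D X = 0 := by
    rw [hDapp, h1 X hX, hq]
    module
  have hX : Z - (b Z • Y - b (J Z) • J Y) ∈ N := by
    rw [hN]
    simp [hY, hJY, h.sq]
  have h3 : Z = (Z - (b Z • Y - b (J Z) • J Y)) + (b Z • Y - b (J Z) • J Y) := by abel
  have h4 : g (D Z) Z = (b Z ^ 2 + b (J Z) ^ 2) * g (D Y) Y := by
    have h5 : D Z = D (b Z • Y - b (J Z) • J Y) := by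
      conv_lhs => rw [h3]
      rw [map_add, hDN _ hX, zero_add]
    rw [h5, hD.self_adj, h5, ← hD.self_adj]
    have h6 := hD.apply_J_self h Y
    have h7 : g (D (J Y)) Y = 0 := by
      rw [hD.self_adj, h.symm]
      exact h6
    simp only [map_sub, map_smul, sub_apply, smul_apply, smul_eq_mul, hD.comm, h.herm, h6]
    rw [← hD.comm, h7]
    ring
  rw [hDapp, hDapp] at h4
  simp only [map_sub, map_smul, sub_apply, smul_apply, smul_eq_mul] at h4
  linarith

/-- The common factor of two independent solutions is constant. -/
theorem RicciIdentity.factor_eq_zero (h : IsHermitianPair g J)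
    (hE : 4 ≤ Module.finrank ℝ E) (hR : IsKahlerCurvature g J R)
    (ha : IsHermitianOp g J a) (hA : IsHermitianOp g J A)
    (hi : LinearIndependent ℝ ![1, a, A]) {B m m' : ℝ}
    (hI : Integrability g J R a (B • a + m • 1))
    (hI' : Integrability g J R A (B • A + m' • 1))
    {lam lam' : E} {b θ θ' : E →L[ℝ] ℝ} (H : RicciIdentity g J R a lam B b θ)
    (H' : RicciIdentity g J R A lam' B b θ') : b = 0 := by
  rcases hE.eq_or_lt with hE | hE
  · exact H.factor_eq_zero_of_finrank_eq_four h hE.symm hR ha hA hi hI hI'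
  by_contra hb
  obtain ⟨p, k, hk⟩ := H.quadratic_of_finrank_gt_four h hE hR ha hb
  obtain ⟨p', k', hk'⟩ := H'.quadratic_of_finrank_gt_four h hE hR hA hb
  have hq := linearIndependent_quadratic h ha hA hi
  rw [Fintype.linearIndependent_iff] at hq
  -- Both quadratic forms involve the same `b`, so this combination eliminates `b(Z)² + b(J Z)²`. It
  -- forces `k = 0`, and then `a` itself is proportional to the identity.
  have h1 := hq ![k * p' - k' * p, k', -k] (by
    ext Z
    simp only [Fin.sum_univ_three, Matrix.cons_val, Pi.add_apply, Pi.smul_apply, smul_eq_mul,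
      Pi.zero_apply, hk, hk']
    ring) 2
  have h2 : k = 0 := by simpa using h1
  have h3 := hq ![-p, 1, 0] (by
    ext Z
    simp only [Fin.sum_univ_three, Matrix.cons_val, Pi.add_apply, Pi.smul_apply, smul_eq_mul,
      Pi.zero_apply, hk, h2]
    ring) 1
  simp at h3

end Constancy
end Kahler
end

noncomputable section

namespace Kahler

/-! ### Kähler structures and the h-projective equation in coordinates -/

section Local

open Filter Topology

set_option synthInstance.maxHeartbeats 200000
set_option linter.unusedSimpArgs false

variable {E : Type*} [NormedAddCommGroup E] [NormedSpace ℝ E]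

/-- The form of the symmetry of second derivatives suited to first-order systems: `Φ` is the
right-hand side prescribed for the derivative of `f`. -/
theorem fderiv_fderiv_comm {F : Type*} [NormedAddCommGroup F] [NormedSpace ℝ F] {f : E → F} {y : E}
    (hf : ContDiffAt ℝ ∞ f y) {Φ : E → E → F} (hΦ : ∀ᶠ z in 𝓝 y, ∀ w, fderiv ℝ f z w = Φ z w)
    (v w : E) : fderiv ℝ (fun z ↦ Φ z w) y v = fderiv ℝ (fun z ↦ Φ z v) y w := by
  have h1 (u : E) : fderiv ℝ (fun z ↦ Φ z u) y = (fderiv ℝ (fderiv ℝ f) y).flip u := by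
    have h2 : (fun z ↦ Φ z u) =ᶠ[𝓝 y] fun z ↦ fderiv ℝ f z u := by
      filter_upwards [hΦ] with z hz
      exact (hz u).symm
    have h3 : DifferentiableAt ℝ (fderiv ℝ f) y :=
      (hf.fderiv_right (m := ∞) (by simp)).differentiableAt (by simp)
    rw [h2.fderiv_eq, fderiv_clm_apply h3 (by fun_prop)]
    ext x
    simp
  rw [h1, h1]
  exact (hf.isSymmSndFDerivAt (by simpa using WithTop.coe_le_coe.mpr (le_top : (2 : ℕ∞) ≤ ⊤))) v w

theorem fderiv_apply_apply {F F' : Type*} [NormedAddCommGroup F] [NormedSpace ℝ F]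
    [NormedAddCommGroup F'] [NormedSpace ℝ F'] {c : E → F →L[ℝ] F'} {u : E → F} {y : E}
    (hc : DifferentiableAt ℝ c y) (hu : DifferentiableAt ℝ u y) (v : E) :
    fderiv ℝ (fun z ↦ c z (u z)) y v = fderiv ℝ c y v (u y) + c y (fderiv ℝ u y v) := by
  rw [fderiv_clm_apply hc hu]
  simp [add_comm]

theorem fderiv_smul_apply {F : Type*} [NormedAddCommGroup F] [NormedSpace ℝ F]
    {c : E → ℝ} {u : E → F} {y : E}
    (hc : DifferentiableAt ℝ c y) (hu : DifferentiableAt ℝ u y) (v : E) :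
    fderiv ℝ (fun z ↦ c z • u z) y v = fderiv ℝ c y v • u y + c y • fderiv ℝ u y v := by
  rw [fderiv_fun_smul hc hu]
  simp [add_comm]

theorem fderiv_const_apply' {F : Type*} [NormedAddCommGroup F] [NormedSpace ℝ F] (u : F) (y v : E) :
    fderiv ℝ (fun _ : E ↦ u) y v = 0 := by
  simp

/-- The components of a Kähler structure with Levi-Civita connection `Γ` on a coordinate
domain `U`. -/
structure IsLocalKahler (U : Set E) (G : E → E →L[ℝ] E →L[ℝ] ℝ) (J : E → E →L[ℝ] E)
    (Γ : E → E →L[ℝ] E →L[ℝ] E) : Prop where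
  isOpen : IsOpen U
  metric_smooth : ContDiffOn ℝ ∞ G U
  complex_smooth : ContDiffOn ℝ ∞ J U
  connection_smooth : ContDiffOn ℝ ∞ Γ U
  pair : ∀ y ∈ U, IsHermitianPair (G y) (J y)
  torsion_free : ∀ y ∈ U, ∀ u v, Γ y u v = Γ y v u
  metric_parallel : ∀ y ∈ U, ∀ w u v,
    fderiv ℝ G y w u v = G y (Γ y w u) v + G y u (Γ y w v)
  complex_parallel : ∀ y ∈ U, ∀ w u, fderiv ℝ J y w u = J y (Γ y w u) - Γ y w (J y u)

/-- The h-projective equation in coordinates, for the endomorphism `a` and the vector field `lam`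
corresponding to a symmetric form and a `1`-form. -/
structure IsLocalSolution (U : Set E) (G : E → E →L[ℝ] E →L[ℝ] ℝ) (J : E → E →L[ℝ] E)
    (Γ : E → E →L[ℝ] E →L[ℝ] E) (a : E → E →L[ℝ] E) (lam : E → E) : Prop where
  left_smooth : ContDiffOn ℝ ∞ a U
  right_smooth : ContDiffOn ℝ ∞ lam U
  hermitian : ∀ y ∈ U, IsHermitianOp (G y) (J y) (a y)
  equation : ∀ y ∈ U, ∀ w u, fderiv ℝ a y w u =
    a y (Γ y w u) - Γ y w (a y u) + hsym (G y) (J y) w (lam y) u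

/-- The curvature of the connection with Christoffel symbols `Γ`. -/
def curvature (Γ : E → E →L[ℝ] E →L[ℝ] E) (y : E) : E →L[ℝ] E →L[ℝ] E →L[ℝ] E :=
  fderiv ℝ Γ y - (fderiv ℝ Γ y).flip
    + ((ContinuousLinearMap.mul ℝ (E →L[ℝ] E)).bilinearComp (Γ y) (Γ y)
      - ((ContinuousLinearMap.mul ℝ (E →L[ℝ] E)).bilinearComp (Γ y) (Γ y)).flip)

theorem curvature_apply (Γ : E → E →L[ℝ] E →L[ℝ] E) (y X Y Z : E) :
    curvature Γ y X Y Z = fderiv ℝ Γ y X Y Z - fderiv ℝ Γ y Y X Z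
      + (Γ y X (Γ y Y Z) - Γ y Y (Γ y X Z)) := by
  rfl

/-- The covariant derivative of the vector field `lam`. -/
def covDerivVector (Γ : E → E →L[ℝ] E →L[ℝ] E) (lam : E → E) (y : E) : E →L[ℝ] E :=
  fderiv ℝ lam y + (Γ y).flip (lam y)

theorem covDerivVector_apply (Γ : E → E →L[ℝ] E →L[ℝ] E) (lam : E → E) (y w : E) :
    covDerivVector Γ lam y w = fderiv ℝ lam y w + Γ y w (lam y) := by
  simp [covDerivVector]

variable {U : Set E} {G : E → E →L[ℝ] E →L[ℝ] ℝ} {J : E → E →L[ℝ] E}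
  {Γ : E → E →L[ℝ] E →L[ℝ] E} {a : E → E →L[ℝ] E} {lam : E → E} {y : E}

theorem ContDiffOn.differentiableAt_of_isOpen {F : Type*} [NormedAddCommGroup F] [NormedSpace ℝ F]
    {f : E → F} (hf : ContDiffOn ℝ ∞ f U) (hU : IsOpen U) (hy : y ∈ U) :
    DifferentiableAt ℝ f y :=
  (hf.contDiffAt (hU.mem_nhds hy)).differentiableAt (by simp)

namespace IsLocalKahler

/-- Cross-differentiating `∇ g = 0` gives skewness and cross-differentiating `∇ J = 0` gives
commutation with `J`; the Bianchi identity comes from the symmetry of `Γ`. -/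
theorem isKahlerCurvature (K : IsLocalKahler U G J Γ) (hy : y ∈ U) :
    IsKahlerCurvature (G y) (J y) (curvature Γ y) := by
  have hG := ContDiffOn.differentiableAt_of_isOpen K.metric_smooth K.isOpen hy
  have hJ := ContDiffOn.differentiableAt_of_isOpen K.complex_smooth K.isOpen hy
  have hΓ := ContDiffOn.differentiableAt_of_isOpen K.connection_smooth K.isOpen hy
  have hU := K.isOpen.mem_nhds hy
  refine ⟨fun X Y Z ↦ ?_, fun X Y Z W ↦ ?_, fun X Y Z ↦ ?_, fun X Y Z ↦ ?_⟩
  · simp only [curvature_apply]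
    abel
  · have h1 := fderiv_fderiv_comm (f := fun z ↦ G z Z W) (y := y)
      (Φ := fun z w ↦ G z (Γ z w Z) W + G z Z (Γ z w W))
      (((K.metric_smooth.contDiffAt hU).clm_apply contDiffAt_const).clm_apply contDiffAt_const)
      (by
        filter_upwards [hU] with z hz w
        have hG := ContDiffOn.differentiableAt_of_isOpen K.metric_smooth K.isOpen hz
        rw [fderiv_apply_apply (by fun_prop) (by fun_prop), fderiv_apply_apply (by fun_prop)
          (by fun_prop), ← K.metric_parallel z hz]
        simp) X Y
    have h2 (w v : E) : fderiv ℝ (fun z ↦ G z (Γ z w Z) W + G z Z (Γ z w W)) y v =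
        fderiv ℝ G y v (Γ y w Z) W + G y (fderiv ℝ Γ y v w Z) W + (fderiv ℝ G y v Z (Γ y w W)
          + G y Z (fderiv ℝ Γ y v w W)) := by
      simp (disch :=
          repeat' first
            | assumption | exact differentiableAt_const _
            | apply DifferentiableAt.clm_apply | apply DifferentiableAt.fun_add
            | apply DifferentiableAt.fun_sub | apply DifferentiableAt.fun_smul) only [add_apply,
          fderiv_fun_add, fderiv_apply_apply, fderiv_const_apply', map_zero,
        zero_apply, add_zero]
    rw [h2, h2] at h1
    simp only [K.metric_parallel y hy] at h1
    simp only [curvature_apply, map_add, map_sub, add_apply, sub_apply]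
    linarith
  · have h1 := fderiv_fderiv_comm (f := fun z ↦ J z Z) (y := y)
      (Φ := fun z w ↦ J z (Γ z w Z) - Γ z w (J z Z))
      ((K.complex_smooth.contDiffAt hU).clm_apply contDiffAt_const)
      (by
        filter_upwards [hU] with z hz w
        have hJ := ContDiffOn.differentiableAt_of_isOpen K.complex_smooth K.isOpen hz
        rw [fderiv_apply_apply (by fun_prop) (by fun_prop), ← K.complex_parallel z hz]
        simp) X Y
    have h2 (w v : E) : fderiv ℝ (fun z ↦ J z (Γ z w Z) - Γ z w (J z Z)) y v =
        fderiv ℝ J y v (Γ y w Z) + J y (fderiv ℝ Γ y v w Z) - (fderiv ℝ Γ y v w (J y Z)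
          + Γ y w (fderiv ℝ J y v Z)) := by
      simp (disch :=
          repeat' first
            | assumption | exact differentiableAt_const _
            | apply DifferentiableAt.clm_apply | apply DifferentiableAt.fun_add
            | apply DifferentiableAt.fun_sub | apply DifferentiableAt.fun_smul) only [add_apply,
          sub_apply, fderiv_fun_sub, fderiv_apply_apply, fderiv_const_apply',
        map_zero, zero_apply, add_zero]
    rw [h2, h2] at h1
    simp only [K.complex_parallel y hy, map_sub] at h1
    simp only [curvature_apply, map_add, map_sub]
    rw [← sub_eq_zero] at h1 ⊢
    rw [← neg_eq_zero, ← h1]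
    abel
  · have h1 (X Y Z : E) : fderiv ℝ Γ y X Y Z = fderiv ℝ Γ y X Z Y := by
      have h2 : (fun z ↦ Γ z Y Z) =ᶠ[𝓝 y] fun z ↦ Γ z Z Y := by
        filter_upwards [hU] with z hz
        exact K.torsion_free z hz Y Z
      have h3 := congrArg (fun T : E →L[ℝ] E ↦ T X) h2.fderiv_eq
      simpa (disch :=
          repeat' first
            | assumption | exact differentiableAt_const _
            | apply DifferentiableAt.clm_apply | apply DifferentiableAt.fun_add
            | apply DifferentiableAt.fun_sub | apply DifferentiableAt.fun_smul) only [add_apply,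
          sub_apply, fderiv_fun_sub, fderiv_apply_apply, fderiv_const_apply',
        map_zero, zero_apply, add_zero] using h3
    simp only [curvature_apply]
    rw [h1 X Y Z, h1 Y X Z, h1 Z Y X, K.torsion_free y hy X Z, K.torsion_free y hy Y Z,
      K.torsion_free y hy Y X]
    abel

end IsLocalKahler

namespace IsLocalSolution

/-- The compatibility condition of the first-order system for `a`: derivatives of `g`, `J` and `a`
are replaced by their equations and `d lam` by `∇ lam - Γ lam`, so that only curvature and `∇ lam`
survive. -/
theorem integrability (K : IsLocalKahler U G J Γ) (S : IsLocalSolution U G J Γ a lam)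
    (hy : y ∈ U) :
    Integrability (G y) (J y) (curvature Γ y) (a y) (covDerivVector Γ lam y) := by
  have hG := ContDiffOn.differentiableAt_of_isOpen K.metric_smooth K.isOpen hy
  have hJ := ContDiffOn.differentiableAt_of_isOpen K.complex_smooth K.isOpen hy
  have hΓ := ContDiffOn.differentiableAt_of_isOpen K.connection_smooth K.isOpen hy
  have ha := ContDiffOn.differentiableAt_of_isOpen S.left_smooth K.isOpen hy
  have hl := ContDiffOn.differentiableAt_of_isOpen S.right_smooth K.isOpen hy
  have hU := K.isOpen.mem_nhds hy
  intro X Y Z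
  have h1 := fderiv_fderiv_comm (f := fun z ↦ a z Z) (y := y)
      (Φ := fun z w ↦ a z (Γ z w Z) - Γ z w (a z Z) + (G z w Z • lam z + G z (lam z) Z • w
        + G z (J z w) Z • J z (lam z) + G z (J z (lam z)) Z • J z w))
      ((S.left_smooth.contDiffAt hU).clm_apply contDiffAt_const)
      (by
        filter_upwards [hU] with z hz w
        have ha := ContDiffOn.differentiableAt_of_isOpen S.left_smooth K.isOpen hz
        rw [fderiv_apply_apply (by fun_prop) (by fun_prop), S.equation z hz, hsym_apply]
        simp) X Y
  have h2 (w v : E) : fderiv ℝ (fun z ↦ a z (Γ z w Z) - Γ z w (a z Z) + (G z w Z • lam z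
        + G z (lam z) Z • w
        + G z (J z w) Z • J z (lam z) + G z (J z (lam z)) Z • J z w)) y v =
        fderiv ℝ a y v (Γ y w Z) + a y (fderiv ℝ Γ y v w Z) - (fderiv ℝ Γ y v w (a y Z)
          + Γ y w (fderiv ℝ a y v Z))
        + (fderiv ℝ G y v w Z • lam y + G y w Z • fderiv ℝ lam y v
          + (fderiv ℝ G y v (lam y) Z + G y (fderiv ℝ lam y v) Z) • w
          + ((fderiv ℝ G y v (J y w) Z + G y (fderiv ℝ J y v w) Z) • J y (lam y)
            + G y (J y w) Z • (fderiv ℝ J y v (lam y) + J y (fderiv ℝ lam y v)))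
          + ((fderiv ℝ G y v (J y (lam y)) Z + G y (fderiv ℝ J y v (lam y)
            + J y (fderiv ℝ lam y v)) Z) • J y w
            + G y (J y (lam y)) Z • fderiv ℝ J y v w)) := by
      simp (disch :=
          repeat' first
            | assumption | exact differentiableAt_const _
            | apply DifferentiableAt.clm_apply | apply DifferentiableAt.fun_add
            | apply DifferentiableAt.fun_sub | apply DifferentiableAt.fun_smul) only [add_apply,
          sub_apply, fderiv_fun_sub, fderiv_apply_apply, fderiv_const_apply',
        map_zero, zero_apply, add_zero, fderiv_fun_add, fderiv_fun_sub, fderiv_smul_apply,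
            smul_zero]
  have h3 (v : E) : fderiv ℝ lam y v = covDerivVector Γ lam y v - Γ y v (lam y) := by
    rw [covDerivVector_apply]
    abel
  rw [h2, h2] at h1
  simp only [K.complex_parallel y hy, K.metric_parallel y hy, S.equation y hy, h3, hsym_apply,
    map_sub, map_add, sub_apply, add_apply, map_smul] at h1
  rw [K.torsion_free y hy Y X] at h1
  simp only [curvature_apply, map_add, map_sub, hsym_apply]
  rw [← sub_eq_zero] at h1 ⊢
  rw [← neg_eq_zero, ← h1]
  module

theorem covDerivVector_smooth (K : IsLocalKahler U G J Γ) (S : IsLocalSolution U G J Γ a lam) :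
    ContDiffOn ℝ ∞ (covDerivVector Γ lam) U := by
  have h1 : ContDiffOn ℝ ∞ (fderiv ℝ lam) U :=
    S.right_smooth.fderiv_of_isOpen K.isOpen (by simp)
  have h2 : ContDiffOn ℝ ∞ (fun y ↦ (ContinuousLinearMap.flipₗᵢ ℝ E E E) (Γ y) (lam y)) U :=
    ((ContinuousLinearMap.flipₗᵢ ℝ E E E).contDiff.comp_contDiffOn
      K.connection_smooth).clm_apply S.right_smooth
  exact h1.add h2

theorem curvature_apply_right (K : IsLocalKahler U G J Γ) (S : IsLocalSolution U G J Γ a lam)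
    (hy : y ∈ U) (X Y : E) :
    curvature Γ y X Y (lam y) =
      fderiv ℝ (covDerivVector Γ lam) y X Y - fderiv ℝ (covDerivVector Γ lam) y Y X
      + (Γ y X (covDerivVector Γ lam y Y) - Γ y Y (covDerivVector Γ lam y X)) := by
  have hΓ := ContDiffOn.differentiableAt_of_isOpen K.connection_smooth K.isOpen hy
  have hl := ContDiffOn.differentiableAt_of_isOpen S.right_smooth K.isOpen hy
  have hL := ContDiffOn.differentiableAt_of_isOpen (S.covDerivVector_smooth K) K.isOpen hy
  have hU := K.isOpen.mem_nhds hy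
  have h3 (z v : E) : fderiv ℝ lam z v = covDerivVector Γ lam z v - Γ z v (lam z) := by
    rw [covDerivVector_apply]
    abel
  have h1 := fderiv_fderiv_comm (f := lam) (y := y)
      (Φ := fun z w ↦ covDerivVector Γ lam z w - Γ z w (lam z))
      (S.right_smooth.contDiffAt hU) (Eventually.of_forall fun z w ↦ h3 z w) X Y
  have h2 (w v : E) : fderiv ℝ (fun z ↦ covDerivVector Γ lam z w - Γ z w (lam z)) y v =
      fderiv ℝ (covDerivVector Γ lam) y v w - (fderiv ℝ Γ y v w (lam y)
        + Γ y w (fderiv ℝ lam y v)) := by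
    simp (disch :=
        repeat' first
          | assumption | exact differentiableAt_const _
          | apply DifferentiableAt.clm_apply) only [
      add_apply, sub_apply, fderiv_fun_sub, fderiv_apply_apply, fderiv_const_apply', map_zero,
      add_zero]
  rw [h2, h2, h3, h3] at h1
  rw [curvature_apply]
  simp only [map_sub] at h1
  rw [← sub_eq_zero] at h1 ⊢
  rw [← neg_eq_zero, ← h1]
  abel

end IsLocalSolution

end Local
end Kahler
end

/-! ### Unique continuation near a point. -/

noncomputable section

namespace Kahler

section Continuation

open Filter Topology Asymptotics

set_option synthInstance.maxHeartbeats 200000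

variable {E : Type*} [NormedAddCommGroup E] [NormedSpace ℝ E]

/-- A map whose derivative is dominated by the map itself vanishes near each of its zeros. -/
theorem eventually_eq_zero_of_fderiv_isBigO {F : Type*} [NormedAddCommGroup F] [NormedSpace ℝ F]
    {σ : E → F} {y : E} (hd : ∀ᶠ z in 𝓝 y, DifferentiableAt ℝ σ z)
    (hO : (fun z ↦ fderiv ℝ σ z) =O[𝓝 y] σ) (h0 : σ y = 0) : ∀ᶠ z in 𝓝 y, σ z = 0 := by
  obtain ⟨C, hC⟩ := hO.bound
  obtain ⟨r, hr, hball⟩ := Metric.eventually_nhds_iff_ball.mp (hd.and hC)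
  refine Metric.eventually_nhds_iff_ball.mpr ⟨r, hr, fun z hz ↦ ?_⟩
  -- Along the segment from `y` to `z` the bound becomes a Grönwall inequality with initial value
  -- zero.
  let γ : ℝ → E := fun t ↦ y + t • (z - y)
  have hγ (t : ℝ) (ht : t ∈ Set.Icc (0 : ℝ) 1) : γ t ∈ Metric.ball y r := by
    rw [mem_ball_iff_norm] at hz ⊢
    have : γ t - y = t • (z - y) := by simp [γ]
    rw [this, norm_smul, Real.norm_of_nonneg ht.1]
    exact (mul_le_of_le_one_left (norm_nonneg _) ht.2).trans_lt hz
  have hγd (t : ℝ) : HasDerivAt γ (z - y) t := by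
    have h1 := ((hasDerivAt_id t).smul_const (z - y)).const_add y
    rw [one_smul] at h1
    exact h1
  have hf (t : ℝ) (ht : t ∈ Set.Icc (0 : ℝ) 1) :
      HasDerivAt (σ ∘ γ) (fderiv ℝ σ (γ t) (z - y)) t :=
    (hball _ (hγ t ht)).1.hasFDerivAt.comp_hasDerivAt t (hγd t)
  have key := norm_le_gronwallBound_of_norm_deriv_right_le (f := σ ∘ γ)
    (f' := fun t ↦ fderiv ℝ σ (γ t) (z - y)) (δ := 0) (K := C * ‖z - y‖) (ε := 0) (a := 0) (b := 1)
    (fun t ht ↦ (hf t ht).continuousAt.continuousWithinAt)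
    (fun t ht ↦ (hf t (Set.Ico_subset_Icc_self ht)).hasDerivWithinAt)
    (by simp [γ, h0])
    (fun t ht ↦ by
      rw [add_zero]
      refine (ContinuousLinearMap.le_opNorm _ _).trans ?_
      have := (hball _ (hγ t (Set.Ico_subset_Icc_self ht))).2
      calc _ ≤ (C * ‖σ (γ t)‖) * ‖z - y‖ := by gcongr
        _ = _ := by simp only [Function.comp_apply]; ring)
    1 (by simp)
  rw [gronwallBound_ε0, zero_mul] at key
  simpa [γ] using key

omit [NormedSpace ℝ E] in
theorem isBigO_clm_apply {F F' H : Type*} [NormedAddCommGroup F] [NormedSpace ℝ F]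
    [NormedAddCommGroup F'] [NormedSpace ℝ F'] [NormedAddCommGroup H]
    {c : E → F →L[ℝ] F'} {u : E → F} {σ : E → H} {y : E}
    (hc : ContinuousAt c y) (hu : u =O[𝓝 y] σ) : (fun z ↦ c z (u z)) =O[𝓝 y] σ := by
  have h1 : c =O[𝓝 y] (fun _ ↦ (1 : ℝ)) := hc.isBigO_one ℝ
  have h2 : (fun z ↦ c z (u z)) =O[𝓝 y] fun z ↦ ‖c z‖ * ‖u z‖ :=
    IsBigO.of_bound 1 (Eventually.of_forall fun z ↦ by
      simpa using (c z).le_opNorm (u z))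
  refine h2.trans ?_
  simpa using h1.norm_left.mul hu.norm_norm

omit [NormedSpace ℝ E] in
theorem isBigO_clm_apply' {F F' H : Type*} [NormedAddCommGroup F] [NormedSpace ℝ F]
    [NormedAddCommGroup F'] [NormedSpace ℝ F'] [NormedAddCommGroup H]
    {c : E → F →L[ℝ] F'} {u : E → F} {σ : E → H} {y : E}
    (hc : c =O[𝓝 y] σ) (hu : ContinuousAt u y) : (fun z ↦ c z (u z)) =O[𝓝 y] σ := by
  have h1 : u =O[𝓝 y] (fun _ ↦ (1 : ℝ)) := hu.isBigO_one ℝ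
  have h2 : (fun z ↦ c z (u z)) =O[𝓝 y] fun z ↦ ‖c z‖ * ‖u z‖ :=
    IsBigO.of_bound 1 (Eventually.of_forall fun z ↦ by
      simpa using (c z).le_opNorm (u z))
  refine h2.trans ?_
  simpa using hc.norm_norm.mul h1.norm_left

omit [NormedSpace ℝ E] in
theorem isBigO_smul {F H : Type*} [NormedAddCommGroup F] [NormedSpace ℝ F]
    [NormedAddCommGroup H] {c : E → ℝ} {u : E → F} {σ : E → H} {y : E}
    (hc : ContinuousAt c y) (hu : u =O[𝓝 y] σ) : (fun z ↦ c z • u z) =O[𝓝 y] σ := by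
  simpa using (hc.isBigO_one ℝ).smul hu.norm_right

omit [NormedSpace ℝ E] in
theorem isBigO_smul' {F H : Type*} [NormedAddCommGroup F] [NormedSpace ℝ F]
    [NormedAddCommGroup H] {c : E → ℝ} {u : E → F} {σ : E → H} {y : E}
    (hc : c =O[𝓝 y] σ) (hu : ContinuousAt u y) : (fun z ↦ c z • u z) =O[𝓝 y] σ := by
  simpa using hc.norm_right.smul (hu.isBigO_one ℝ)

variable [FiniteDimensional ℝ E]

omit [FiniteDimensional ℝ E] in
theorem isBigO_of_basis {F H ι : Type*} [Fintype ι] [NormedAddCommGroup F] [NormedSpace ℝ F]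
    [NormedAddCommGroup H] (b : Module.Basis ι ℝ E)
    {c : E → E →L[ℝ] F} {σ : E → H} {y : E} (h : ∀ i, (fun z ↦ c z (b i)) =O[𝓝 y] σ) :
    c =O[𝓝 y] σ := by
  obtain ⟨C, hC, hb⟩ := b.exists_opNorm_le (F := F)
  have h1 : (fun z ↦ ∑ i, ‖c z (b i)‖) =O[𝓝 y] σ := by
    have h2 := IsBigO.sum (s := Finset.univ) fun i _ ↦ (h i).norm_left
    refine h2.congr_left fun z ↦ ?_
    simp
  refine IsBigO.trans (IsBigO.of_bound C (Eventually.of_forall fun z ↦ ?_)) h1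
  rw [Real.norm_of_nonneg (Finset.sum_nonneg fun _ _ ↦ norm_nonneg _)]
  exact hb (Finset.sum_nonneg fun _ _ ↦ norm_nonneg _) fun i ↦
    Finset.single_le_sum (f := fun i ↦ ‖c z (b i)‖) (fun _ _ ↦ norm_nonneg _) (Finset.mem_univ i)

/-- The musical isomorphism as a continuous linear equivalence. -/
def IsHermitianPair.toDualL {g : E →L[ℝ] E →L[ℝ] ℝ} {J : E →L[ℝ] E} (h : IsHermitianPair g J) :
    E ≃L[ℝ] (E →L[ℝ] ℝ) :=
  (h.toDual.trans LinearMap.toContinuousLinearMap).toContinuousLinearEquiv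

theorem IsHermitianPair.coe_toDualL {g : E →L[ℝ] E →L[ℝ] ℝ} {J : E →L[ℝ] E}
    (h : IsHermitianPair g J) : (h.toDualL : E →L[ℝ] E →L[ℝ] ℝ) = g := by
  ext u v
  rfl

variable {U : Set E} {G : E → E →L[ℝ] E →L[ℝ] ℝ} {J : E → E →L[ℝ] E}
  {Γ : E → E →L[ℝ] E →L[ℝ] E} {a : E → E →L[ℝ] E} {lam : E → E} {y : E}

theorem IsHermitianPair.inverse_apply_apply {g : E →L[ℝ] E →L[ℝ] ℝ} {J : E →L[ℝ] E}
    (h : IsHermitianPair g J) (f : E →L[ℝ] ℝ) (v : E) : g (g.inverse f) v = f v := by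
  have : g.inverse = h.toDualL.symm := by
    have h1 := ContinuousLinearMap.inverse_equiv h.toDualL
    rwa [h.coe_toDualL] at h1
  rw [this]
  exact congrArg (fun T : E →L[ℝ] ℝ ↦ T v) (h.toDualL.apply_symm_apply f)

theorem contDiffOn_inverse {n : WithTop ℕ∞} (hG : ContDiffOn ℝ n G U)
    (hp : ∀ y ∈ U, IsHermitianPair (G y) (J y)) :
    ContDiffOn ℝ n (fun y ↦ (G y).inverse) U := by
  intro y hy
  have h1 := contDiffAt_map_inverse (n := n) (hp y hy).toDualL
  rw [(hp y hy).coe_toDualL] at h1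
  exact h1.comp_contDiffWithinAt y (hG y hy)

omit [FiniteDimensional ℝ E] in
theorem eventually_differentiableAt {F : Type*} [NormedAddCommGroup F] [NormedSpace ℝ F]
    {f : E → F} (hf : ContDiffOn ℝ ∞ f U) (hU : IsOpen U) (hy : y ∈ U) :
    ∀ᶠ z in 𝓝 y, DifferentiableAt ℝ f z := by
  filter_upwards [hU.mem_nhds hy] with z hz
  exact ContDiffOn.differentiableAt_of_isOpen hf hU hz

omit [FiniteDimensional ℝ E] in
theorem continuousAt_of_contDiffOn {F : Type*} [NormedAddCommGroup F] [NormedSpace ℝ F]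
    {f : E → F} (hf : ContDiffOn ℝ ∞ f U) (hU : IsOpen U) (hy : y ∈ U) : ContinuousAt f y :=
  (ContDiffOn.differentiableAt_of_isOpen hf hU hy).continuousAt

omit [FiniteDimensional ℝ E] in
theorem contDiffOn_fderiv_apply {F : Type*} [NormedAddCommGroup F] [NormedSpace ℝ F] {c : E → F}
    (hc : ContDiffOn ℝ ∞ c U) (hU : IsOpen U) (v : E) :
    ContDiffOn ℝ ∞ (fun y ↦ fderiv ℝ c y v) U :=
  (hc.fderiv_of_isOpen hU (by simp)).clm_apply contDiffOn_const

omit [FiniteDimensional ℝ E] in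
theorem contDiffOn_clm_apply_const {F F' : Type*} [NormedAddCommGroup F] [NormedSpace ℝ F]
    [NormedAddCommGroup F'] [NormedSpace ℝ F'] {c : E → F →L[ℝ] F'} {n : WithTop ℕ∞}
    (hc : ContDiffOn ℝ n c U) (v : F) : ContDiffOn ℝ n (fun y ↦ c y v) U :=
  hc.clm_apply contDiffOn_const

omit [FiniteDimensional ℝ E] in
theorem IsLocalKahler.curvature_smooth (K : IsLocalKahler U G J Γ) (X Y Z : E) :
    ContDiffOn ℝ ∞ (fun y ↦ curvature Γ y X Y Z) U := by
  have h0 := K.connection_smooth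
  have h2 (X Y Z : E) : ContDiffOn ℝ ∞ (fun y ↦ fderiv ℝ Γ y X Y Z) U :=
    contDiffOn_clm_apply_const (contDiffOn_clm_apply_const
      (contDiffOn_fderiv_apply h0 K.isOpen X) Y) Z
  have h3 (X Y Z : E) : ContDiffOn ℝ ∞ (fun y ↦ Γ y X (Γ y Y Z)) U :=
    (contDiffOn_clm_apply_const h0 X).clm_apply
      (contDiffOn_clm_apply_const (contDiffOn_clm_apply_const h0 Y) Z)
  simp only [curvature_apply]
  exact ((h2 X Y Z).sub (h2 Y X Z)).add ((h3 X Y Z).sub (h3 Y X Z))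

/-- The linear operator giving the tracefree part of `∇_X lam` in terms of `a`. -/
def tracefreeOperator (G : E → E →L[ℝ] E →L[ℝ] ℝ) (Γ : E → E →L[ℝ] E →L[ℝ] E) (X y : E) :
    (E →L[ℝ] E) →L[ℝ] E :=
  LinearMap.toContinuousLinearMap
    { toFun := fun a ↦ (G y).inverse (LinearMap.toContinuousLinearMap
        { toFun := fun W ↦ tr E (commutatorMap (curvature Γ y) a X W)
          map_add' := fun W W' ↦ by
            rw [← map_add]
            congr 1
            ext Y
            simp only [commutatorMap_apply, map_add, add_apply]
            abel
          map_smul' := fun r W ↦ by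
            rw [RingHom.id_apply, ← map_smul]
            congr 1
            ext Y
            simp only [commutatorMap_apply, map_smul, smul_apply, smul_sub] })
      map_add' := fun a a' ↦ by
        rw [← map_add, ← map_add]
        congr 2
        ext W
        change tr E _ = tr E _ + tr E _
        rw [← map_add]
        congr 1
        ext Y
        simp only [commutatorMap_apply, map_add, add_apply]
        abel
      map_smul' := fun r a ↦ by
        rw [RingHom.id_apply, ← map_smul, ← map_smul]
        congr 2
        ext W
        change tr E _ = r • tr E _
        rw [← map_smul]
        congr 1
        ext Y
        simp only [commutatorMap_apply, map_smul, smul_apply, smul_sub] }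

theorem IsLocalKahler.tracefreeOperator_apply (K : IsLocalKahler U G J Γ) (hy : y ∈ U)
    (X W : E) (a : E →L[ℝ] E) :
    G y (tracefreeOperator G Γ X y a) W = tr E (commutatorMap (curvature Γ y) a X W) :=
  (K.pair y hy).inverse_apply_apply _ _

theorem IsLocalKahler.tracefreeOperator_smooth (K : IsLocalKahler U G J Γ) (X : E) :
    ContDiffOn ℝ ∞ (tracefreeOperator G Γ X) U := by
  rw [contDiffOn_clm_apply]
  intro a
  refine (contDiffOn_inverse K.metric_smooth K.pair).clm_apply ?_
  rw [contDiffOn_clm_apply]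
  intro W
  change ContDiffOn ℝ ∞ (fun y ↦ tr E (commutatorMap (curvature Γ y) a X W)) U
  refine (tr E).contDiff.comp_contDiffOn ?_
  rw [contDiffOn_clm_apply]
  intro Y
  simp only [commutatorMap_apply]
  exact (K.curvature_smooth X Y (a W)).sub
    (a.contDiff.comp_contDiffOn (K.curvature_smooth X Y W))

namespace IsLocalSolution

theorem isHermitianOp_covDerivVector (K : IsLocalKahler U G J Γ)
    (S : IsLocalSolution U G J Γ a lam) (hE : 2 < Module.finrank ℝ E) (hy : y ∈ U) :
    IsHermitianOp (G y) (J y) (covDerivVector Γ lam y) :=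
  (S.integrability K hy).isHermitianOp (K.pair y hy) (K.isKahlerCurvature hy) (S.hermitian y hy) hE

/-- By the trace formula `∇ lam` depends only on its trace and, through a linear operator with
smooth coefficients, on `a`. This is what closes the first-order system for `(a, lam, tr ∇ lam)`. -/
theorem covDerivVector_eq (K : IsLocalKahler U G J Γ)
    (S : IsLocalSolution U G J Γ a lam) (hE : 2 < Module.finrank ℝ E) (hy : y ∈ U) (X : E) :
    covDerivVector Γ lam y X = (tr E (covDerivVector Γ lam y) / Module.finrank ℝ E) • X
      + (Module.finrank ℝ E : ℝ)⁻¹ • tracefreeOperator G Γ X y (a y) := by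
  have hd : (Module.finrank ℝ E : ℝ) ≠ 0 := by
    have : (2 : ℝ) < Module.finrank ℝ E := by exact_mod_cast hE
    linarith
  refine (K.pair y hy).ext_left fun W ↦ ?_
  have h1 := (S.integrability K hy).trace_formula (K.pair y hy) (K.isKahlerCurvature hy)
    (S.hermitian y hy) hE X W
  simp only [map_add, map_smul, add_apply, smul_apply, smul_eq_mul, K.tracefreeOperator_apply hy]
  field_simp
  linarith

theorem tr_covDerivVector_smooth (K : IsLocalKahler U G J Γ) (S : IsLocalSolution U G J Γ a lam) :
    ContDiffOn ℝ ∞ (fun y ↦ tr E (covDerivVector Γ lam y)) U :=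
  (tr E).contDiff.comp_contDiffOn (S.covDerivVector_smooth K)

/-- A solution whose coefficients `a`, `lam` and `tr ∇ lam` vanish at a point vanishes nearby. -/
theorem eventually_eq_zero (K : IsLocalKahler U G J Γ)
    (S : IsLocalSolution U G J Γ a lam) (hE : 2 < Module.finrank ℝ E) (hy : y ∈ U)
    (ha0 : a y = 0) (hl0 : lam y = 0) (ht0 : tr E (covDerivVector Γ lam y) = 0) :
    ∀ᶠ z in 𝓝 y, a z = 0 := by
  have hU := K.isOpen.mem_nhds hy
  set d : ℝ := ((Module.finrank ℝ E : ℕ) : ℝ)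
  let ν : E → ℝ := fun z ↦ tr E (covDerivVector Γ lam z) / d
  have hνs : ContDiffOn ℝ ∞ ν U := (S.tr_covDerivVector_smooth K).div_const _
  -- The aim is `dσ = O(σ)`: `da` is controlled by the equation, `d lam` by the formula for `∇ lam`,
  -- and `dν` by the Ricci identity.
  let σ : E → (E →L[ℝ] E) × E × ℝ := fun z ↦ (a z, lam z, ν z)
  have oa : a =O[𝓝 y] σ := isBigO_fst_prod
  have ol : lam =O[𝓝 y] σ := isBigO_fst_prod.trans isBigO_snd_prod
  have oν : ν =O[𝓝 y] σ := isBigO_snd_prod.trans isBigO_snd_prod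
  have cG := continuousAt_of_contDiffOn K.metric_smooth K.isOpen hy
  have cJ := continuousAt_of_contDiffOn K.complex_smooth K.isOpen hy
  have cΓ := continuousAt_of_contDiffOn K.connection_smooth K.isOpen hy
  have ca := continuousAt_of_contDiffOn S.left_smooth K.isOpen hy
  have cl := continuousAt_of_contDiffOn S.right_smooth K.isOpen hy
  have cν := continuousAt_of_contDiffOn hνs K.isOpen hy
  have oda (w : E) : (fun z ↦ fderiv ℝ a z w) =O[𝓝 y] σ := by
    refine isBigO_of_basis (Module.finBasis ℝ E) fun i ↦ ?_
    generalize Module.finBasis ℝ E i = u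
    have h1 : (fun z ↦ fderiv ℝ a z w u) =ᶠ[𝓝 y] fun z ↦ a z (Γ z w u) - Γ z w (a z u)
        + (G z w u • lam z + G z (lam z) u • w + G z (J z w) u • J z (lam z)
          + G z (J z (lam z)) u • J z w) := by
      filter_upwards [hU] with z hz
      rw [S.equation z hz, hsym_apply]
    refine h1.trans_isBigO ?_
    have oJl := isBigO_clm_apply cJ ol
    exact ((isBigO_clm_apply' oa
        ((cΓ.clm_apply continuousAt_const).clm_apply continuousAt_const)).sub
      (isBigO_clm_apply (cΓ.clm_apply continuousAt_const)
          (isBigO_clm_apply' oa continuousAt_const))).add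
      ((((isBigO_smul ((cG.clm_apply continuousAt_const).clm_apply continuousAt_const) ol).add
      (isBigO_smul' (isBigO_clm_apply'
          (isBigO_clm_apply cG ol) continuousAt_const) continuousAt_const)).add
      (isBigO_smul ((cG.clm_apply
          (cJ.clm_apply continuousAt_const)).clm_apply continuousAt_const) oJl)).add
      (isBigO_smul' (isBigO_clm_apply' (isBigO_clm_apply cG oJl) continuousAt_const)
          (cJ.clm_apply continuousAt_const)))
  have hL (X : E) : ∀ᶠ z in 𝓝 y, covDerivVector Γ lam z X =
      ν z • X + d⁻¹ • tracefreeOperator G Γ X z (a z) := by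
    filter_upwards [hU] with z hz
    exact S.covDerivVector_eq K hE hz X
  have cΨ (X : E) := continuousAt_of_contDiffOn (K.tracefreeOperator_smooth X) K.isOpen hy
  have oL (X : E) : (fun z ↦ covDerivVector Γ lam z X) =O[𝓝 y] σ := by
    refine EventuallyEq.trans_isBigO (hL X) ?_
    exact (isBigO_smul' oν continuousAt_const).add ((isBigO_clm_apply (cΨ X) oa).const_smul_left _)
  have odl (w : E) : (fun z ↦ fderiv ℝ lam z w) =O[𝓝 y] σ := by
    have h1 (z : E) : fderiv ℝ lam z w = covDerivVector Γ lam z w - Γ z w (lam z) := by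
      rw [covDerivVector_apply]
      abel
    simp only [h1]
    exact (oL w).sub (isBigO_clm_apply (cΓ.clm_apply continuousAt_const) ol)
  have odL (X Y : E) : ∀ᶠ z in 𝓝 y, fderiv ℝ (covDerivVector Γ lam) z X Y =
      fderiv ℝ ν z X • Y + d⁻¹ • (fderiv ℝ (tracefreeOperator G Γ Y) z X (a z)
        + tracefreeOperator G Γ Y z (fderiv ℝ a z X)) := by
    filter_upwards [(hL Y).eventually_nhds, eventually_differentiableAt
        (S.covDerivVector_smooth K) K.isOpen hy,
        eventually_differentiableAt S.left_smooth K.isOpen hy,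
      eventually_differentiableAt (K.tracefreeOperator_smooth Y) K.isOpen hy,
          eventually_differentiableAt hνs K.isOpen hy] with z hz d1 d2 d3 d4
    have h1 : fderiv ℝ (fun z ↦ covDerivVector Γ lam z Y) z X
        = fderiv ℝ (covDerivVector Γ lam) z X Y := by
      rw [fderiv_apply_apply d1 (differentiableAt_const _)]
      simp
    have h2 := EventuallyEq.fderiv_eq (𝕜 := ℝ) hz
    rw [← h1, h2, fderiv_fun_add (d4.fun_smul (differentiableAt_const _))
      ((d3.clm_apply d2).fun_const_smul _), add_apply,
      fderiv_smul_apply d4 (differentiableAt_const _), fderiv_fun_const_smul (d3.clm_apply d2)]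
    simp [fderiv_apply_apply d3 d2]
  -- The Ricci identity for `lam` bounds only `dν ∧ 1`. Since the dimension exceeds one, the
  -- coordinate of another basis vector will extract `dν` itself.
  have key (X Y : E) : (fun z ↦ fderiv ℝ ν z X • Y - fderiv ℝ ν z Y • X) =O[𝓝 y] σ := by
    have h1 : (fun z ↦ fderiv ℝ ν z X • Y - fderiv ℝ ν z Y • X) =ᶠ[𝓝 y] fun z ↦
        curvature Γ z X Y (lam z) - (Γ z X (covDerivVector Γ lam z Y)
          - Γ z Y (covDerivVector Γ lam z X))
        - d⁻¹ • (fderiv ℝ (tracefreeOperator G Γ Y) z X (a z)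
          + tracefreeOperator G Γ Y z (fderiv ℝ a z X))
        + d⁻¹ • (fderiv ℝ (tracefreeOperator G Γ X) z Y (a z)
          + tracefreeOperator G Γ X z (fderiv ℝ a z Y)) := by
      filter_upwards [hU, odL X Y, odL Y X] with z hz h2 h3
      rw [S.curvature_apply_right K hz, h2, h3]
      abel
    refine h1.trans_isBigO ?_
    have cR : ContinuousAt (fun z ↦ curvature Γ z X Y) y := by
      refine continuousAt_of_contDiffOn
          (contDiffOn_clm_apply.mpr fun Z ↦ K.curvature_smooth X Y Z) K.isOpen hy
    have cdΨ (X Y : E) : ContinuousAt (fun z ↦ fderiv ℝ (tracefreeOperator G Γ X) z Y) y :=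
      continuousAt_of_contDiffOn (contDiffOn_fderiv_apply
          (K.tracefreeOperator_smooth X) K.isOpen Y) K.isOpen hy
    have o1 (X Y : E) := ((isBigO_clm_apply (cdΨ X Y) oa).add
      (isBigO_clm_apply (cΨ X) (oda Y))).const_smul_left d⁻¹
    exact (((isBigO_clm_apply cR ol).sub
      ((isBigO_clm_apply (cΓ.clm_apply continuousAt_const) (oL Y)).sub
      (isBigO_clm_apply (cΓ.clm_apply continuousAt_const) (oL X)))).sub (o1 Y X)).add (o1 X Y)
  have odν : (fun z ↦ fderiv ℝ ν z) =O[𝓝 y] σ := by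
    let b := Module.finBasis ℝ E
    refine isBigO_of_basis b fun i ↦ ?_
    obtain ⟨j, hj⟩ : ∃ j, j ≠ i := by
      have : Nontrivial (Fin (Module.finrank ℝ E)) := Fin.nontrivial_iff_two_le.mpr hE.le
      exact exists_ne i
    have h1 := isBigO_clm_apply
      (c := fun _ ↦ (LinearMap.toContinuousLinearMap (b.coord j) : E →L[ℝ] ℝ)) continuousAt_const
      (key (b i) (b j))
    refine h1.congr_left fun z ↦ ?_
    simp [hj]
  have oσ : (fun z ↦ fderiv ℝ σ z) =O[𝓝 y] σ := by
    refine isBigO_of_basis (Module.finBasis ℝ E) fun i ↦ ?_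
    generalize Module.finBasis ℝ E i = w
    have h1 : (fun z ↦ fderiv ℝ σ z w) =ᶠ[𝓝 y] fun z ↦
        (fderiv ℝ a z w, fderiv ℝ lam z w, fderiv ℝ ν z w) := by
      filter_upwards [eventually_differentiableAt S.left_smooth K.isOpen hy,
          eventually_differentiableAt S.right_smooth K.isOpen hy,
          eventually_differentiableAt hνs K.isOpen hy] with z d1 d2 d3
      rw [DifferentiableAt.fderiv_prodMk d1 (d2.prodMk d3), DifferentiableAt.fderiv_prodMk d2 d3]
      rfl
    refine h1.trans_isBigO ?_
    exact (oda w).prod_left ((odl w).prod_left (isBigO_clm_apply' odν continuousAt_const))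
  have hσ := eventually_eq_zero_of_fderiv_isBigO (σ := σ) (y := y) (by
    filter_upwards [eventually_differentiableAt S.left_smooth K.isOpen hy,
        eventually_differentiableAt S.right_smooth K.isOpen hy,
        eventually_differentiableAt hνs K.isOpen hy] with z d1 d2 d3
    exact d1.prodMk (d2.prodMk d3)) oσ (by simp [σ, ν, ha0, hl0, ht0])
  filter_upwards [hσ] with z hz
  exact congrArg Prod.fst hz

end IsLocalSolution

end Continuation
end Kahler
end

/-! ### The extended system in coordinates. -/

noncomputable section

namespace Kahler

section Factor

open Filter Topology

set_option synthInstance.maxHeartbeats 200000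

variable {E : Type*} [NormedAddCommGroup E] [NormedSpace ℝ E]
  {U : Set E} {G : E → E →L[ℝ] E →L[ℝ] ℝ} {J : E → E →L[ℝ] E}
  {Γ : E → E →L[ℝ] E →L[ℝ] E} {a A : E → E →L[ℝ] E} {lam Lam : E → E} {y : E}

theorem eventually_eq_of_fderiv_eq_zero {f : E → ℝ}
    (h : ∀ᶠ z in 𝓝 y, DifferentiableAt ℝ f z ∧ fderiv ℝ f z = 0) : ∀ᶠ z in 𝓝 y, f z = f y := by
  obtain ⟨r, hr, hb⟩ := Metric.eventually_nhds_iff_ball.mp h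
  refine Metric.eventually_nhds_iff_ball.mpr ⟨r, hr, fun z hz ↦ ?_⟩
  exact Metric.isOpen_ball.is_const_of_fderiv_eq_zero (convex_ball y r).isPreconnected
    (fun x hx ↦ (hb x hx).1.differentiableWithinAt) (fun x hx ↦ (hb x hx).2) hz
    (Metric.mem_ball_self hr)

theorem exists_smul_add_smul_of_not_linearIndependent {V : Type*} [AddCommGroup V] [Module ℝ V]
    {u v w : V} (h1 : LinearIndependent ℝ ![u, v]) (h2 : ¬LinearIndependent ℝ ![u, v, w]) :
    ∃ p q : ℝ, w = p • u + q • v := by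
  rw [Fintype.not_linearIndependent_iff] at h2
  obtain ⟨c, hc, i, hi⟩ := h2
  simp only [Fin.sum_univ_three, Matrix.cons_val] at hc
  have h3 : c 2 ≠ 0 := by
    intro h3
    rw [LinearIndependent.pair_iff] at h1
    obtain ⟨h4, h5⟩ := h1 (c 0) (c 1) (by simpa [h3] using hc)
    fin_cases i
    · exact hi h4
    · exact hi h5
    · exact hi h3
  refine ⟨-((c 2)⁻¹ * c 0), -((c 2)⁻¹ * c 1), ?_⟩
  have h4 : w = ((c 2)⁻¹ * c 2) • w := by rw [inv_mul_cancel₀ h3, one_smul]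
  rw [h4, ← sub_eq_zero]
  have h5 : (c 2)⁻¹ • (c 0 • u + c 1 • v + c 2 • w) = 0 := by rw [hc, smul_zero]
  rw [← h5]
  module

theorem exists_eq_smul_of_not_linearIndependent {V : Type*} [AddCommGroup V] [Module ℝ V]
    {u v : V} (h1 : u ≠ 0) (h2 : ¬LinearIndependent ℝ ![u, v]) : ∃ p : ℝ, v = p • u := by
  rw [LinearIndependent.pair_iff' h1] at h2
  push Not at h2
  obtain ⟨p, hp⟩ := h2
  exact ⟨p, hp.symm⟩

omit [NormedSpace ℝ E] in
theorem eventually_linearIndependent {ι V : Type*} [Finite ι] [NormedAddCommGroup V]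
    [NormedSpace ℝ V] {v : ι → E → V} (hv : ∀ i, ContinuousAt (v i) y)
    (h : LinearIndependent ℝ fun i ↦ v i y) :
    ∀ᶠ z in 𝓝 y, LinearIndependent ℝ fun i ↦ v i z := by
  have h1 : ContinuousAt (fun z i ↦ v i z) y := continuousAt_pi.mpr hv
  exact h1.eventually_mem (isOpen_setOfPred_linearIndependent.mem_nhds h)

omit [NormedSpace ℝ E] in
theorem eventually_linearIndependent_pair {V : Type*} [NormedAddCommGroup V] [NormedSpace ℝ V]
    {u v : E → V} (hu : ContinuousAt u y) (hv : ContinuousAt v y)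
    (h : LinearIndependent ℝ ![u y, v y]) : ∀ᶠ z in 𝓝 y, LinearIndependent ℝ ![u z, v z] := by
  have h1 (z : E) : (fun i ↦ ![u, v] i z) = ![u z, v z] := by
    ext i
    fin_cases i <;> rfl
  have h2 := eventually_linearIndependent (y := y) (v := ![u, v])
    (by intro i; fin_cases i; exacts [hu, hv]) (by rwa [h1])
  simpa only [h1] using h2

omit [NormedSpace ℝ E] in
theorem eventually_linearIndependent_triple {V : Type*} [NormedAddCommGroup V] [NormedSpace ℝ V]
    {u v w : E → V} (hu : ContinuousAt u y) (hv : ContinuousAt v y) (hw : ContinuousAt w y)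
    (h : LinearIndependent ℝ ![u y, v y, w y]) :
    ∀ᶠ z in 𝓝 y, LinearIndependent ℝ ![u z, v z, w z] := by
  have h1 (z : E) : (fun i ↦ ![u, v, w] i z) = ![u z, v z, w z] := by
    ext i
    fin_cases i <;> rfl
  have h2 := eventually_linearIndependent (y := y) (v := ![u, v, w])
    (by intro i; fin_cases i; exacts [hu, hv, hw]) (by rwa [h1])
  simpa only [h1] using h2

theorem linearIndependent_pair_of_triple {V : Type*} [AddCommGroup V] [Module ℝ V]
    {u v w : V} (h : LinearIndependent ℝ ![u, v, w]) : LinearIndependent ℝ ![u, v] := by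
  rw [LinearIndependent.pair_iff]
  intro s t hst
  rw [Fintype.linearIndependent_iff] at h
  have := h ![s, t, 0] (by simpa [Fin.sum_univ_three] using hst)
  exact ⟨this 0, this 1⟩

variable [FiniteDimensional ℝ E]

omit [FiniteDimensional ℝ E] in
theorem differentiableAt_div {V : Type*} [NormedAddCommGroup V] [NormedSpace ℝ V] {φ : V →L[ℝ] ℝ}
    {u v : E → V} (hu : DifferentiableAt ℝ u y) (hv : DifferentiableAt ℝ v y)
    (h : φ (u y) ≠ 0) : DifferentiableAt ℝ (fun z ↦ φ (v z) / φ (u z)) y := by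
  have h1 : DifferentiableAt ℝ (fun z ↦ φ (u z)) y := φ.differentiableAt.comp y hu
  have h2 : DifferentiableAt ℝ (fun z ↦ φ (v z)) y := φ.differentiableAt.comp y hv
  simp only [div_eq_mul_inv]
  exact h2.mul (h1.inv h)

omit [FiniteDimensional ℝ E] in
theorem exists_dual_pair {V : Type*} [NormedAddCommGroup V] [NormedSpace ℝ V]
    [FiniteDimensional ℝ V] {u v : V} (h : LinearIndependent ℝ ![u, v]) :
    ∃ φ : V →L[ℝ] ℝ, φ u = 0 ∧ φ v = 1 := by
  have h1 : v ∉ Submodule.span ℝ {u} := by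
    have := h.notMem_span_image (s := {0}) (x := 1) (by simp)
    simpa using this
  obtain ⟨f, hf, hf'⟩ := Submodule.exists_le_ker_of_notMem h1
  refine ⟨(f v)⁻¹ • LinearMap.toContinuousLinearMap f, ?_, ?_⟩
  · have : f u = 0 := hf' (Submodule.mem_span_singleton_self u)
    simp [this]
  · simp [hf]

/-- Differentiating `A = f + h a` shows that `hsym w (Lam - h lam)` lies in the span of `1` and `a`
for every `w`. By `eq_zero_of_hsym_mem_span` the vector `Lam - h lam` vanishes, and the derivatives
of the coefficients satisfy the stated relation. -/
theorem IsLocalSolution.eq_of_eq_smul_add_smul (K : IsLocalKahler U G J Γ)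
    (S : IsLocalSolution U G J Γ a lam) (S' : IsLocalSolution U G J Γ A Lam)
    (hE : 3 < Module.finrank ℝ E) (hy : y ∈ U) {f h : E → ℝ}
    (hf : DifferentiableAt ℝ f y) (hh : DifferentiableAt ℝ h y)
    (H : ∀ᶠ z in 𝓝 y, A z = f z • 1 + h z • a z) (w : E) :
    fderiv ℝ f y w • (1 : E →L[ℝ] E) + fderiv ℝ h y w • a y = 0 := by
  have ha := ContDiffOn.differentiableAt_of_isOpen S.left_smooth K.isOpen hy
  have h0 (w : E) : hsym (G y) (J y) w (Lam y - h y • lam y) =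
      fderiv ℝ f y w • (1 : E →L[ℝ] E) + fderiv ℝ h y w • a y := by
    have h1 : fderiv ℝ A y w =
        fderiv ℝ f y w • (1 : E →L[ℝ] E) + (fderiv ℝ h y w • a y + h y • fderiv ℝ a y w) := by
      rw [EventuallyEq.fderiv_eq (𝕜 := ℝ) H, fderiv_fun_add (hf.fun_smul
        (differentiableAt_const _)) (hh.fun_smul ha), add_apply,
        fderiv_smul_apply hh ha, fderiv_smul_apply hf (differentiableAt_const _)]
      simp
    ext u
    have h2 := congrArg (fun T : E →L[ℝ] E ↦ T u) h1
    simp only [S'.equation y hy, add_apply, smul_apply, S.equation y hy, H.self_of_nhds,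
      map_add, map_smul] at h2
    rw [sub_eq_add_neg, ← neg_smul, hsym_add_right, hsym_smul_right]
    simp only [add_apply, smul_apply]
    rw [← sub_eq_zero] at h2 ⊢
    rw [← h2]
    simp only [one_apply_eq_self]
    module
  have h3 := eq_zero_of_hsym_mem_span (K.pair y hy) hE fun w ↦ ⟨_, _, h0 w⟩
  have h4 := h0 w
  rw [h3] at h4
  rw [← h4]
  ext u
  simp [hsym_apply]

/-- Take `A = a`, `h = 0` and `f = tr a / d` in the preceding lemma: `f` has zero derivative. -/
theorem IsLocalSolution.eventually_eq_smul_one (K : IsLocalKahler U G J Γ)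
    (S : IsLocalSolution U G J Γ a lam) (hE : 3 < Module.finrank ℝ E) (hy : y ∈ U)
    (H : ∀ᶠ z in 𝓝 y, ¬LinearIndependent ℝ ![1, a z]) :
    ∃ r : ℝ, ∀ᶠ z in 𝓝 y, a z = r • 1 := by
  have : Nontrivial E := Module.nontrivial_of_finrank_pos (R := ℝ) (by omega)
  have h2 : ∀ᶠ z in 𝓝 y, a z = (tr E (a z) / Module.finrank ℝ E) • 1 + (0 : ℝ) • a z := by
    filter_upwards [H] with z hz
    obtain ⟨p, hp⟩ := exists_eq_smul_of_not_linearIndependent one_ne_zero hz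
    have hd : (Module.finrank ℝ E : ℝ) ≠ 0 := by
      have : 0 < Module.finrank ℝ E := by omega
      positivity
    rw [zero_smul, add_zero]
    conv_rhs => rw [hp, map_smul, tr_one, smul_eq_mul, mul_div_cancel_right₀ _ hd]
    exact hp
  have hda := eventually_differentiableAt S.left_smooth K.isOpen hy
  have hd : ∀ᶠ z in 𝓝 y, DifferentiableAt ℝ (fun z ↦ tr E (a z) / Module.finrank ℝ E) z := by
    filter_upwards [hda] with z hz
    have h3 : DifferentiableAt ℝ (fun z ↦ tr E (a z)) z := (tr E).differentiableAt.comp z hz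
    simp only [div_eq_mul_inv]
    exact h3.mul_const _
  have h3 : ∀ᶠ z in 𝓝 y, fderiv ℝ (fun z ↦ tr E (a z) / Module.finrank ℝ E) z = 0 := by
    filter_upwards [hd, h2.eventually_nhds, K.isOpen.mem_nhds hy] with z h4 h5 h6
    ext w
    have h7 := S.eq_of_eq_smul_add_smul K S hE h6 h4 (differentiableAt_const 0) h5 w
    simpa using h7
  refine ⟨tr E (a y) / Module.finrank ℝ E, ?_⟩
  filter_upwards [eventually_eq_of_fderiv_eq_zero (hd.and h3), h2] with z h4 h5
  rwa [h4, zero_smul, add_zero] at h5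

/-- Two solutions which together with the metric are dependent at each point of an open set
are dependent with constant coefficients near some point of it. -/
theorem IsLocalSolution.exists_dependent (K : IsLocalKahler U G J Γ)
    (S : IsLocalSolution U G J Γ a lam) (S' : IsLocalSolution U G J Γ A Lam)
    (hE : 3 < Module.finrank ℝ E) (hy : y ∈ U)
    (H : ∀ᶠ z in 𝓝 y, ¬LinearIndependent ℝ ![1, a z, A z]) :
    ∃ c : Fin 3 → ℝ, c ≠ 0 ∧ ∃ x ∈ U, ∀ᶠ z in 𝓝 x, c 0 • 1 + c 1 • a z + c 2 • A z = 0 := by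
  have : Nontrivial E := Module.nontrivial_of_finrank_pos (R := ℝ) (by omega)
  by_cases h1 : ∃ᶠ x in 𝓝 y, LinearIndependent ℝ ![1, a x]
  · obtain ⟨x, hx, hxU, hxd⟩ := (h1.and_eventually
      ((K.isOpen.eventually_mem hy).and H.eventually_nhds)).exists
    -- `φ` and `ψ` express the coefficients of `A = f + h a` through differentiable functions near
    -- `x`. Independence of `1` and `a` then turns the relation between `df` and `dh` into `df = dh
    -- = 0`.
    obtain ⟨φ, hφ1, hφa⟩ := exists_dual_pair hx
    obtain ⟨ψ, hψa, hψ1⟩ := exists_dual_pair (LinearIndependent.pair_symm_iff.mp hx)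
    have hda := eventually_differentiableAt S.left_smooth K.isOpen hxU
    have hdA := eventually_differentiableAt S'.left_smooth K.isOpen hxU
    have hca := continuousAt_of_contDiffOn S.left_smooth K.isOpen hxU
    have hφ : ∀ᶠ z in 𝓝 x, φ (a z) ≠ 0 :=
      (φ.continuous.continuousAt.comp hca).eventually_ne (by simp [hφa])
    have hli : ∀ᶠ z in 𝓝 x, LinearIndependent ℝ ![1, a z] :=
      eventually_linearIndependent_pair continuousAt_const hca hx
    let h : E → ℝ := fun z ↦ φ (A z) / φ (a z)
    let f : E → ℝ := fun z ↦ ψ (A z) - h z * ψ (a z)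
    have hrep : ∀ᶠ z in 𝓝 x, A z = f z • 1 + h z • a z := by
      filter_upwards [hxd, hli, hφ] with z h2 h3 h4
      obtain ⟨p, q, hpq⟩ := exists_smul_add_smul_of_not_linearIndependent h3 h2
      have h5 : h z = q := by
        simp [h, hpq, hφ1, h4]
      have h6 : f z = p := by
        simp only [f, h5]
        simp [hpq, hψ1]
      rw [h5, h6]
      exact hpq
    have hd : ∀ᶠ z in 𝓝 x, DifferentiableAt ℝ h z ∧ DifferentiableAt ℝ f z := by
      filter_upwards [hda, hdA, hφ] with z h2 h3 h4
      have h5 : DifferentiableAt ℝ h z := differentiableAt_div h2 h3 h4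
      have h6 : DifferentiableAt ℝ (fun z ↦ ψ (A z)) z := ψ.differentiableAt.comp z h3
      have h7 : DifferentiableAt ℝ (fun z ↦ ψ (a z)) z := ψ.differentiableAt.comp z h2
      exact ⟨h5, h6.sub (h5.mul h7)⟩
    have hz : ∀ᶠ z in 𝓝 x, fderiv ℝ f z = 0 ∧ fderiv ℝ h z = 0 := by
      filter_upwards [hd, hrep.eventually_nhds, hli, K.isOpen.mem_nhds hxU] with z h2 h3 h4 h5
      have h6 (w : E) := S.eq_of_eq_smul_add_smul K S' hE h5 h2.2 h2.1 h3 w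
      rw [LinearIndependent.pair_iff] at h4
      exact ⟨ContinuousLinearMap.ext fun w ↦ (h4 _ _ (h6 w)).1,
        ContinuousLinearMap.ext fun w ↦ (h4 _ _ (h6 w)).2⟩
    refine ⟨![f x, h x, -1], fun h0 ↦ by simpa using congrFun h0 2, x, hxU, ?_⟩
    filter_upwards [eventually_eq_of_fderiv_eq_zero ((hd.and hz).mono fun z h ↦ ⟨h.1.2, h.2.1⟩),
      eventually_eq_of_fderiv_eq_zero ((hd.and hz).mono fun z h ↦ ⟨h.1.1, h.2.2⟩), hrep]
      with z h2 h3 h4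
    rw [h4, h2, h3]
    simp only [Matrix.cons_val]
    module
  · rw [not_frequently] at h1
    obtain ⟨r, hr⟩ := S.eventually_eq_smul_one K hE hy h1
    refine ⟨![-r, 1, 0], fun h0 ↦ by simpa using congrFun h0 1, y, hy, ?_⟩
    filter_upwards [hr] with z h5
    rw [h5]
    simp

/-- The scalar part `μ` in `∇ lam = μ + B a`. -/
def scalarPart (Γ : E → E →L[ℝ] E →L[ℝ] E) (a : E → E →L[ℝ] E) (lam : E → E) (B : ℝ) (z : E) : ℝ :=
  (tr E (covDerivVector Γ lam z) - B * tr E (a z)) / Module.finrank ℝ E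

/-- The extended system at a point. -/
def IsExtendedAt (G : E → E →L[ℝ] E →L[ℝ] ℝ) (Γ : E → E →L[ℝ] E →L[ℝ] E) (a : E → E →L[ℝ] E)
    (lam : E → E) (B : ℝ) (z : E) : Prop :=
  covDerivVector Γ lam z = B • a z + scalarPart Γ a lam B z • 1 ∧
    ∀ w, fderiv ℝ (scalarPart Γ a lam B) z w = 2 * B * G z (lam z) w

theorem scalarPart_eq [Nontrivial E] {B m : ℝ} {z : E}
    (h : covDerivVector Γ lam z = B • a z + m • 1) : scalarPart Γ a lam B z = m := by
  have hd : (Module.finrank ℝ E : ℝ) ≠ 0 := by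
    have := Module.finrank_pos (R := ℝ) (M := E)
    positivity
  rw [scalarPart, h]
  simp only [map_add, map_smul, tr_one, smul_eq_mul]
  field_simp
  ring

theorem IsLocalSolution.scalarPart_smooth (K : IsLocalKahler U G J Γ)
    (S : IsLocalSolution U G J Γ a lam) (B : ℝ) : ContDiffOn ℝ ∞ (scalarPart Γ a lam B) U := by
  have h1 : ContDiffOn ℝ ∞ (fun y ↦ tr E (a y)) U := (tr E).contDiff.comp_contDiffOn S.left_smooth
  exact ((S.tr_covDerivVector_smooth K).sub (contDiffOn_const.mul h1)).div_const _

omit [FiniteDimensional ℝ E] in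
/-- The derivative of `∇ lam = B a + m`. -/
theorem IsLocalSolution.ricciIdentity (K : IsLocalKahler U G J Γ)
    (S : IsLocalSolution U G J Γ a lam) (hy : y ∈ U) {B m : E → ℝ} (hB : DifferentiableAt ℝ B y)
    (hm : DifferentiableAt ℝ m y)
    (H : ∀ᶠ z in 𝓝 y, covDerivVector Γ lam z = B z • a z + m z • 1) :
    RicciIdentity (G y) (J y) (curvature Γ y) (a y) (lam y) (B y) (fderiv ℝ B y)
      (fderiv ℝ m y) := by
  have ha := ContDiffOn.differentiableAt_of_isOpen S.left_smooth K.isOpen hy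
  have h1 (X Y : E) : fderiv ℝ (covDerivVector Γ lam) y X Y =
      fderiv ℝ B y X • a y Y + B y • fderiv ℝ a y X Y + fderiv ℝ m y X • Y := by
    rw [EventuallyEq.fderiv_eq (𝕜 := ℝ) H, fderiv_fun_add (hB.fun_smul ha)
      (hm.fun_smul (differentiableAt_const _)), add_apply, fderiv_smul_apply hB ha,
      fderiv_smul_apply hm (differentiableAt_const _)]
    simp
  intro X Y
  rw [S.curvature_apply_right K hy, h1, h1, H.self_of_nhds, S.equation y hy, S.equation y hy]
  have one (v : E) : (1 : E →L[ℝ] E) v = v := rfl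
  simp only [add_apply, smul_apply, map_add, map_smul, one, K.torsion_free y hy Y X]
  module

/-- Where two solutions are independent together with the metric, both satisfy the extended
system with one and the same constant. -/
theorem IsLocalSolution.exists_isExtendedAt (K : IsLocalKahler U G J Γ)
    (S : IsLocalSolution U G J Γ a lam) (S' : IsLocalSolution U G J Γ A Lam)
    (hE : 3 < Module.finrank ℝ E) (hy : y ∈ U)
    (hi : LinearIndependent ℝ ![1, a y, A y]) :
    ∃ B, ∀ᶠ z in 𝓝 y, IsExtendedAt G Γ a lam B z ∧ IsExtendedAt G Γ A Lam B z := by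
  have : Nontrivial E := Module.nontrivial_of_finrank_pos (R := ℝ) (by omega)
  have hca := continuousAt_of_contDiffOn S.left_smooth K.isOpen hy
  have hcA := continuousAt_of_contDiffOn S'.left_smooth K.isOpen hy
  have hli : ∀ᶠ z in 𝓝 y, LinearIndependent ℝ ![1, a z, A z] :=
    eventually_linearIndependent_triple continuousAt_const hca hcA hi
  obtain ⟨φ, hφ1, hφa⟩ := exists_dual_pair (linearIndependent_pair_of_triple hi)
  have hφ : ∀ᶠ z in 𝓝 y, φ (a z) ≠ 0 :=
    (φ.continuous.continuousAt.comp hca).eventually_ne (by simp [hφa])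
  -- The pointwise factor is only known to exist. Since `φ` kills the identity, this quotient
  -- recovers it and is differentiable.
  let B : E → ℝ := fun z ↦ φ (covDerivVector Γ lam z) / φ (a z)
  let m : (E → E →L[ℝ] E) → (E → E) → E → ℝ := fun a lam z ↦
    (tr E (covDerivVector Γ lam z) - B z * tr E (a z)) / Module.finrank ℝ E
  have hm {a : E → E →L[ℝ] E} {lam : E → E} {r z} (h : covDerivVector Γ lam z =
      B z • a z + r • 1) : m a lam z = r := scalarPart_eq (B := B z) h
  have hrep : ∀ᶠ z in 𝓝 y, covDerivVector Γ lam z = B z • a z + m a lam z • 1 ∧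
      covDerivVector Γ Lam z = B z • A z + m A Lam z • 1 := by
    filter_upwards [hφ, hli, K.isOpen.eventually_mem hy] with z h1 h2 h3
    obtain ⟨b, r, r', h4, h5⟩ := Integrability.exists_common_factor (K.pair z h3)
      (K.isKahlerCurvature h3) (S.hermitian z h3) (S'.hermitian z h3)
      (S.isHermitianOp_covDerivVector K (by omega) h3)
      (S'.isHermitianOp_covDerivVector K (by omega) h3)
      (S.integrability K h3) (S'.integrability K h3) h2
    have h6 : B z = b := by
      simp [B, h4, hφ1, h1]
    rw [← h6] at h4 h5
    rw [hm h4, hm h5]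
    exact ⟨h4, h5⟩
  have hBd : ∀ᶠ z in 𝓝 y, DifferentiableAt ℝ B z := by
    filter_upwards [eventually_differentiableAt S.left_smooth K.isOpen hy, hφ,
      eventually_differentiableAt (S.covDerivVector_smooth K) K.isOpen hy] with z h1 h2 h3
    exact differentiableAt_div h1 h3 h2
  have hmd {a : E → E →L[ℝ] E} {lam : E → E} (S : IsLocalSolution U G J Γ a lam) :
      ∀ᶠ z in 𝓝 y, DifferentiableAt ℝ (m a lam) z := by
    filter_upwards [eventually_differentiableAt S.left_smooth K.isOpen hy, hBd,
      eventually_differentiableAt (S.tr_covDerivVector_smooth K) K.isOpen hy] with z h1 h2 h3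
    have h4 : DifferentiableAt ℝ (fun z ↦ tr E (a z)) z := (tr E).differentiableAt.comp z h1
    simp only [m, div_eq_mul_inv]
    exact (h3.sub (h2.mul h4)).mul_const _
  have hR : ∀ᶠ z in 𝓝 y, fderiv ℝ B z = 0 ∧ (∀ w, fderiv ℝ (m a lam) z w = 2 * B z * G z (lam z) w)
      ∧ ∀ w, fderiv ℝ (m A Lam) z w = 2 * B z * G z (Lam z) w := by
    filter_upwards [hBd, hmd S, hmd S', hrep.eventually_nhds, hli,
      K.isOpen.eventually_mem hy] with z h1 h2 h3 h4 h5 h6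
    have r1 := S.ricciIdentity K h6 h1 h2 (h4.mono fun _ h ↦ h.1)
    have r2 := S'.ricciIdentity K h6 h1 h3 (h4.mono fun _ h ↦ h.2)
    have i1 := S.integrability K h6
    have i2 := S'.integrability K h6
    rw [h4.self_of_nhds.1] at i1
    rw [h4.self_of_nhds.2] at i2
    have b0 := r1.factor_eq_zero (K.pair z h6) (by omega) (K.isKahlerCurvature h6)
      (S.hermitian z h6) (S'.hermitian z h6) h5 i1 i2 r2
    exact ⟨b0, r1.eq_of_eq_zero (K.pair z h6) (K.isKahlerCurvature h6) (by omega)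
      (S.hermitian z h6) b0, r2.eq_of_eq_zero (K.pair z h6) (K.isKahlerCurvature h6) (by omega)
      (S'.hermitian z h6) b0⟩
  have hBc := eventually_eq_of_fderiv_eq_zero (hBd.and (hR.mono fun _ h ↦ h.1))
  refine ⟨B y, ?_⟩
  filter_upwards [hBc.eventually_nhds, hrep, hR] with z h1 h2 h3
  have h4 := h1.self_of_nhds
  rw [h4] at h2 h3
  have h5 (a : E → E →L[ℝ] E) (lam : E → E) : scalarPart Γ a lam (B y) =ᶠ[𝓝 z] m a lam := by
    filter_upwards [h1] with x hx
    simp only [scalarPart, m, hx]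
  refine ⟨⟨?_, ?_⟩, ⟨?_, ?_⟩⟩
  · rw [(h5 a lam).self_of_nhds]
    exact h2.1
  · rw [(h5 a lam).fderiv_eq]
    exact h3.2.1
  · rw [(h5 A Lam).self_of_nhds]
    exact h2.2
  · rw [(h5 A Lam).fderiv_eq]
    exact h3.2.2

theorem fderiv_tr_eq (K : IsLocalKahler U G J Γ) (S : IsLocalSolution U G J Γ a lam) (hy : y ∈ U)
    (w : E) : fderiv ℝ (fun z ↦ tr E (a z)) y w = 4 * G y (lam y) w := by
  have ha := ContDiffOn.differentiableAt_of_isOpen S.left_smooth K.isOpen hy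
  have h1 : fderiv ℝ a y w = a y * Γ y w - Γ y w * a y + hsym (G y) (J y) w (lam y) := by
    ext u
    exact S.equation y hy w u
  have h2 : fderiv ℝ (fun z ↦ tr E (a z)) y w = tr E (fderiv ℝ a y w) := by
    have := ((tr E).hasFDerivAt (x := a y)).comp y ha.hasFDerivAt
    exact congrArg (fun T : E →L[ℝ] ℝ ↦ T w) this.fderiv
  rw [h2, h1, map_add, map_sub, tr_mul_comm, sub_self, tr_hsym (K.pair y hy),
    (K.pair y hy).symm]
  ring

/-- `lam` is a quarter of the gradient of `tr a`, so it vanishes wherever `a` vanishes nearby. -/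
theorem IsLocalSolution.eq_zero_of_eventually (K : IsLocalKahler U G J Γ)
    (S : IsLocalSolution U G J Γ a lam) (hy : y ∈ U) (H : ∀ᶠ z in 𝓝 y, a z = 0) :
    lam y = 0 ∧ covDerivVector Γ lam y = 0 := by
  have h1 : ∀ᶠ z in 𝓝 y, lam z = 0 := by
    filter_upwards [H.eventually_nhds, K.isOpen.eventually_mem hy] with z hz hzU
    refine (K.pair z hzU).nondeg _ fun w ↦ ?_
    have h2 : (fun x ↦ tr E (a x)) =ᶠ[𝓝 z] fun _ ↦ 0 := hz.mono fun x hx ↦ by simp [hx]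
    have h3 := fderiv_tr_eq K S hzU w
    rw [h2.fderiv_eq, fderiv_const_apply'] at h3
    linarith
  refine ⟨h1.self_of_nhds, ?_⟩
  have h2 : lam =ᶠ[𝓝 y] fun _ ↦ 0 := h1
  ext w
  rw [covDerivVector_apply, h2.fderiv_eq, h1.self_of_nhds]
  simp

omit [FiniteDimensional ℝ E] in
/-- A ratio of smooth functions which is locally constant on a dense set is locally constant. -/
theorem exists_ratio_of_dense (hU : IsOpen U) (hy : y ∈ U) {P Q : E → ℝ}
    (hP : ContDiffOn ℝ ∞ P U) (hQ : ContDiffOn ℝ ∞ Q U) (hQy : Q y ≠ 0) {Ω : E → ℝ → Prop}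
    (hΩ : ∀ x ∈ U, ∀ B, Ω x B → ∀ᶠ z in 𝓝 x, P z = B * Q z)
    (hdense : ∀ᶠ z in 𝓝 y, ∃ᶠ x in 𝓝 z, ∃ B, Ω x B) :
    ∃ β, ∀ᶠ x in 𝓝 y, ∀ B, Ω x B → B = β := by
  have hQ' : ∀ᶠ z in 𝓝 y, Q z ≠ 0 := (continuousAt_of_contDiffOn hQ hU hy).eventually_ne hQy
  obtain ⟨V, hV, hVo, hyV⟩ := eventually_nhds_iff.mp hQ'
  have hs : ContDiffOn ℝ ∞ (fun z ↦ P z / Q z) (U ∩ V) :=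
    (hP.mono Set.inter_subset_left).div (hQ.mono Set.inter_subset_left) fun z hz ↦ hV z hz.2
  have hUV : IsOpen (U ∩ V) := hU.inter hVo
  -- `P / Q` is smooth across the points where no `B` is known. Its derivative vanishes on a dense
  -- set, hence everywhere near `y` by continuity.
  have h0 : ∀ᶠ z in 𝓝 y, fderiv ℝ (fun z ↦ P z / Q z) z = 0 := by
    filter_upwards [hUV.eventually_mem ⟨hy, hyV⟩, hdense] with z hz hzd
    have hc : ContinuousAt (fderiv ℝ (fun z ↦ P z / Q z)) z :=
      ((hs.fderiv_of_isOpen hUV (m := ∞) (by simp)).continuousOn).continuousAt (hUV.mem_nhds hz)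
    refine tendsto_nhds_unique_of_frequently_eq hc tendsto_const_nhds ?_
    refine (hzd.and_eventually (hUV.eventually_mem hz)).mono ?_
    rintro x ⟨⟨B, hB⟩, hx⟩
    have h1 : (fun z ↦ P z / Q z) =ᶠ[𝓝 x] fun _ ↦ B := by
      filter_upwards [hΩ x hx.1 B hB, hVo.mem_nhds hx.2] with z h2 h3
      rw [h2, mul_div_cancel_right₀ _ (hV z h3)]
    rw [h1.fderiv_eq]
    simp
  have h1 := eventually_eq_of_fderiv_eq_zero
    ((eventually_differentiableAt hs hUV ⟨hy, hyV⟩).and h0)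
  refine ⟨P y / Q y, ?_⟩
  filter_upwards [h1, hUV.eventually_mem ⟨hy, hyV⟩] with x h2 h3 B hB
  rw [← h2, (hΩ x h3.1 B hB).self_of_nhds, mul_div_cancel_right₀ _ (hV x h3.2)]

theorem IsExtendedAt.of_frequently (K : IsLocalKahler U G J Γ)
    (S : IsLocalSolution U G J Γ a lam) {B : ℝ} {z : E} (hz : z ∈ U)
    (H : ∃ᶠ x in 𝓝 z, IsExtendedAt G Γ a lam B x) : IsExtendedAt G Γ a lam B z := by
  have c1 := continuousAt_of_contDiffOn S.left_smooth K.isOpen hz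
  have c2 := continuousAt_of_contDiffOn (S.covDerivVector_smooth K) K.isOpen hz
  have c3 := continuousAt_of_contDiffOn (S.scalarPart_smooth K B) K.isOpen hz
  have c4 := continuousAt_of_contDiffOn K.metric_smooth K.isOpen hz
  have c5 := continuousAt_of_contDiffOn S.right_smooth K.isOpen hz
  constructor
  · exact tendsto_nhds_unique_of_frequently_eq c2
      ((c1.const_smul B).add (c3.smul continuousAt_const)) (H.mono fun x hx ↦ hx.1)
  · intro w
    have c6 := continuousAt_of_contDiffOn
      (contDiffOn_fderiv_apply (S.scalarPart_smooth K B) K.isOpen w) K.isOpen hz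
    exact tendsto_nhds_unique_of_frequently_eq c6
      (continuousAt_const.mul ((c4.clm_apply c5).clm_apply continuousAt_const))
      (H.mono fun x hx ↦ hx.2 w)

/-- Two solutions generically independent together with the metric satisfy the extended system
near each point where one of them is not proportional to the metric to first order. -/
theorem IsLocalSolution.exists_isExtendedAt_of_dense (K : IsLocalKahler U G J Γ)
    (S : IsLocalSolution U G J Γ a lam) (S' : IsLocalSolution U G J Γ A Lam)
    (hE : 3 < Module.finrank ℝ E) (hy : y ∈ U)
    (hdense : ∀ᶠ z in 𝓝 y, ∃ᶠ x in 𝓝 z, LinearIndependent ℝ ![1, a x, A x])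
    (hne : LinearIndependent ℝ ![1, a y] ∨ lam y ≠ 0) :
    ∃ B, ∀ᶠ z in 𝓝 y, IsExtendedAt G Γ a lam B z ∧ IsExtendedAt G Γ A Lam B z := by
  let Ω : E → ℝ → Prop := fun x B ↦ ∀ᶠ z in 𝓝 x, IsExtendedAt G Γ a lam B z ∧
    IsExtendedAt G Γ A Lam B z
  have hdΩ : ∀ᶠ z in 𝓝 y, ∃ᶠ x in 𝓝 z, ∃ B, Ω x B := by
    filter_upwards [hdense, K.isOpen.eventually_mem hy] with z hz hzU
    refine (hz.and_eventually (K.isOpen.eventually_mem hzU)).mono ?_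
    rintro x ⟨h1, h2⟩
    exact S.exists_isExtendedAt K S' hE h2 h1
  have htr : ContDiffOn ℝ ∞ (fun y ↦ tr E (a y)) U :=
    (tr E).contDiff.comp_contDiffOn S.left_smooth
  -- Two ways to write `B` as a quotient with denominator nonzero at `y`: from the Hessian equation
  -- when `a` is not proportional to the metric at `y`, and from the gradient equation when `lam`
  -- does not vanish there.
  obtain ⟨P, Q, hP, hQ, hQy, hPQ⟩ : ∃ P Q : E → ℝ, ContDiffOn ℝ ∞ P U ∧ ContDiffOn ℝ ∞ Q U ∧
      Q y ≠ 0 ∧ ∀ x ∈ U, ∀ B, Ω x B → ∀ᶠ z in 𝓝 x, P z = B * Q z := by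
    rcases hne with hne | hne
    · obtain ⟨φ, hφ1, hφa⟩ := exists_dual_pair hne
      refine ⟨fun z ↦ φ (covDerivVector Γ lam z), fun z ↦ φ (a z),
        φ.contDiff.comp_contDiffOn (S.covDerivVector_smooth K),
        φ.contDiff.comp_contDiffOn S.left_smooth, by simp [hφa], fun x _ B hB ↦ ?_⟩
      filter_upwards [hB] with z hz
      rw [hz.1.1]
      simp [hφ1]
    · obtain ⟨w, hw⟩ : ∃ w, G y (lam y) w ≠ 0 := by
        by_contra! h
        exact hne ((K.pair y hy).nondeg _ h)
      set d : ℝ := ((Module.finrank ℝ E : ℕ) : ℝ) with hd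
      have hd0 : 0 < d := by
        have : 0 < Module.finrank ℝ E := by omega
        positivity
      -- With `μ` the scalar part, `tr ∇ lam = d μ + B tr a`. Since `dμ = 2 B g(lam, ·)` and `d(tr
      -- a) = 4 g(lam, ·)`, the derivative is `(2 d + 4) B g(lam, ·)`.
      refine ⟨fun z ↦ fderiv ℝ (fun z ↦ tr E (covDerivVector Γ lam z)) z w,
        fun z ↦ (2 * d + 4) * G z (lam z) w,
        contDiffOn_fderiv_apply (S.tr_covDerivVector_smooth K) K.isOpen w,
        contDiffOn_const.mul ((K.metric_smooth.clm_apply S.right_smooth).clm_apply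
          contDiffOn_const), mul_ne_zero (by positivity) hw, fun x hx B hB ↦ ?_⟩
      filter_upwards [hB, K.isOpen.eventually_mem hx] with z hz hzU
      have h1 := hz.1.2 w
      have h2 : scalarPart Γ a lam B = fun z ↦
          (tr E (covDerivVector Γ lam z) - B * tr E (a z)) * d⁻¹ := by
        ext z
        rw [scalarPart, div_eq_mul_inv]
      have d1 := ContDiffOn.differentiableAt_of_isOpen (S.tr_covDerivVector_smooth K) K.isOpen hzU
      have d2 := ContDiffOn.differentiableAt_of_isOpen htr K.isOpen hzU
      rw [h2, fderiv_mul_const (d1.fun_sub (d2.const_mul B)), fderiv_fun_sub d1 (d2.const_mul B),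
        fderiv_const_mul d2] at h1
      simp only [smul_apply, sub_apply, smul_eq_mul, fderiv_tr_eq K S hzU] at h1
      field_simp at h1
      linarith
  obtain ⟨β, hβ⟩ := exists_ratio_of_dense K.isOpen hy hP hQ hQy hPQ hdΩ
  refine ⟨β, ?_⟩
  filter_upwards [hβ.eventually_nhds, hdΩ, K.isOpen.eventually_mem hy] with z h1 h2 h3
  have h4 : ∃ᶠ x in 𝓝 z, IsExtendedAt G Γ a lam β x ∧ IsExtendedAt G Γ A Lam β x := by
    refine (h2.and_eventually h1).mono ?_
    rintro x ⟨⟨B, hB⟩, h5⟩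
    rw [← h5 B hB]
    exact hB.self_of_nhds
  exact ⟨IsExtendedAt.of_frequently K S h3 (h4.mono fun _ h ↦ h.1),
    IsExtendedAt.of_frequently K S' h3 (h4.mono fun _ h ↦ h.2)⟩

end Factor
end Kahler
end

noncomputable section

namespace Kahler

/-! ### The Levi-Civita connection in coordinates -/

section LeviCivita

open Filter Topology

set_option synthInstance.maxHeartbeats 400000
set_option maxSynthPendingDepth 3

variable {E : Type*} [NormedAddCommGroup E] [NormedSpace ℝ E]
  {U : Set E} {G : E → E →L[ℝ] E →L[ℝ] ℝ} {J : E → E →L[ℝ] E}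
  {α : E → E →L[ℝ] E →L[ℝ] ℝ} {ℓ : E → E →L[ℝ] ℝ} {y : E}

/-- The Christoffel symbols of the first kind of a metric with derivative `D`. -/
def lowerChristoffel (D : E →L[ℝ] E →L[ℝ] E →L[ℝ] ℝ) : E →L[ℝ] E →L[ℝ] E →L[ℝ] ℝ :=
  (1 / 2 : ℝ) • (D + D.flip
    - (ContinuousLinearMap.flipₗᵢ ℝ E E ℝ).toContinuousLinearEquiv.toContinuousLinearMap ∘L D.flip)

theorem lowerChristoffel_apply (D : E →L[ℝ] E →L[ℝ] E →L[ℝ] ℝ) (u v w : E) :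
    lowerChristoffel D u v w = 1 / 2 * (D u v w + D v u w - D w u v) := by
  rfl

/-- The Levi-Civita connection of the metric with components `G`. -/
def leviCivita (G : E → E →L[ℝ] E →L[ℝ] ℝ) (y : E) : E →L[ℝ] E →L[ℝ] E :=
  (ContinuousLinearMap.compL ℝ E (E →L[ℝ] ℝ) E (G y).inverse) ∘L lowerChristoffel (fderiv ℝ G y)

theorem leviCivita_apply (G : E → E →L[ℝ] E →L[ℝ] ℝ) (y u v : E) :
    leviCivita G y u v = (G y).inverse (lowerChristoffel (fderiv ℝ G y) u v) :=
  rfl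

theorem christoffel_eq (hG : DifferentiableAt ℝ G y) (u v : E) :
    christoffel G y u v = leviCivita G y u v := by
  have h1 (u : E) : fderiv ℝ (fun z ↦ G z u) y = (fderiv ℝ G y).flip u := by
    ext1 w
    rw [fderiv_apply_apply hG (differentiableAt_const _), fderiv_const_apply']
    simp
  have h2 (u v w : E) : fderiv ℝ (fun z ↦ G z u v) y w = fderiv ℝ G y w u v := by
    rw [fderiv_apply_apply (hG.clm_apply (differentiableAt_const u)) (differentiableAt_const _),
      fderiv_const_apply', h1]
    simp
  rw [christoffel, leviCivita_apply]
  congr 1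
  ext w
  rw [lowerChristoffel_apply, h1, h1]
  simp [h2]

variable [FiniteDimensional ℝ E]

theorem leviCivita_lower (h : IsHermitianPair (G y) (J y)) (u v w : E) :
    G y (leviCivita G y u v) w =
      1 / 2 * (fderiv ℝ G y u v w + fderiv ℝ G y v u w - fderiv ℝ G y w u v) := by
  rw [leviCivita_apply, h.inverse_apply_apply, lowerChristoffel_apply]

theorem leviCivita_smooth (hU : IsOpen U) (hG : ContDiffOn ℝ ∞ G U)
    (hp : ∀ y ∈ U, IsHermitianPair (G y) (J y)) : ContDiffOn ℝ ∞ (leviCivita G) U := by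
  have h1 : ContDiffOn ℝ ∞ (fderiv ℝ G) U := hG.fderiv_of_isOpen hU (by simp)
  simp_rw [contDiffOn_clm_apply]
  intro u v
  refine (contDiffOn_inverse hG hp).clm_apply ?_
  rw [contDiffOn_clm_apply]
  intro w
  have h2 (u v w : E) : ContDiffOn ℝ ∞ (fun y ↦ fderiv ℝ G y u v w) U :=
    ((h1.clm_apply contDiffOn_const).clm_apply contDiffOn_const).clm_apply contDiffOn_const
  exact (contDiffOn_const.mul (((h2 u v w).add (h2 v u w)).sub (h2 w u v))).congr
    fun y _ ↦ lowerChristoffel_apply _ _ _ _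

omit [FiniteDimensional ℝ E] in
theorem fderiv_symm (hG : DifferentiableAt ℝ G y) (hs : ∀ᶠ z in 𝓝 y, ∀ u v, G z u v = G z v u)
    (u v w : E) : fderiv ℝ G y u v w = fderiv ℝ G y u w v := by
  have h2 (u v w : E) : fderiv ℝ (fun z ↦ G z u v) y w = fderiv ℝ G y w u v := by
    rw [fderiv_apply_apply (hG.clm_apply (differentiableAt_const u)) (differentiableAt_const _),
      fderiv_const_apply', fderiv_apply_apply hG (differentiableAt_const _), fderiv_const_apply']
    simp
  rw [← h2, ← h2]
  have : (fun z ↦ G z v w) =ᶠ[𝓝 y] fun z ↦ G z w v := hs.mono fun z hz ↦ hz v w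
  rw [this.fderiv_eq]

theorem isLocalKahler_leviCivita (hU : IsOpen U) (hG : ContDiffOn ℝ ∞ G U)
    (hJ : ContDiffOn ℝ ∞ J U) (hp : ∀ y ∈ U, IsHermitianPair (G y) (J y))
    (hpar : ∀ y ∈ U, ∀ w u, covDerivEnd G J y w u = 0) :
    IsLocalKahler U G J (leviCivita G) := by
  have hs {y : E} (hy : y ∈ U) (u v w : E) : fderiv ℝ G y u v w = fderiv ℝ G y u w v :=
    fderiv_symm (ContDiffOn.differentiableAt_of_isOpen hG hU hy)
      ((hU.eventually_mem hy).mono fun z hz ↦ (hp z hz).symm) u v w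
  refine ⟨hU, hG, hJ, leviCivita_smooth hU hG hp, hp, fun y hy u v ↦ ?_, fun y hy w u v ↦ ?_,
    fun y hy w u ↦ ?_⟩
  · refine (hp y hy).ext_left fun w ↦ ?_
    rw [leviCivita_lower (hp y hy), leviCivita_lower (hp y hy), hs hy w u v]
    ring
  · rw [(hp y hy).symm u, leviCivita_lower (hp y hy), leviCivita_lower (hp y hy), hs hy w v u,
      hs hy u w v, hs hy v w u]
    ring
  · have h1 := hpar y hy w u
    rw [covDerivEnd, christoffel_eq (ContDiffOn.differentiableAt_of_isOpen hG hU hy),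
      christoffel_eq (ContDiffOn.differentiableAt_of_isOpen hG hU hy), fderiv_apply_apply
      (ContDiffOn.differentiableAt_of_isOpen hJ hU hy) (differentiableAt_const _),
      fderiv_const_apply', map_zero, add_zero] at h1
    rw [eq_sub_iff_add_eq, ← sub_eq_zero]
    exact h1

/-- The endomorphism corresponding to a bilinear form. -/
def raise (G α : E → E →L[ℝ] E →L[ℝ] ℝ) (y : E) : E →L[ℝ] E :=
  (G y).inverse ∘L α y

/-- The vector field corresponding to a `1`-form. -/
def raiseCovector (G : E → E →L[ℝ] E →L[ℝ] ℝ) (ℓ : E → E →L[ℝ] ℝ) (y : E) : E :=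
  (G y).inverse (ℓ y)

theorem raise_lower (h : IsHermitianPair (G y) (J y)) (u v : E) :
    G y (raise G α y u) v = α y u v :=
  h.inverse_apply_apply _ _

theorem raiseCovector_lower (h : IsHermitianPair (G y) (J y)) (v : E) :
    G y (raiseCovector G ℓ y) v = ℓ y v :=
  h.inverse_apply_apply _ _

theorem raise_smooth (hG : ContDiffOn ℝ ∞ G U) (hp : ∀ y ∈ U, IsHermitianPair (G y) (J y))
    (hα : ContDiffOn ℝ ∞ α U) : ContDiffOn ℝ ∞ (raise G α) U :=
  (contDiffOn_inverse hG hp).clm_comp hα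

theorem raiseCovector_smooth (hG : ContDiffOn ℝ ∞ G U)
    (hp : ∀ y ∈ U, IsHermitianPair (G y) (J y)) (hℓ : ContDiffOn ℝ ∞ ℓ U) :
    ContDiffOn ℝ ∞ (raiseCovector G ℓ) U :=
  (contDiffOn_inverse hG hp).clm_apply hℓ

/-- Because the metric is parallel, raising an index commutes with covariant differentiation; the
signs in the equation come from `g(x, J z) = -g(J x, z)`. -/
theorem isLocalSolution_raise (K : IsLocalKahler U G J (leviCivita G)) (hα : ContDiffOn ℝ ∞ α U)
    (hℓ : ContDiffOn ℝ ∞ ℓ U) (hs : ∀ y ∈ U, ∀ u v, α y u v = α y v u)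
    (hh : ∀ y ∈ U, ∀ u v, α y (J y u) (J y v) = α y u v)
    (he : ∀ y ∈ U, ∀ u v w, covDerivBilin G α y w u v =
      ℓ y u * G y v w + ℓ y v * G y u w - ℓ y (J y u) * G y v (J y w)
        - ℓ y (J y v) * G y u (J y w)) :
    IsLocalSolution U G J (leviCivita G) (raise G α) (raiseCovector G ℓ) := by
  have ha := raise_smooth K.metric_smooth K.pair hα
  refine ⟨ha, raiseCovector_smooth K.metric_smooth K.pair hℓ, fun y hy ↦ ⟨fun u v ↦ ?_, fun u ↦ ?_⟩,
    fun y hy w u ↦ ?_⟩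
  · rw [raise_lower (K.pair y hy), (K.pair y hy).symm u, raise_lower (K.pair y hy), hs y hy]
  · refine (K.pair y hy).ext_left fun v ↦ ?_
    have h1 : v = J y (-J y v) := by rw [map_neg, (K.pair y hy).sq, neg_neg]
    rw [h1, (K.pair y hy).herm, raise_lower (K.pair y hy), raise_lower (K.pair y hy), hh y hy]
  · have hp := K.pair y hy
    refine hp.ext_left fun v ↦ ?_
    have hGd := ContDiffOn.differentiableAt_of_isOpen K.metric_smooth K.isOpen hy
    have had := ContDiffOn.differentiableAt_of_isOpen ha K.isOpen hy
    have h1 : fderiv ℝ (fun z ↦ α z u v) y w =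
        fderiv ℝ G y w (raise G α y u) v + G y (fderiv ℝ (raise G α) y w u) v := by
      have h2 : (fun z ↦ α z u v) =ᶠ[𝓝 y] fun z ↦ G z (raise G α z u) v := by
        filter_upwards [K.isOpen.mem_nhds hy] with z hz
        rw [raise_lower (K.pair z hz)]
      have h3 : DifferentiableAt ℝ (fun z ↦ raise G α z u) y :=
        had.clm_apply (differentiableAt_const u)
      rw [h2.fderiv_eq, fderiv_apply_apply (hGd.clm_apply h3) (differentiableAt_const _),
        fderiv_const_apply', fderiv_apply_apply hGd h3,
        fderiv_apply_apply had (differentiableAt_const u), fderiv_const_apply']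
      simp
    have h2 := he y hy u v w
    rw [covDerivBilin, h1, christoffel_eq hGd, christoffel_eq hGd, K.metric_parallel y hy] at h2
    simp only [← raise_lower (α := α) hp, ← raiseCovector_lower (ℓ := ℓ) hp] at h2
    simp only [hsym_apply, map_add, map_sub, map_smul, add_apply, sub_apply, smul_apply,
      smul_eq_mul]
    have h3 (x z : E) : G y x (J y z) = -G y (J y x) z := by
      rw [← hp.herm x, hp.sq, map_neg]
    rw [h3 (raiseCovector G ℓ y), h3 (raiseCovector G ℓ y)] at h2
    rw [hp.symm v w, hp.symm v (J y w), hp.symm u w, hp.symm u (J y w)] at h2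
    linear_combination h2

theorem covDerivCovector_eq (K : IsLocalKahler U G J (leviCivita G)) (hℓ : ContDiffOn ℝ ∞ ℓ U)
    (hy : y ∈ U) (w u : E) : covDerivCovector G ℓ y w u =
      G y (covDerivVector (leviCivita G) (raiseCovector G ℓ) y w) u := by
  have hp := K.pair y hy
  have hGd := ContDiffOn.differentiableAt_of_isOpen K.metric_smooth K.isOpen hy
  have hl := ContDiffOn.differentiableAt_of_isOpen
    (raiseCovector_smooth K.metric_smooth K.pair hℓ) K.isOpen hy
  have h2 : (fun z ↦ ℓ z u) =ᶠ[𝓝 y] fun z ↦ G z (raiseCovector G ℓ z) u := by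
    filter_upwards [K.isOpen.mem_nhds hy] with z hz
    rw [raiseCovector_lower (K.pair z hz)]
  rw [covDerivCovector, h2.fderiv_eq, fderiv_apply_apply (hGd.clm_apply hl)
    (differentiableAt_const _), fderiv_const_apply', fderiv_apply_apply hGd hl,
    christoffel_eq hGd, covDerivVector_apply, add_apply, K.metric_parallel y hy,
    ← raiseCovector_lower (ℓ := ℓ) hp, map_zero, map_add, add_apply]
  ring

omit [FiniteDimensional ℝ E] in
theorem fderiv_comp_apply {F : Type*} [NormedAddCommGroup F] [NormedSpace ℝ F] {f : E → F}
    {φ : E → E} (hf : DifferentiableAt ℝ f (φ y)) (hφ : DifferentiableAt ℝ φ y) :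
    DifferentiableAt ℝ (fun z ↦ f (φ z)) y ∧
      ∀ w, fderiv ℝ (fun z ↦ f (φ z)) y w = fderiv ℝ f (φ y) (fderiv ℝ φ y w) :=
  ⟨hf.comp y hφ, fun w ↦ congrArg (fun T : E →L[ℝ] F ↦ T w) (fderiv_comp y hf hφ)⟩

/-- The covariant derivative of `1`-forms does not depend on the coordinates. -/
theorem covDerivCovector_comp {G' : E → E →L[ℝ] E →L[ℝ] ℝ} {ℓ' : E → E →L[ℝ] ℝ} {J' : E → E →L[ℝ] E}
    {φ : E → E} (hφ : ContDiffAt ℝ ∞ φ y) (hp : IsHermitianPair (G y) (J y))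
    (hp' : IsHermitianPair (G' (φ y)) (J' (φ y)))
    (hGd : DifferentiableAt ℝ G y)
    (hGd' : DifferentiableAt ℝ G' (φ y)) (hℓ' : DifferentiableAt ℝ ℓ' (φ y))
    (hG : ∀ᶠ z in 𝓝 y, ∀ u v, G z u v = G' (φ z) (fderiv ℝ φ z u) (fderiv ℝ φ z v))
    (hl : ∀ᶠ z in 𝓝 y, ∀ u, ℓ z u = ℓ' (φ z) (fderiv ℝ φ z u))
    (hsurj : Function.Surjective (fderiv ℝ φ y)) (w u : E) :
    covDerivCovector G ℓ y w u =
      covDerivCovector G' ℓ' (φ y) (fderiv ℝ φ y w) (fderiv ℝ φ y u) := by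
  have hφ1 : DifferentiableAt ℝ φ y := hφ.differentiableAt (by simp)
  have hφ2 : DifferentiableAt ℝ (fderiv ℝ φ) y :=
    (hφ.fderiv_right (m := ∞) (by simp)).differentiableAt (by simp)
  have hD (v : E) : DifferentiableAt ℝ (fun z ↦ fderiv ℝ φ z v) y :=
    hφ2.clm_apply (differentiableAt_const v)
  have hDv (v w : E) : fderiv ℝ (fun z ↦ fderiv ℝ φ z v) y w = fderiv ℝ (fderiv ℝ φ) y w v := by
    rw [fderiv_apply_apply hφ2 (differentiableAt_const v), fderiv_const_apply']
    simp
  have hD2 (v w : E) : fderiv ℝ (fderiv ℝ φ) y w v = fderiv ℝ (fderiv ℝ φ) y v w :=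
    hφ.isSymmSndFDerivAt (by simpa using WithTop.coe_le_coe.mpr (le_top : (2 : ℕ∞) ≤ ⊤)) w v
  obtain ⟨hG1, hG2⟩ := fderiv_comp_apply hGd' hφ1
  obtain ⟨hl1, hl2⟩ := fderiv_comp_apply hℓ' hφ1
  have hdG (u v w : E) : fderiv ℝ G y w u v =
      fderiv ℝ G' (φ y) (fderiv ℝ φ y w) (fderiv ℝ φ y u) (fderiv ℝ φ y v)
        + G' (φ y) (fderiv ℝ (fderiv ℝ φ) y w u) (fderiv ℝ φ y v)
        + G' (φ y) (fderiv ℝ φ y u) (fderiv ℝ (fderiv ℝ φ) y w v) := by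
    have h1 : fderiv ℝ (fun z ↦ G z u v) y w = fderiv ℝ G y w u v := by
      rw [fderiv_apply_apply (hGd.clm_apply (differentiableAt_const u)) (differentiableAt_const _),
        fderiv_const_apply', fderiv_apply_apply hGd (differentiableAt_const _),
        fderiv_const_apply']
      simp
    have h2 : (fun z ↦ G z u v) =ᶠ[𝓝 y] fun z ↦ G' (φ z) (fderiv ℝ φ z u) (fderiv ℝ φ z v) :=
      hG.mono fun z hz ↦ hz u v
    rw [← h1, h2.fderiv_eq, fderiv_apply_apply (hG1.clm_apply (hD u)) (hD v),
      fderiv_apply_apply hG1 (hD u), hG2, hDv, hDv, add_apply]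
  -- The transformation law of the Christoffel symbols. The second-derivative term cancels the one
  -- produced by differentiating the pulled-back 1-form.
  have hΓ : fderiv ℝ φ y (leviCivita G y w u) =
      leviCivita G' (φ y) (fderiv ℝ φ y w) (fderiv ℝ φ y u) + fderiv ℝ (fderiv ℝ φ) y w u := by
    refine hp'.ext_left fun v ↦ ?_
    obtain ⟨v, rfl⟩ := hsurj v
    rw [← hG.self_of_nhds, leviCivita_lower hp, hdG, hdG, hdG, map_add, add_apply,
      leviCivita_lower hp', hD2 w u, hD2 v w, hD2 v u,
      hp'.symm (fderiv ℝ φ y u) (fderiv ℝ (fderiv ℝ φ) y v w)]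
    ring
  have h3 : (fun z ↦ ℓ z u) =ᶠ[𝓝 y] fun z ↦ ℓ' (φ z) (fderiv ℝ φ z u) :=
    hl.mono fun z hz ↦ hz u
  have h4 : fderiv ℝ (fun z ↦ ℓ' z (fderiv ℝ φ y u)) (φ y) (fderiv ℝ φ y w) =
      fderiv ℝ ℓ' (φ y) (fderiv ℝ φ y w) (fderiv ℝ φ y u) := by
    rw [fderiv_apply_apply hℓ' (differentiableAt_const _), fderiv_const_apply']
    simp
  rw [covDerivCovector, covDerivCovector, christoffel_eq hGd, christoffel_eq hGd', h3.fderiv_eq,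
    fderiv_apply_apply hl1 (hD u), hl2, hDv, hl.self_of_nhds, hΓ, h4, map_add]
  ring

end LeviCivita
end Kahler
end

noncomputable section

namespace Kahler

/-! ### Kähler structures in charts -/

section Charts

open Filter Topology

set_option synthInstance.maxHeartbeats 400000
set_option maxSynthPendingDepth 3

variable {E : Type*} [NormedAddCommGroup E] [NormedSpace ℝ E]
  {M : Type*} [TopologicalSpace M] [ChartedSpace E M] [IsManifold 𝓘(ℝ, E) ∞ M]
  {c c' : OpenPartialHomeomorph M E} {y : E}

theorem frame_coframe (hc : c ∈ atlas E M) (hy : y ∈ c.target)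
    (v : TangentSpace 𝓘(ℝ, E) (c.symm y)) : frame c y (coframe c y v) = v := by
  have : IsManifold 𝓘(ℝ, E) 1 M := IsManifold.of_le (n := ∞) (by simp)
  have h := (mdifferentiable_of_mem_atlas (I := 𝓘(ℝ, E)) hc).symm_comp_deriv (c.map_target hy)
  rw [c.right_inv hy] at h
  exact congrArg (fun T : E →L[ℝ] E ↦ T v) h

theorem coframe_frame (hc : c ∈ atlas E M) (hy : y ∈ c.target) (v : E) :
    coframe c y (frame c y v) = v := by
  have : IsManifold 𝓘(ℝ, E) 1 M := IsManifold.of_le (n := ∞) (by simp)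
  have h := (mdifferentiable_of_mem_atlas (I := 𝓘(ℝ, E)) hc).comp_symm_deriv hy
  exact congrArg (fun T : E →L[ℝ] E ↦ T v) h

theorem endInChart_apply (hc : c ∈ atlas E M) (hy : y ∈ c.target) (J : EndField E M) (u : E) :
    frame c y (endInChart c J y u) = J (c.symm y) (frame c y u) :=
  frame_coframe hc hy _

theorem contDiffAt_covectorInChart {l : CovectorField E M} (hl : SmoothCovector l)
    (hc : c ∈ atlas E M) (hy : y ∈ c.target) (u : E) :
    ContDiffAt ℝ ∞ (fun z ↦ covectorInChart c l z u) y := by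
  have h1 : ContMDiffAt 𝓘(ℝ, E) 𝓘(ℝ, E) ∞ c.symm y :=
    contMDiffAt_symm_of_mem_maximalAtlas (IsManifold.subset_maximalAtlas hc) hy
  have h := ContMDiffAt.clm_bundle_apply (F₁ := E) (F₂ := ℝ)
    (E₁ := fun p : M ↦ TangentSpace 𝓘(ℝ, E) p) (E₂ := fun _ : M ↦ ℝ)
    ((hl (c.symm y)).comp y h1) (contMDiffAt_frame hc hy u)
  rw [Bundle.contMDiffAt_totalSpace] at h
  exact h.2.contDiffAt

theorem contDiffAt_bilinInChart_end {T : BilinField E M} (hT : SmoothBilin T) {J : EndField E M}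
    (hJ : SmoothEnd J) (hc : c ∈ atlas E M) (hy : y ∈ c.target) (u v : E) :
    ContDiffAt ℝ ∞ (fun z ↦ bilinInChart c T z (endInChart c J z u) v) y := by
  have h1 : ContMDiffAt 𝓘(ℝ, E) 𝓘(ℝ, E) ∞ c.symm y :=
    contMDiffAt_symm_of_mem_maximalAtlas (IsManifold.subset_maximalAtlas hc) hy
  have h2 := ContMDiffAt.clm_bundle_apply (F₁ := E) (F₂ := E)
    (E₁ := fun p : M ↦ TangentSpace 𝓘(ℝ, E) p) (E₂ := fun p : M ↦ TangentSpace 𝓘(ℝ, E) p)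
    ((hJ (c.symm y)).comp y h1) (contMDiffAt_frame hc hy u)
  have h := ContMDiffAt.clm_bundle_apply₂ (F₁ := E) (F₂ := E) (F₃ := ℝ)
    (E₁ := fun p : M ↦ TangentSpace 𝓘(ℝ, E) p) (E₂ := fun p : M ↦ TangentSpace 𝓘(ℝ, E) p)
    (E₃ := fun _ : M ↦ ℝ)
    ((hT (c.symm y)).comp y h1) h2 (contMDiffAt_frame hc hy v)
  rw [Bundle.contMDiffAt_totalSpace] at h
  refine h.2.contDiffAt.congr_of_eventuallyEq ?_
  filter_upwards [c.open_target.mem_nhds hy] with z hz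
  rw [bilinInChart_apply, endInChart_apply hc hz]
  rfl

/-- The transition map between two charts. -/
theorem frame_transition (hc : c ∈ atlas E M) (hc' : c' ∈ atlas E M) (hy : y ∈ c.target)
    (hy' : c.symm y ∈ c'.source) (u : E) :
    (frame c y u : E) = frame c' (c' (c.symm y)) (fderiv ℝ (fun z ↦ c' (c.symm z)) y u) := by
  have : IsManifold 𝓘(ℝ, E) 1 M := IsManifold.of_le (n := ∞) (by simp)
  have d1 : MDifferentiableAt 𝓘(ℝ, E) 𝓘(ℝ, E) c.symm y :=
    (mdifferentiable_of_mem_atlas (I := 𝓘(ℝ, E)) hc).mdifferentiableAt_symm hy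
  have d2 : MDifferentiableAt 𝓘(ℝ, E) 𝓘(ℝ, E) c' (c.symm y) :=
    (mdifferentiable_of_mem_atlas (I := 𝓘(ℝ, E)) hc').mdifferentiableAt hy'
  have h1 : mfderiv 𝓘(ℝ, E) 𝓘(ℝ, E) (c' ∘ c.symm) y =
      (mfderiv 𝓘(ℝ, E) 𝓘(ℝ, E) c' (c.symm y)).comp (mfderiv 𝓘(ℝ, E) 𝓘(ℝ, E) c.symm y) :=
    mfderiv_comp y d2 d1
  rw [mfderiv_eq_fderiv] at h1
  have h2 := (mdifferentiable_of_mem_atlas (I := 𝓘(ℝ, E)) hc').symm_comp_deriv hy'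
  have h3 : (fderiv ℝ (fun z ↦ c' (c.symm z)) y u : E) =
      mfderiv 𝓘(ℝ, E) 𝓘(ℝ, E) c' (c.symm y) (frame c y u) :=
    congrArg (fun T : E →L[ℝ] E ↦ T u) h1
  rw [h3]
  exact (congrArg (fun T : E →L[ℝ] E ↦ T (frame c y u)) h2).symm

theorem contDiffAt_transition (hc : c ∈ atlas E M) (hc' : c' ∈ atlas E M) (hy : y ∈ c.target)
    (hy' : c.symm y ∈ c'.source) : ContDiffAt ℝ ∞ (fun z ↦ c' (c.symm z)) y := by
  have h1 : ContMDiffAt 𝓘(ℝ, E) 𝓘(ℝ, E) ∞ c.symm y :=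
    contMDiffAt_symm_of_mem_maximalAtlas (IsManifold.subset_maximalAtlas hc) hy
  have h2 : ContMDiffAt 𝓘(ℝ, E) 𝓘(ℝ, E) ∞ c' (c.symm y) :=
    contMDiffAt_of_mem_maximalAtlas (IsManifold.subset_maximalAtlas hc') hy'
  exact (h2.comp y h1).contDiffAt

theorem bilinInChart_transition (hc : c ∈ atlas E M) (hc' : c' ∈ atlas E M) (hy : y ∈ c.target)
    (hy' : c.symm y ∈ c'.source) (T : BilinField E M) (u v : E) :
    bilinInChart c T y u v = bilinInChart c' T (c' (c.symm y))
      (fderiv ℝ (fun z ↦ c' (c.symm z)) y u) (fderiv ℝ (fun z ↦ c' (c.symm z)) y v) := by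
  -- The points `c'.symm (c' (c.symm y))` and `c.symm y` are equal only by a proof. Reading all
  -- tangent vectors in the model space `E` allows the base point to be rewritten.
  have h1 (p q : M) (h : p = q) (x z : E) :
      (T p : E →L[ℝ] E →L[ℝ] ℝ) x z = (T q : E →L[ℝ] E →L[ℝ] ℝ) x z := by rw [h]
  have h2 : (T (c.symm y) : E →L[ℝ] E →L[ℝ] ℝ) (frame c y u) (frame c y v) = _ :=
    h1 _ _ (c'.left_inv hy').symm _ _
  rw [frame_transition hc hc' hy hy' u, frame_transition hc hc' hy hy' v] at h2
  rw [bilinInChart_apply, bilinInChart_apply, ← h2, ← frame_transition hc hc' hy hy' u,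
    ← frame_transition hc hc' hy hy' v]

theorem covectorInChart_transition (hc : c ∈ atlas E M) (hc' : c' ∈ atlas E M) (hy : y ∈ c.target)
    (hy' : c.symm y ∈ c'.source) (l : CovectorField E M) (u : E) :
    covectorInChart c l y u = covectorInChart c' l (c' (c.symm y))
      (fderiv ℝ (fun z ↦ c' (c.symm z)) y u) := by
  have h1 (p q : M) (h : p = q) (x : E) :
      (l p : E →L[ℝ] ℝ) x = (l q : E →L[ℝ] ℝ) x := by rw [h]
  have h2 : (l (c.symm y) : E →L[ℝ] ℝ) (frame c y u) = _ :=
    h1 _ _ (c'.left_inv hy').symm _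
  rw [frame_transition hc hc' hy hy' u] at h2
  change (l (c.symm y) : E →L[ℝ] ℝ) (frame c y u) = (l (c'.symm (c' (c.symm y))) : E →L[ℝ] ℝ)
    (frame c' (c' (c.symm y)) _)
  rw [← h2, ← frame_transition hc hc' hy hy' u]

theorem surjective_transition (hc : c ∈ atlas E M) (hc' : c' ∈ atlas E M) (hy : y ∈ c.target)
    (hy' : c.symm y ∈ c'.source) :
    Function.Surjective (fderiv ℝ (fun z ↦ c' (c.symm z)) y) := by
  have ht : c' (c.symm y) ∈ c'.target := c'.map_source hy'
  intro v
  have h1 : Function.Surjective (frame c y) := fun v ↦ ⟨_, frame_coframe hc hy v⟩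
  obtain ⟨u, hu⟩ := h1 (frame c' (c' (c.symm y)) v : E)
  refine ⟨u, ?_⟩
  have h2 := frame_transition hc hc' hy hy' u
  have h3 := congrArg (coframe c' (c' (c.symm y)) : E →L[ℝ] E) (h2.symm.trans hu)
  have h4 := coframe_frame hc' ht v
  have h5 := coframe_frame hc' ht (fderiv ℝ (fun z ↦ c' (c.symm z)) y u)
  exact h5.symm.trans (h3.trans h4)

variable [FiniteDimensional ℝ E]

theorem bilinInChart_smooth {T : BilinField E M} (hT : SmoothBilin T) (hc : c ∈ atlas E M) :
    ContDiffOn ℝ ∞ (bilinInChart c T) c.target := by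
  simp_rw [contDiffOn_clm_apply]
  exact fun u v y hy ↦ (contDiffAt_bilinInChart hT hc hy u v).contDiffWithinAt

theorem covectorInChart_smooth {l : CovectorField E M} (hl : SmoothCovector l)
    (hc : c ∈ atlas E M) : ContDiffOn ℝ ∞ (covectorInChart c l) c.target := by
  simp_rw [contDiffOn_clm_apply]
  exact fun u y hy ↦ (contDiffAt_covectorInChart hl hc hy u).contDiffWithinAt

namespace KahlerStructure

variable (K : KahlerStructure E M)

omit [FiniteDimensional ℝ E] in
theorem isHermitianPair (hc : c ∈ atlas E M) (hy : y ∈ c.target) :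
    IsHermitianPair (bilinInChart c K.g y) (endInChart c K.J y) := by
  refine ⟨fun u v ↦ K.g_symm _ _ _, fun u hu ↦ ?_, fun u ↦ ?_, fun u v ↦ ?_⟩
  · have h1 : frame c y u = 0 := by
      refine K.g_nondegenerate _ _ fun v ↦ ?_
      have h2 := hu (coframe c y v)
      rwa [bilinInChart_apply, frame_coframe hc hy] at h2
    rw [← coframe_frame hc hy u, h1, map_zero]
  · rw [← coframe_frame hc hy (endInChart c K.J y _), endInChart_apply hc hy,
      endInChart_apply hc hy, K.J_sq, map_neg, coframe_frame hc hy]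
  · rw [bilinInChart_apply, endInChart_apply hc hy, endInChart_apply hc hy, K.g_hermitian,
      bilinInChart_apply]

/-- Smoothness is checked on the bilinear form `g(J ·, ·)`, whose components are scalar functions;
raising the index recovers `J`. -/
theorem endInChart_smooth (hc : c ∈ atlas E M) : ContDiffOn ℝ ∞ (endInChart c K.J) c.target := by
  have h1 : ContDiffOn ℝ ∞ (fun y ↦ bilinInChart c K.g y ∘L endInChart c K.J y) c.target := by
    simp_rw [contDiffOn_clm_apply]
    exact fun u v y hy ↦
      (contDiffAt_bilinInChart_end K.g_smooth K.J_smooth hc hy u v).contDiffWithinAt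
  refine (raise_smooth (bilinInChart_smooth K.g_smooth hc)
    (fun y hy ↦ K.isHermitianPair hc hy) h1).congr fun y hy ↦ ?_
  ext u
  refine (K.isHermitianPair hc hy).ext_left fun v ↦ ?_
  rw [raise_lower (K.isHermitianPair hc hy)]
  rfl

theorem isLocalKahler (hc : c ∈ atlas E M) :
    IsLocalKahler c.target (bilinInChart c K.g) (endInChart c K.J)
      (leviCivita (bilinInChart c K.g)) :=
  isLocalKahler_leviCivita c.open_target (bilinInChart_smooth K.g_smooth hc)
    (K.endInChart_smooth hc) (fun _ hy ↦ K.isHermitianPair hc hy) (K.J_parallel c hc)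

variable {K} in
theorem IsSolution.isLocalSolution {a : BilinField E M} {l : CovectorField E M}
    (S : K.IsSolution a l) (hc : c ∈ atlas E M) :
    IsLocalSolution c.target (bilinInChart c K.g) (endInChart c K.J)
      (leviCivita (bilinInChart c K.g)) (raise (bilinInChart c K.g) (bilinInChart c a))
      (raiseCovector (bilinInChart c K.g) (covectorInChart c l)) := by
  refine isLocalSolution_raise (K.isLocalKahler hc) (bilinInChart_smooth S.smooth_left hc)
    (covectorInChart_smooth S.smooth_right hc) (fun y _ u v ↦ S.symm _ _ _) (fun y hy u v ↦ ?_)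
    (S.equation c hc)
  rw [bilinInChart_apply, endInChart_apply hc hy, endInChart_apply hc hy, S.hermitian,
    bilinInChart_apply]

theorem covDerivCovector_transition {l : CovectorField E M} (hl : SmoothCovector l)
    (hc : c ∈ atlas E M) (hc' : c' ∈ atlas E M) (hy : y ∈ c.target)
    (hy' : c.symm y ∈ c'.source) (w u : E) :
    covDerivCovector (bilinInChart c K.g) (covectorInChart c l) y w u =
      covDerivCovector (bilinInChart c' K.g) (covectorInChart c' l) (c' (c.symm y))
        (fderiv ℝ (fun z ↦ c' (c.symm z)) y w) (fderiv ℝ (fun z ↦ c' (c.symm z)) y u) := by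
  have ht : c' (c.symm y) ∈ c'.target := c'.map_source hy'
  have hev : ∀ᶠ z in 𝓝 y, z ∈ c.target ∧ c.symm z ∈ c'.source :=
    (c.open_target.eventually_mem hy).and
      ((c.continuousAt_symm hy).eventually (c'.open_source.mem_nhds hy'))
  exact covDerivCovector_comp (φ := fun z ↦ c' (c.symm z)) (contDiffAt_transition hc hc' hy hy')
    (K.isHermitianPair hc hy) (K.isHermitianPair hc' ht)
    (ContDiffOn.differentiableAt_of_isOpen (bilinInChart_smooth K.g_smooth hc) c.open_target hy)
    (ContDiffOn.differentiableAt_of_isOpen (bilinInChart_smooth K.g_smooth hc') c'.open_target ht)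
    (ContDiffOn.differentiableAt_of_isOpen (covectorInChart_smooth hl hc') c'.open_target ht)
    (hev.mono fun z hz ↦ bilinInChart_transition hc hc' hz.1 hz.2 K.g)
    (hev.mono fun z hz ↦ covectorInChart_transition hc hc' hz.1 hz.2 l)
    (surjective_transition hc hc' hy hy') w u

/-- The equation `λ_{i,j} = m g_{ij} + B a_{ij}` at a point, in the chart `c`. -/
def HessianAt (c : OpenPartialHomeomorph M E) (a : BilinField E M) (l : CovectorField E M)
    (B m : ℝ) (y : E) : Prop :=
  ∀ u v : E, covDerivCovector (bilinInChart c K.g) (covectorInChart c l) y v u =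
    m * bilinInChart c K.g y u v + B * bilinInChart c a y u v

theorem HessianAt.transition {a : BilinField E M} {l : CovectorField E M} (hl : SmoothCovector l)
    {B m : ℝ} (hc : c ∈ atlas E M) (hc' : c' ∈ atlas E M) (hy : y ∈ c.target)
    (hy' : c.symm y ∈ c'.source) (H : K.HessianAt c' a l B m (c' (c.symm y))) :
    K.HessianAt c a l B m y := by
  intro u v
  rw [K.covDerivCovector_transition hl hc hc' hy hy', H,
    bilinInChart_transition hc hc' hy hy' K.g, bilinInChart_transition hc hc' hy hy' a]

variable {K} in
-- The dictionary between the chart-independent tensor equation, used to compare charts, and the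
-- operator equation used in the local analysis.
theorem IsSolution.hessianAt_iff {a : BilinField E M} {l : CovectorField E M}
    (S : K.IsSolution a l) (hc : c ∈ atlas E M) (hy : y ∈ c.target) {B m : ℝ} :
    K.HessianAt c a l B m y ↔ covDerivVector (leviCivita (bilinInChart c K.g))
      (raiseCovector (bilinInChart c K.g) (covectorInChart c l)) y =
        B • raise (bilinInChart c K.g) (bilinInChart c a) y + m • 1 := by
  have hp := K.isHermitianPair hc hy
  have one (v : E) : (1 : E →L[ℝ] E) v = v := rfl
  have hs (u v : E) : bilinInChart c a y u v = bilinInChart c a y v u := S.symm _ _ _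
  constructor
  · intro h
    ext u
    refine hp.ext_left fun v ↦ ?_
    rw [← covDerivCovector_eq (K.isLocalKahler hc) (covectorInChart_smooth S.smooth_right hc) hy, h]
    simp only [add_apply, smul_apply, map_add, map_smul, raise_lower hp, one, smul_eq_mul]
    rw [hp.symm v u, hs v u]
    ring
  · intro h u v
    rw [covDerivCovector_eq (K.isLocalKahler hc) (covectorInChart_smooth S.smooth_right hc) hy, h]
    simp only [add_apply, smul_apply, map_add, map_smul, raise_lower hp, one, smul_eq_mul]
    rw [hp.symm v u, hs v u]
    ring

end KahlerStructure

end Charts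
end Kahler
end

noncomputable section

namespace Kahler

/-! ### Global arguments -/

namespace KahlerStructure

open Filter Topology

set_option synthInstance.maxHeartbeats 400000
set_option maxSynthPendingDepth 3

variable {E : Type*} [NormedAddCommGroup E] [NormedSpace ℝ E]
  {M : Type*} [TopologicalSpace M] [ChartedSpace E M] [IsManifold 𝓘(ℝ, E) ∞ M]
  {K : KahlerStructure E M} {c c' : OpenPartialHomeomorph M E} {y : E}
  {a A : BilinField E M} {l L : CovectorField E M}

/-- The endomorphism field corresponding to a bilinear form, in a chart. -/
abbrev endo (K : KahlerStructure E M) (c : OpenPartialHomeomorph M E) (a : BilinField E M) :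
    E → E →L[ℝ] E :=
  raise (bilinInChart c K.g) (bilinInChart c a)

/-- The vector field corresponding to a `1`-form, in a chart. -/
abbrev vec (K : KahlerStructure E M) (c : OpenPartialHomeomorph M E) (l : CovectorField E M) :
    E → E :=
  raiseCovector (bilinInChart c K.g) (covectorInChart c l)

/-- The Levi-Civita connection in a chart. -/
abbrev conn (K : KahlerStructure E M) (c : OpenPartialHomeomorph M E) :
    E → E →L[ℝ] E →L[ℝ] E :=
  leviCivita (bilinInChart c K.g)

omit [NormedSpace ℝ E] [ChartedSpace E M] [IsManifold 𝓘(ℝ, E) ∞ M] in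
theorem eventually_symm_iff (P : M → Prop) (hy : y ∈ c.target) :
    (∀ᶠ z in 𝓝 y, P (c.symm z)) ↔ ∀ᶠ q in 𝓝 (c.symm y), P q := by
  have h := c.eventually_nhds' P (c.map_target hy)
  rwa [c.right_inv hy] at h

omit [NormedSpace ℝ E] [ChartedSpace E M] [IsManifold 𝓘(ℝ, E) ∞ M] in
theorem frequently_symm_iff (P : M → Prop) (hy : y ∈ c.target) :
    (∃ᶠ z in 𝓝 y, P (c.symm z)) ↔ ∃ᶠ q in 𝓝 (c.symm y), P q :=
  not_congr (eventually_symm_iff (fun q ↦ ¬P q) hy)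

theorem endo_add (K : KahlerStructure E M) (c : OpenPartialHomeomorph M E) (a A : BilinField E M)
    (y : E) : K.endo c (a + A) y = K.endo c a y + K.endo c A y := by
  rw [endo, raise, bilinInChart_add, ContinuousLinearMap.comp_add]
  rfl

theorem endo_smul (K : KahlerStructure E M) (c : OpenPartialHomeomorph M E) (r : ℝ)
    (a : BilinField E M) (y : E) : K.endo c (r • a) y = r • K.endo c a y := by
  rw [endo, raise, bilinInChart_smul, ContinuousLinearMap.comp_smul]
  rfl

theorem vec_add (K : KahlerStructure E M) (c : OpenPartialHomeomorph M E) (l L : CovectorField E M)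
    (y : E) : K.vec c (l + L) y = K.vec c l y + K.vec c L y :=
  map_add (bilinInChart c K.g y).inverse (covectorInChart c l y) (covectorInChart c L y)

theorem vec_smul (K : KahlerStructure E M) (c : OpenPartialHomeomorph M E) (r : ℝ)
    (l : CovectorField E M) (y : E) : K.vec c (r • l) y = r • K.vec c l y :=
  map_smul (bilinInChart c K.g y).inverse r (covectorInChart c l y)

variable [FiniteDimensional ℝ E]

theorem endo_metric (K : KahlerStructure E M) (hc : c ∈ atlas E M) (hy : y ∈ c.target) :
    K.endo c K.g y = 1 := by
  have hp := K.isHermitianPair hc hy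
  ext u
  refine hp.ext_left fun v ↦ ?_
  rw [raise_lower hp]
  rfl

theorem endo_eq_zero_iff (hc : c ∈ atlas E M) (hy : y ∈ c.target) :
    K.endo c a y = 0 ↔ a (c.symm y) = 0 := by
  have hp := K.isHermitianPair hc hy
  constructor
  · intro h
    ext u v
    have h1 : bilinInChart c a y (coframe c y u) (coframe c y v) = 0 := by
      rw [← raise_lower hp, show raise (bilinInChart c K.g) (bilinInChart c a) y = 0 from h]
      simp
    rwa [bilinInChart_apply, frame_coframe hc hy, frame_coframe hc hy] at h1
  · intro h
    ext u
    refine hp.ext_left fun v ↦ ?_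
    rw [raise_lower hp, bilinInChart_apply, h]
    simp

theorem vec_eq_zero_iff (hc : c ∈ atlas E M) (hy : y ∈ c.target) :
    K.vec c l y = 0 ↔ l (c.symm y) = 0 := by
  have hp := K.isHermitianPair hc hy
  constructor
  · intro h
    ext u
    have h1 := raiseCovector_lower (ℓ := covectorInChart c l) hp (coframe c y u)
    rw [show raiseCovector (bilinInChart c K.g) (covectorInChart c l) y = 0 from h] at h1
    have h2 : covectorInChart c l y (coframe c y u) = l (c.symm y) (frame c y (coframe c y u)) :=
      rfl
    rw [h2, frame_coframe hc hy] at h1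
    simpa using h1.symm
  · intro h
    refine hp.nondeg _ fun v ↦ ?_
    rw [raiseCovector_lower hp, covectorInChart, h]
    simp

theorem isSolution_metric (K : KahlerStructure E M) : K.IsSolution K.g (fun _ ↦ 0) where
  smooth_left := K.g_smooth
  smooth_right := K.isSolution_zero.smooth_right
  symm := K.g_symm
  hermitian := K.g_hermitian
  equation := by
    intro c hc y hy u v w
    have h0 (z : E) : covectorInChart c (fun _ ↦ 0 : CovectorField E M) y z = 0 := rfl
    have hK := K.isLocalKahler hc
    have hd := ContDiffOn.differentiableAt_of_isOpen hK.metric_smooth hK.isOpen hy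
    have h1 : fderiv ℝ (fun z ↦ bilinInChart c K.g z u v) y w
        = fderiv ℝ (bilinInChart c K.g) y w u v := by
      rw [fderiv_apply_apply (hd.clm_apply (differentiableAt_const u)) (differentiableAt_const _),
        fderiv_const_apply', fderiv_apply_apply hd (differentiableAt_const _), fderiv_const_apply']
      simp
    rw [covDerivBilin, h1, christoffel_eq hd, christoffel_eq hd, hK.metric_parallel y hy]
    simp only [h0]
    ring

theorem IsSolution.combination (S : K.IsSolution a l) (S' : K.IsSolution A L) (r s t : ℝ) :
    K.IsSolution (r • K.g + s • a + t • A) (s • l + t • L) := by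
  have h := ((K.isSolution_metric.smul r).add (S.smul s)).add (S'.smul t)
  have h1 : r • (fun _ ↦ 0 : CovectorField E M) + s • l = s • l := by
    ext p v
    simp
  rwa [h1] at h

theorem endo_combination (hc : c ∈ atlas E M) (hy : y ∈ c.target) (r s t : ℝ) :
    K.endo c (r • K.g + s • a + t • A) y = r • 1 + s • K.endo c a y + t • K.endo c A y := by
  rw [endo_add, endo_add, endo_smul, endo_smul, endo_smul, endo_metric K hc hy]

theorem tr_covDerivVector_combination (S : K.IsSolution a l) (S' : K.IsSolution A L)
    (hc : c ∈ atlas E M) (hy : y ∈ c.target) (s t : ℝ) :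
    tr E (covDerivVector (K.conn c) (K.vec c (s • l + t • L)) y) =
      s * tr E (covDerivVector (K.conn c) (K.vec c l) y)
        + t * tr E (covDerivVector (K.conn c) (K.vec c L) y) := by
  have d1 : DifferentiableAt ℝ (K.vec c l) y :=
    ContDiffOn.differentiableAt_of_isOpen (S.isLocalSolution hc).right_smooth c.open_target hy
  have d2 : DifferentiableAt ℝ (K.vec c L) y :=
    ContDiffOn.differentiableAt_of_isOpen (S'.isLocalSolution hc).right_smooth c.open_target hy
  have h1 : K.vec c (s • l + t • L) = fun z ↦ s • K.vec c l z + t • K.vec c L z := by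
    ext1 z
    rw [vec_add, vec_smul, vec_smul]
  have h2 : covDerivVector (K.conn c) (K.vec c (s • l + t • L)) y =
      s • covDerivVector (K.conn c) (K.vec c l) y
        + t • covDerivVector (K.conn c) (K.vec c L) y := by
    ext w
    simp only [covDerivVector_apply, add_apply, smul_apply]
    rw [h1, fderiv_fun_add (d1.fun_const_smul s) (d2.fun_const_smul t), fderiv_fun_const_smul d1,
      fderiv_fun_const_smul d2]
    simp only [add_apply, smul_apply, map_add, map_smul]
    module
  rw [h2, map_add, map_smul, map_smul, smul_eq_mul, smul_eq_mul]

/-! ### Unique continuation and the constant on a connected manifold. -/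

section Connected

variable [ConnectedSpace M]

/-- Unique continuation for the h-projective equation. -/
theorem IsSolution.eq_zero_of_eventually (S : K.IsSolution a l) (hE : 3 < Module.finrank ℝ E)
    {p : M} (H : ∀ᶠ q in 𝓝 p, a q = 0) (q : M) : a q = 0 := by
  have hopen : IsOpen {p | ∀ᶠ q in 𝓝 p, a q = 0} :=
    isOpen_iff_eventually.mpr fun x hx ↦ eventually_eventually_nhds.mpr hx
  -- At a limit point, `a`, `lam` and `∇ lam` vanish by continuity, and the local continuation
  -- result applies there.
  have hclosed : IsClosed {p | ∀ᶠ q in 𝓝 p, a q = 0} := by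
    rw [isClosed_iff_frequently]
    intro x hx
    set c := chartAt E x with hcdef
    have hc : c ∈ atlas E M := chart_mem_atlas E x
    have hy : c x ∈ c.target := c.map_source (mem_chart_source E x)
    have hx' : c.symm (c x) = x := c.left_inv (mem_chart_source E x)
    rw [← hx'] at hx ⊢
    generalize c x = y at hx hy ⊢
    have hK := K.isLocalKahler hc
    have hS := S.isLocalSolution hc
    have h1 := (frequently_symm_iff _ hy).mpr hx
    have h2 : ∃ᶠ z in 𝓝 y, K.endo c a z = 0 ∧ K.vec c l z = 0 ∧
        covDerivVector (K.conn c) (K.vec c l) z = 0 := by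
      refine (h1.and_eventually (c.open_target.eventually_mem hy)).mono ?_
      rintro z ⟨hz, hzt⟩
      have h3 : ∀ᶠ x in 𝓝 z, K.endo c a x = 0 := by
        filter_upwards [(eventually_symm_iff _ hzt).mpr hz, c.open_target.mem_nhds hzt] with x h4 h5
        exact (endo_eq_zero_iff hc h5).mpr h4
      exact ⟨h3.self_of_nhds, hS.eq_zero_of_eventually hK hzt h3⟩
    have e1 : K.endo c a y = 0 := tendsto_nhds_unique_of_frequently_eq
      (continuousAt_of_contDiffOn hS.left_smooth hK.isOpen hy) tendsto_const_nhds
      (h2.mono fun _ h ↦ h.1)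
    have e2 : K.vec c l y = 0 := tendsto_nhds_unique_of_frequently_eq
      (continuousAt_of_contDiffOn hS.right_smooth hK.isOpen hy) tendsto_const_nhds
      (h2.mono fun _ h ↦ h.2.1)
    have e3 : covDerivVector (K.conn c) (K.vec c l) y = 0 := tendsto_nhds_unique_of_frequently_eq
      (continuousAt_of_contDiffOn (hS.covDerivVector_smooth hK) hK.isOpen hy) tendsto_const_nhds
      (h2.mono fun _ h ↦ h.2.2)
    have h3 := hS.eventually_eq_zero hK (by omega) hy e1 e2 (by rw [e3, map_zero])
    refine (eventually_symm_iff _ hy).mp ?_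
    filter_upwards [h3, c.open_target.mem_nhds hy] with z h4 h5
    exact (endo_eq_zero_iff hc h5).mp h4
  have huniv := IsClopen.eq_univ ⟨hclosed, hopen⟩ ⟨p, H⟩
  have hq : q ∈ {p | ∀ᶠ q in 𝓝 p, a q = 0} := huniv ▸ Set.mem_univ q
  exact mem_of_mem_nhds (s := {q | a q = 0}) hq

theorem IsSolution.eq_zero_of_endo_eventually (S : K.IsSolution a l)
    (hE : 3 < Module.finrank ℝ E) (hc : c ∈ atlas E M) (hy : y ∈ c.target)
    (H : ∀ᶠ z in 𝓝 y, K.endo c a z = 0) (q : M) : a q = 0 := by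
  refine S.eq_zero_of_eventually hE ((eventually_symm_iff _ hy).mp ?_) q
  filter_upwards [H, c.open_target.mem_nhds hy] with z h4 h5
  exact (endo_eq_zero_iff hc h5).mp h4

theorem IsSolution.eq_zero_of_data (S : K.IsSolution a l) (hE : 3 < Module.finrank ℝ E)
    (hc : c ∈ atlas E M) (hy : y ∈ c.target) (ha : K.endo c a y = 0) (hl : K.vec c l y = 0)
    (ht : tr E (covDerivVector (K.conn c) (K.vec c l) y) = 0) (q : M) : a q = 0 :=
  S.eq_zero_of_endo_eventually hE hc hy
    ((S.isLocalSolution hc).eventually_eq_zero (K.isLocalKahler hc) (by omega) hy ha hl ht) q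

omit [ConnectedSpace M] in
theorem IsSolution.right_eq_zero (S : K.IsSolution a l) (H : ∀ q, a q = 0) (q : M) : l q = 0 := by
  have hc := chart_mem_atlas E q
  have hy := (chartAt E q).map_source (mem_chart_source E q)
  have h := ((S.isLocalSolution hc).eq_zero_of_eventually (K.isLocalKahler hc) hy (by
    filter_upwards [(chartAt E q).open_target.mem_nhds hy] with z hz
    exact (endo_eq_zero_iff hc hz).mpr (H _))).1
  rw [← (chartAt E q).left_inv (mem_chart_source E q)]
  exact (vec_eq_zero_iff hc hy).mp h

/-- Linear independence of two tensors together with the metric. -/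
def IsGenericPair (K : KahlerStructure E M) (a A : BilinField E M) : Prop :=
  ∀ r s t : ℝ, (∀ p, (r • K.g + s • a + t • A) p = 0) → r = 0 ∧ s = 0 ∧ t = 0

omit [FiniteDimensional ℝ E] [ConnectedSpace M] in
theorem IsGenericPair.symm (h : K.IsGenericPair a A) : K.IsGenericPair A a := by
  intro r s t H
  obtain ⟨h1, h2, h3⟩ := h r t s fun p ↦ by
    rw [← H p, add_right_comm]
  exact ⟨h1, h3, h2⟩

/-- Pointwise dependence on an open set would give a nontrivial relation with constant coefficients
near some point, and unique continuation would spread it over the whole manifold. -/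
theorem IsGenericPair.frequently_linearIndependent (h : K.IsGenericPair a A)
    (S : K.IsSolution a l) (S' : K.IsSolution A L) (hE : 3 < Module.finrank ℝ E)
    (hc : c ∈ atlas E M) (hy : y ∈ c.target) :
    ∃ᶠ z in 𝓝 y, LinearIndependent ℝ ![1, K.endo c a z, K.endo c A z] := by
  intro hn
  obtain ⟨d, hd, x, hx, H⟩ := (S.isLocalSolution hc).exists_dependent (K.isLocalKahler hc)
    (S'.isLocalSolution hc) hE hy hn
  obtain ⟨h0, h1, h2⟩ := h (d 0) (d 1) (d 2)
    ((S.combination S' (d 0) (d 1) (d 2)).eq_zero_of_endo_eventually hE hc hx (by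
      filter_upwards [H, c.open_target.mem_nhds hx] with z h3 h4
      rw [endo_combination hc h4]
      exact h3))
  refine hd ?_
  ext i
  fin_cases i
  exacts [h0, h1, h2]

theorem IsGenericPair.exists_isExtendedAt (h : K.IsGenericPair a A)
    (S : K.IsSolution a l) (S' : K.IsSolution A L) (hE : 3 < Module.finrank ℝ E)
    (hc : c ∈ atlas E M) (hy : y ∈ c.target) :
    ∃ B, ∀ᶠ z in 𝓝 y,
      IsExtendedAt (bilinInChart c K.g) (K.conn c) (K.endo c a) (K.vec c l) B z ∧
      IsExtendedAt (bilinInChart c K.g) (K.conn c) (K.endo c A) (K.vec c L) B z := by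
  have : Nontrivial E := Module.nontrivial_of_finrank_pos (R := ℝ) (by omega)
  have hK := K.isLocalKahler hc
  have hS := S.isLocalSolution hc
  have hS' := S'.isLocalSolution hc
  have hd : ∀ᶠ z in 𝓝 y, ∃ᶠ x in 𝓝 z, LinearIndependent ℝ ![1, K.endo c a x, K.endo c A x] :=
    (c.open_target.eventually_mem hy).mono fun z hz ↦ h.frequently_linearIndependent S S' hE hc hz
  have hd' : ∀ᶠ z in 𝓝 y, ∃ᶠ x in 𝓝 z, LinearIndependent ℝ ![1, K.endo c A x, K.endo c a x] :=
    (c.open_target.eventually_mem hy).mono fun z hz ↦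
      h.symm.frequently_linearIndependent S' S hE hc hz
  by_cases h1 : LinearIndependent ℝ ![1, K.endo c a y] ∨ K.vec c l y ≠ 0
  · exact hS.exists_isExtendedAt_of_dense hK hS' hE hy hd h1
  by_cases h2 : LinearIndependent ℝ ![1, K.endo c A y] ∨ K.vec c L y ≠ 0
  · obtain ⟨B, hB⟩ := hS'.exists_isExtendedAt_of_dense hK hS hE hy hd' h2
    exact ⟨B, hB.mono fun _ h ↦ h.symm⟩
  -- Now both tensors are multiples of the metric at the point and both 1-forms vanish there, so
  -- modulo the metric the only remaining data are the traces `ν` and `ν'`.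
  exfalso
  rw [not_or, not_not] at h1 h2
  obtain ⟨r, hr⟩ := exists_eq_smul_of_not_linearIndependent one_ne_zero h1.1
  obtain ⟨s, hs⟩ := exists_eq_smul_of_not_linearIndependent one_ne_zero h2.1
  set ν := tr E (covDerivVector (K.conn c) (K.vec c l) y) with hν
  set ν' := tr E (covDerivVector (K.conn c) (K.vec c L) y) with hν'
  have key (x z : ℝ) (hxz : x * ν + z * ν' = 0) : x = 0 ∧ z = 0 := by
    refine (h (-(x * r + z * s)) x z ((S.combination S' (-(x * r + z * s)) x z).eq_zero_of_data hE
      hc hy ?_ ?_ ?_)).2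
    · rw [endo_combination hc hy, hr, hs]
      module
    · rw [vec_add, vec_smul, vec_smul, h1.2, h2.2]
      simp
    · rw [tr_covDerivVector_combination S S' hc hy]
      exact hxz
  -- Two numbers are always linearly related: the combination with coefficients `ν'` and `-ν` has
  -- zero data, so `ν = 0`. Then the first solution alone, corrected by the metric, has zero data.
  obtain ⟨-, h3⟩ := key ν' (-ν) (by ring)
  exact one_ne_zero (key 1 0 (by rw [neg_eq_zero.mp h3]; ring)).1

/-- At a nearby point where `1, a, A` are independent, the two Hessian equations are compared in one
chart; independence of `1` and `a` identifies the factors. -/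
theorem IsGenericPair.factor_unique (h : K.IsGenericPair a A)
    (S : K.IsSolution a l) (S' : K.IsSolution A L) (hE : 3 < Module.finrank ℝ E)
    (hc : c ∈ atlas E M) (hc' : c' ∈ atlas E M) (hy : y ∈ c.target) (hy' : c.symm y ∈ c'.source)
    {B B' : ℝ} (H : ∀ᶠ z in 𝓝 y,
      IsExtendedAt (bilinInChart c K.g) (K.conn c) (K.endo c a) (K.vec c l) B z)
    (H' : ∀ᶠ z in 𝓝 (c' (c.symm y)),
      IsExtendedAt (bilinInChart c' K.g) (K.conn c') (K.endo c' a) (K.vec c' l) B' z) :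
    B = B' := by
  have hcont : ContinuousAt (fun z ↦ c' (c.symm z)) y :=
    (contDiffAt_transition hc hc' hy hy').continuousAt
  obtain ⟨z, hz, h1, h2, h3, h4⟩ := ((h.frequently_linearIndependent S S' hE hc hy).and_eventually
    (H.and ((hcont.eventually H').and ((c.open_target.eventually_mem hy).and
      ((c.continuousAt_symm hy).eventually (c'.open_source.mem_nhds hy')))))).exists
  have h5 := (S.hessianAt_iff hc h3).mp (HessianAt.transition K S.smooth_right hc hc' h3 h4
    ((S.hessianAt_iff hc' (c'.map_source h4)).mpr h2.1))
  have h6 := h1.1.symm.trans h5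
  have h7 := LinearIndependent.pair_iff.mp (linearIndependent_pair_of_triple hz)
    (scalarPart (K.conn c) (K.endo c a) (K.vec c l) B z
      - scalarPart (K.conn c') (K.endo c' a) (K.vec c' l) B' (c' (c.symm z))) (B - B') (by
      rw [← sub_eq_zero] at h6
      rw [← h6]
      module)
  exact sub_eq_zero.mp h7.2

/-- The constant of the extended system does not depend on the point. -/
theorem IsGenericPair.exists_constant (h : K.IsGenericPair a A)
    (S : K.IsSolution a l) (S' : K.IsSolution A L) (hE : 3 < Module.finrank ℝ E) :
    ∃ B, ∀ c ∈ atlas E M, ∀ y ∈ c.target,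
      IsExtendedAt (bilinInChart c K.g) (K.conn c) (K.endo c a) (K.vec c l) B y ∧
      IsExtendedAt (bilinInChart c K.g) (K.conn c) (K.endo c A) (K.vec c L) B y := by
  let P (c : OpenPartialHomeomorph M E) (y : E) (B : ℝ) : Prop := ∀ᶠ z in 𝓝 y,
      IsExtendedAt (bilinInChart c K.g) (K.conn c) (K.endo c a) (K.vec c l) B z ∧
      IsExtendedAt (bilinInChart c K.g) (K.conn c) (K.endo c A) (K.vec c L) B z
  have hex (p : M) : ∃ B, P (chartAt E p) (chartAt E p p) B :=
    h.exists_isExtendedAt S S' hE (chart_mem_atlas E p)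
      ((chartAt E p).map_source (mem_chart_source E p))
  choose β hβ using hex
  have hcmp {p : M} {c : OpenPartialHomeomorph M E} (hc : c ∈ atlas E M) (hp : p ∈ c.source)
      {B : ℝ} (hB : P c (c p) B) : B = β p := by
    have hl : c.symm (c p) = p := c.left_inv hp
    refine h.factor_unique S S' hE hc (chart_mem_atlas E p) (c.map_source hp)
      (by rw [hl]; exact mem_chart_source E p) (hB.mono fun _ h ↦ h.1) ?_
    rw [hl]
    exact (hβ p).mono fun _ h ↦ h.1
  have hloc : IsLocallyConstant β := by
    rw [IsLocallyConstant.iff_eventually_eq]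
    intro p
    have h1 := ((chartAt E p).continuousAt (mem_chart_source E p)).eventually
      (eventually_eventually_nhds.mpr (hβ p))
    filter_upwards [h1, (chartAt E p).open_source.mem_nhds (mem_chart_source E p)] with q h2 h3
    exact (hcmp (chart_mem_atlas E p) h3 h2).symm
  obtain ⟨p⟩ : Nonempty M := inferInstance
  refine ⟨β p, fun c hc y hy ↦ ?_⟩
  obtain ⟨B, hB⟩ := h.exists_isExtendedAt S S' hE hc hy
  have h1 : B = β (c.symm y) := hcmp hc (c.map_target hy) (by rw [c.right_inv hy]; exact hB)
  rw [hloc.apply_eq_of_preconnectedSpace p (c.symm y), ← h1]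
  exact hB.self_of_nhds

omit [FiniteDimensional ℝ E] [ConnectedSpace M] in
theorem contMDiffAt_of_chart {f : M → ℝ} {m : E → ℝ} (hc : c ∈ atlas E M)
    (hm : ContDiffOn ℝ ∞ m c.target) (hf : ∀ y ∈ c.target, f (c.symm y) = m y) {p : M}
    (hp : p ∈ c.source) : ContMDiffAt 𝓘(ℝ, E) 𝓘(ℝ, ℝ) ∞ f p := by
  have h1 : f =ᶠ[𝓝 p] m ∘ c := by
    filter_upwards [c.open_source.mem_nhds hp] with q hq
    rw [Function.comp_apply, ← hf _ (c.map_source hq), c.left_inv hq]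
  have h2 : ContMDiffAt 𝓘(ℝ, E) 𝓘(ℝ, ℝ) ∞ m (c p) :=
    (hm.contDiffAt (c.open_target.mem_nhds (c.map_source hp))).contMDiffAt
  exact (h2.comp p (contMDiffAt_of_mem_maximalAtlas (IsManifold.subset_maximalAtlas hc)
    hp)).congr_of_eventuallyEq h1

omit [FiniteDimensional ℝ E] [ConnectedSpace M] in
theorem mvfderiv_of_chart {f : M → ℝ} {m : E → ℝ} (hc : c ∈ atlas E M)
    (hm : ContDiffOn ℝ ∞ m c.target) (hf : ∀ y ∈ c.target, f (c.symm y) = m y) (hy : y ∈ c.target)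
    (v : TangentSpace 𝓘(ℝ, E) (c.symm y)) :
    mvfderiv 𝓘(ℝ, E) f (c.symm y) v = fderiv ℝ m y (coframe c y v) := by
  have hp := c.map_target hy
  have h1 : f =ᶠ[𝓝 (c.symm y)] m ∘ c := by
    filter_upwards [c.open_source.mem_nhds hp] with q hq
    rw [Function.comp_apply, ← hf _ (c.map_source hq), c.left_inv hq]
  have d1 : MDifferentiableAt 𝓘(ℝ, E) 𝓘(ℝ, ℝ) m (c (c.symm y)) := by
    rw [c.right_inv hy]
    exact (ContDiffOn.differentiableAt_of_isOpen hm c.open_target hy).mdifferentiableAt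
  have d2 : MDifferentiableAt 𝓘(ℝ, E) 𝓘(ℝ, E) c (c.symm y) :=
    (contMDiffAt_of_mem_maximalAtlas (n := ∞) (IsManifold.subset_maximalAtlas hc)
      hp).mdifferentiableAt (by simp)
  have h2 := h1.mfderiv_eq.trans (mfderiv_comp (c.symm y) d1 d2)
  rw [mfderiv_eq_fderiv, c.right_inv hy] at h2
  exact congrArg (fun T : E →L[ℝ] ℝ ↦ T v) h2

omit [ConnectedSpace M] in
-- The Hessian equation is tensorial and determines its scalar part once `B` is fixed, so the
-- chartwise scalar parts agree on overlaps.
theorem IsSolution.exists_scalarPart [Nontrivial E] (S : K.IsSolution a l) {B : ℝ}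
    (H : ∀ c ∈ atlas E M, ∀ y ∈ c.target, covDerivVector (K.conn c) (K.vec c l) y =
      B • K.endo c a y + scalarPart (K.conn c) (K.endo c a) (K.vec c l) B y • 1) :
    ∃ μ : M → ℝ, ∀ c ∈ atlas E M, ∀ y ∈ c.target,
      μ (c.symm y) = scalarPart (K.conn c) (K.endo c a) (K.vec c l) B y := by
  have h1 {c c' : OpenPartialHomeomorph M E} (hc : c ∈ atlas E M) (hc' : c' ∈ atlas E M) {y : E}
      (hy : y ∈ c.target) (hy' : c.symm y ∈ c'.source) :
      scalarPart (K.conn c) (K.endo c a) (K.vec c l) B y =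
        scalarPart (K.conn c') (K.endo c' a) (K.vec c' l) B (c' (c.symm y)) := by
    have h2 := (S.hessianAt_iff hc' (c'.map_source hy')).mpr (H c' hc' _ (c'.map_source hy'))
    exact scalarPart_eq ((S.hessianAt_iff hc hy).mp
      (HessianAt.transition K S.smooth_right hc hc' hy hy' h2))
  exact ⟨fun p ↦ scalarPart (K.conn (chartAt E p)) (K.endo (chartAt E p) a)
    (K.vec (chartAt E p) l) B (chartAt E p p), fun c hc y hy ↦
      (h1 hc (chart_mem_atlas E _) hy (mem_chart_source E _)).symm⟩

omit [ConnectedSpace M] in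
/-- Local solutions of the extended system with the same constant fit together. -/
theorem IsSolution.exists_isExtendedSolution [Nontrivial E] (S : K.IsSolution a l) {B : ℝ}
    (H : ∀ c ∈ atlas E M, ∀ y ∈ c.target,
      IsExtendedAt (bilinInChart c K.g) (K.conn c) (K.endo c a) (K.vec c l) B y) :
    ∃ μ : M → ℝ, K.IsExtendedSolution a l μ B := by
  obtain ⟨μ, hμ⟩ := S.exists_scalarPart fun c hc y hy ↦ (H c hc y hy).1
  have hm {c : OpenPartialHomeomorph M E} (hc : c ∈ atlas E M) :
      ContDiffOn ℝ ∞ (scalarPart (K.conn c) (K.endo c a) (K.vec c l) B) c.target :=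
    (S.isLocalSolution hc).scalarPart_smooth (K.isLocalKahler hc) B
  refine ⟨μ, S, fun p ↦ ?_, fun c hc y hy ↦ ?_, fun p v ↦ ?_⟩
  · exact contMDiffAt_of_chart (chart_mem_atlas E p) (hm (chart_mem_atlas E p))
      (fun y hy ↦ hμ _ (chart_mem_atlas E p) y hy) (mem_chart_source E p)
  · rw [hμ c hc y hy]
    exact (S.hessianAt_iff hc hy).mpr (H c hc y hy).1
  · have hgrad {c : OpenPartialHomeomorph M E} (hc : c ∈ atlas E M) {y : E} (hy : y ∈ c.target)
        (v : TangentSpace 𝓘(ℝ, E) (c.symm y)) :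
        mvfderiv 𝓘(ℝ, E) μ (c.symm y) v = 2 * B * l (c.symm y) v := by
      have h3 : covectorInChart c l y (coframe c y v) = l (c.symm y) (frame c y (coframe c y v)) :=
        rfl
      rw [mvfderiv_of_chart hc (hm hc) (hμ c hc) hy, (H c hc y hy).2,
        raiseCovector_lower (K.isHermitianPair hc hy), h3, frame_coframe hc hy]
    have h1 := hgrad (chart_mem_atlas E p) ((chartAt E p).map_source (mem_chart_source E p))
    rw [(chartAt E p).left_inv (mem_chart_source E p)] at h1
    exact h1 v

/-- The constant of the extended system is unique, unless `a` is a multiple of the metric. -/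
theorem IsExtendedSolution.factor_unique (hE : 3 < Module.finrank ℝ E) {μ μ' : M → ℝ} {B B' : ℝ}
    (H : K.IsExtendedSolution a l μ B) (H' : K.IsExtendedSolution a l μ' B')
    (hne : ¬∃ k : ℝ, ∀ p, a p = k • K.g p) : B' = B := by
  by_contra hB
  have hB' : B - B' ≠ 0 := sub_ne_zero.mpr (Ne.symm hB)
  have S := H.isSolution
  obtain ⟨p⟩ : Nonempty M := inferInstance
  have hc := chart_mem_atlas E p
  have hy := (chartAt E p).map_source (mem_chart_source E p)
  -- Subtracting the two Hessian equations gives `(μ - μ') g + (B - B') a = 0`, so `a` is pointwise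
  -- proportional to the metric. The factor is locally constant, and unique continuation makes the
  -- proportionality global.
  obtain ⟨r, hr⟩ := (S.isLocalSolution hc).eventually_eq_smul_one (K.isLocalKahler hc) hE hy (by
    filter_upwards [(chartAt E p).open_target.mem_nhds hy] with z hz hi
    have h1 := (S.hessianAt_iff hc hz).mp (H.hessian _ hc z hz)
    have h2 := (S.hessianAt_iff hc hz).mp (H'.hessian _ hc z hz)
    have h3 := h1.symm.trans h2
    rw [← sub_eq_zero] at h3
    refine hB' (LinearIndependent.pair_iff.mp hi (μ ((chartAt E p).symm z)
      - μ' ((chartAt E p).symm z)) (B - B') ?_).2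
    rw [← h3]
    module)
  refine hne ⟨r, fun q ↦ ?_⟩
  have h1 := (S.combination S (-r) 1 0).eq_zero_of_endo_eventually hE hc hy (by
    filter_upwards [hr, (chartAt E p).open_target.mem_nhds hy] with z h2 h3
    rw [endo_combination hc h3, endo, h2]
    module) q
  have h2 : (-r) • K.g q + (1 : ℝ) • a q + (0 : ℝ) • a q = 0 := h1
  rw [one_smul, zero_smul, add_zero, neg_smul, neg_add_eq_zero] at h2
  exact h2.symm

end Connected

end KahlerStructure

end Kahler
end

/-! ### From the degree of mobility to independent pairs, and the theorem. -/

noncomputable section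

namespace Kahler

theorem exists_notMem_span_pair {V : Type*} [AddCommGroup V] [Module ℝ V]
    (h : 3 ≤ Module.rank ℝ V) (u v : V) : ∃ w, w ∉ Submodule.span ℝ {u, v} := by
  by_contra! hn
  have h1 : Submodule.span ℝ {u, v} = ⊤ := Submodule.eq_top_iff'.mpr hn
  have h2 : Module.rank ℝ V ≤ 2 := by
    rw [← rank_top ℝ V, ← h1]
    refine (rank_span_le _).trans ((Cardinal.mk_insert_le).trans ?_)
    rw [Cardinal.mk_singleton, one_add_one_eq_two]
  have h3 : (3 : Cardinal) ≤ 2 := h.trans h2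
  exact absurd h3 (by norm_num)

namespace KahlerStructure

set_option synthInstance.maxHeartbeats 400000
set_option maxSynthPendingDepth 3

variable {E : Type*} [NormedAddCommGroup E] [NormedSpace ℝ E] [FiniteDimensional ℝ E]
  {M : Type*} [TopologicalSpace M] [ChartedSpace E M] [IsManifold 𝓘(ℝ, E) ∞ M]
  {K : KahlerStructure E M} {a A s : BilinField E M}

omit [FiniteDimensional ℝ E] in
theorem exists_metric_ne_zero [Nonempty M] [Nontrivial E] (K : KahlerStructure E M) :
    ∃ p, K.g p ≠ 0 := by
  obtain ⟨p⟩ := ‹Nonempty M›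
  obtain ⟨u, hu⟩ := exists_ne (0 : E)
  refine ⟨p, fun h ↦ hu (K.g_nondegenerate p u fun v ↦ ?_)⟩
  rw [h]
  rfl

/-- If the degree of mobility is at least `3`, there are two solutions independent together
with the metric. -/
theorem exists_isGenericPair [Nonempty M] [Nontrivial E] (hD : 3 ≤ K.degreeOfMobility) :
    ∃ (a A : BilinField E M) (l L : CovectorField E M), K.IsSolution a l ∧ K.IsSolution A L ∧
      K.IsGenericPair a A := by
  let g' : K.solutionSpace := ⟨(K.g, fun _ ↦ 0), K.isSolution_metric⟩
  -- The repeated vector makes the span a line: `w` avoids the multiples of the metric, then `W`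
  -- avoids the plane spanned by the metric and `w`.
  obtain ⟨w, hw⟩ := exists_notMem_span_pair hD g' g'
  obtain ⟨W, hW⟩ := exists_notMem_span_pair hD g' w
  obtain ⟨⟨a, l⟩, S⟩ := w
  obtain ⟨⟨A, L⟩, S'⟩ := W
  have S : K.IsSolution a l := S
  have S' : K.IsSolution A L := S'
  refine ⟨a, A, l, L, S, S', fun x y z H ↦ ?_⟩
  -- Genericity concerns the tensors alone, while independence in the solution space concerns pairs.
  -- A solution with zero tensor has zero 1-form, which bridges the two.
  have h1 := (S.combination S' x y z).right_eq_zero H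
  have ha : x • K.g + y • a + z • A = 0 := funext H
  have hl : y • l + z • L = 0 := funext h1
  have hz : z = 0 := by
    by_contra hz
    refine hW (Submodule.mem_span_pair.mpr ⟨-(z⁻¹ * x), -(z⁻¹ * y), ?_⟩)
    refine Subtype.ext (Prod.ext ?_ ?_)
    · change -(z⁻¹ * x) • K.g + -(z⁻¹ * y) • a = A
      have h2 : A = (z⁻¹ * z) • A := by rw [inv_mul_cancel₀ hz, one_smul]
      rw [h2, ← sub_eq_zero, ← neg_eq_zero, ← smul_zero z⁻¹, ← ha]
      module
    · change -(z⁻¹ * x) • (fun _ ↦ 0 : CovectorField E M) + -(z⁻¹ * y) • l = L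
      have h2 : L = (z⁻¹ * z) • L := by rw [inv_mul_cancel₀ hz, one_smul]
      have h0 : (fun _ ↦ 0 : CovectorField E M) = 0 := rfl
      rw [h0, smul_zero, zero_add, h2, ← sub_eq_zero, ← neg_eq_zero, ← smul_zero z⁻¹, ← hl]
      module
  subst hz
  rw [zero_smul, add_zero] at ha hl
  have hy : y = 0 := by
    by_contra hy
    refine hw (Submodule.mem_span_pair.mpr ⟨-(y⁻¹ * x), 0, ?_⟩)
    refine Subtype.ext (Prod.ext ?_ ?_)
    · change -(y⁻¹ * x) • K.g + (0 : ℝ) • K.g = a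
      have h2 : a = (y⁻¹ * y) • a := by rw [inv_mul_cancel₀ hy, one_smul]
      rw [zero_smul, add_zero, h2, ← sub_eq_zero, ← neg_eq_zero, ← smul_zero y⁻¹, ← ha]
      module
    · change -(y⁻¹ * x) • (fun _ ↦ 0 : CovectorField E M) + (0 : ℝ) • (fun _ ↦ 0) = l
      have h0 : (fun _ ↦ 0 : CovectorField E M) = 0 := rfl
      rw [h0, smul_zero, zero_add, smul_zero]
      exact ((smul_eq_zero.mp hl).resolve_left hy).symm
  subst hy
  rw [zero_smul, add_zero] at ha
  refine ⟨?_, rfl, rfl⟩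
  obtain ⟨p, hp⟩ := K.exists_metric_ne_zero
  exact (smul_eq_zero.mp (congrFun ha p)).resolve_right hp

omit [FiniteDimensional ℝ E] in
theorem IsGenericPair.left_ne (h : K.IsGenericPair a A) : ¬∃ k : ℝ, ∀ p, a p = k • K.g p := by
  rintro ⟨k, hk⟩
  have h1 := h (-k) 1 0 fun p ↦ by
    change (-k) • K.g p + (1 : ℝ) • a p + (0 : ℝ) • A p = 0
    rw [hk p]
    module
  exact one_ne_zero h1.2.1

omit [FiniteDimensional ℝ E] in
/-- A tensor which is not a multiple of the metric is independent of one of two given ones. -/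
theorem IsGenericPair.exists_of_ne [Nonempty M] [Nontrivial E] (h : K.IsGenericPair a A)
    (hs : ¬∃ k : ℝ, ∀ p, s p = k • K.g p) : K.IsGenericPair a s ∨ K.IsGenericPair A s := by
  have key {b : BilinField E M} (hb : ¬∃ k : ℝ, ∀ p, b p = k • K.g p)
      (hn : ¬K.IsGenericPair b s) : ∃ x y : ℝ, y ≠ 0 ∧ s = x • K.g + y • b := by
    simp only [IsGenericPair, not_forall] at hn
    obtain ⟨x, y, z, H, hne⟩ := hn
    have H' : x • K.g + y • b + z • s = 0 := funext H
    have hz : z ≠ 0 := by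
      rintro rfl
      rw [zero_smul, add_zero] at H'
      by_cases hy : y = 0
      · subst hy
        rw [zero_smul, add_zero] at H'
        obtain ⟨p, hp⟩ := K.exists_metric_ne_zero
        exact hne ⟨(smul_eq_zero.mp (congrFun H' p)).resolve_right hp, rfl, rfl⟩
      · refine hb ⟨-(y⁻¹ * x), fun p ↦ ?_⟩
        have h2 : b p = (y⁻¹ * y) • b p := by rw [inv_mul_cancel₀ hy, one_smul]
        have h3 : x • K.g p + y • b p = 0 := congrFun H' p
        rw [h2, ← sub_eq_zero, ← smul_zero y⁻¹, ← h3]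
        module
    have h2 : s = (-(z⁻¹ * x)) • K.g + (-(z⁻¹ * y)) • b := by
      have h2 : s = (z⁻¹ * z) • s := by rw [inv_mul_cancel₀ hz, one_smul]
      rw [h2, ← sub_eq_zero, ← smul_zero z⁻¹, ← H']
      module
    refine ⟨_, _, fun hy ↦ hs ⟨-(z⁻¹ * x), fun p ↦ ?_⟩, h2⟩
    rw [hy, zero_smul, add_zero] at h2
    exact congrFun h2 p
  by_contra! hn
  obtain ⟨x, y, hy, h1⟩ := key h.left_ne hn.1
  obtain ⟨x', y', -, h2⟩ := key h.symm.left_ne hn.2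
  -- If `s` were dependent on the metric and `a`, and also on the metric and `A`, equating the two
  -- expressions would relate the metric, `a` and `A`.
  refine hy (h (x - x') y (-y') fun p ↦ ?_).2.1
  have h3 : x • K.g + y • a - (x' • K.g + y' • A) = 0 := by rw [← h1, ← h2, sub_self]
  refine Eq.trans (congrFun ?_ p) (congrFun h3 p)
  module

end KahlerStructure

end Kahler

end

theorem theorem3
    {E : Type*} [NormedAddCommGroup E] [NormedSpace ℝ E] [FiniteDimensional ℝ E]
    {M : Type*} [TopologicalSpace M] [T2Space M] [SecondCountableTopology M] [ConnectedSpace M]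
    [ChartedSpace E M] [IsManifold 𝓘(ℝ, E) ∞ M]
    (n : ℕ) (hn : 2 ≤ n) (hdim : Module.finrank ℝ E = 2 * n)
    (K : Kahler.KahlerStructure E M) (hD : 3 ≤ K.degreeOfMobility) :
    ∃ B : ℝ, ∀ (a : Kahler.BilinField E M) (l : Kahler.CovectorField E M),
      K.IsSolution a l → (¬ ∃ k : ℝ, ∀ p, a p = k • K.g p) →
        (∃ μ : M → ℝ, K.IsExtendedSolution a l μ B) ∧
        ∀ B' : ℝ, (∃ μ' : M → ℝ, K.IsExtendedSolution a l μ' B') → B' = B := by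
  have hE : 3 < Module.finrank ℝ E := by omega
  have : Nontrivial E := Module.nontrivial_of_finrank_pos (R := ℝ) (by omega)
  obtain ⟨a, A, l, L, S, S', h⟩ := Kahler.KahlerStructure.exists_isGenericPair hD
  obtain ⟨B, hB⟩ := h.exists_constant S S' hE
  obtain ⟨μ, hμ⟩ := S.exists_isExtendedSolution fun c hc y hy ↦ (hB c hc y hy).1
  obtain ⟨ν, hν⟩ := S'.exists_isExtendedSolution fun c hc y hy ↦ (hB c hc y hy).2
  refine ⟨B, fun s m T hs ↦ ?_⟩
  -- The pair `(b, s)` has its own constant `C`. Since `b` also satisfies the extended system with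
  -- `B`, uniqueness for `b` gives `C = B`.
  have key {b : Kahler.BilinField E M} {k : Kahler.CovectorField E M} (Q : K.IsSolution b k)
      (hb : ¬∃ r : ℝ, ∀ p, b p = r • K.g p) {ρ : M → ℝ} (hρ : K.IsExtendedSolution b k ρ B)
      (hbs : K.IsGenericPair b s) : ∃ μ : M → ℝ, K.IsExtendedSolution s m μ B := by
    obtain ⟨C, hC⟩ := hbs.exists_constant Q T hE
    obtain ⟨σ, hσ⟩ := Q.exists_isExtendedSolution fun c hc y hy ↦ (hC c hc y hy).1
    rw [← hρ.factor_unique hE hσ hb]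
    exact T.exists_isExtendedSolution fun c hc y hy ↦ (hC c hc y hy).2
  have hs' : ∃ μ : M → ℝ, K.IsExtendedSolution s m μ B := by
    rcases h.exists_of_ne hs with h1 | h1
    · exact key S h.left_ne hμ h1
    · exact key S' h.symm.left_ne hν h1
  refine ⟨hs', ?_⟩
  rintro B' ⟨μ', hμ'⟩
  obtain ⟨σ, hσ⟩ := hs'
  exact hσ.factor_unique hE hμ' hs
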